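/- An ordered binary tree is an ordered rooted tree in which every internal node has one or two children. For a sequence $W = w_1, \ldots, w_n$ of $n \ge 1$ real weights, a (binary) alphabetic minimax tree for $W$ is an ordered binary tree with $n$ leaves which, among all ordered binary trees with $n$ leaves, minimizes $\max_{1 \le i \le n} (w_i + \ell_i)$, where $\ell_1, \ldots, \ell_n$ are the depths of its leaves from left to right. Let $d$ be the number of distinct integers among $\lceil w_1 \rceil, \ldots, \lceil w_n \rceil$. **Theorem.** An alphabetic minimax tree for $W$ can be built in $O(n d \log\log n)$ time. Precisely: there are a program $P$ for the random access machine described below and constants $k$ and $C$ such that, for every $n \ge 1$ and every sequence $W$ of $n$ real weights, $P$ run on input $(n, W)$ with word bound $(n+2)^k$ halts after at most $C\, n\, d \max\{1, \log_2\log_2 n\}$ steps (the maximum is read as $1$ for $n = 1$) with an alphabetic minimax tree for $W$ in its memory. The machine has finitely many arrays of words and of real numbers, all cells initially $0$ except those holding the input; stored words are natural numbers below the word bound (so they have $O(\log n)$ bits) and serve as addresses. Each of the following takes one step: storing the value of a fixed expression, and evaluating a fixed test (for branching and loops). Word expressions use constants, array reads, $+$, truncated $-$, $\times$ and integer division; real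 expressions use array reads, words, $+$, $-$, $\lfloor\cdot\rfloor$ and $\lceil\cdot\rceil$; tests are Boolean combinations of comparisons; a real number may be rounded down (to $0$ if it is negative) and stored as a word if the result is below the word bound. The tree is output as a linked structure: a pointer to the root, pointers from each node to its children, and for each leaf its position $i$. -/

import Mathlib

/-! ### Ordered binary trees and alphabetic minimax trees -/

/-- Ordered rooted binary trees: every internal node has one or two children, listed from left to
right. -/
inductive BinTree where
  | leaf : BinTree
  | unary (t : BinTree) : BinTree
  | binary (l r : BinTree) : BinTree

namespace BinTree

/-- The number of leaves of a tree. -/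
def numLeaves : BinTree → ℕ
  | leaf => 1
  | unary t => t.numLeaves
  | binary l r => l.numLeaves + r.numLeaves

/-- The depths `ℓ₁, …, ℓₙ` of the leaves, from left to right (the root has depth `0`). -/
def depths : BinTree → List ℕ
  | leaf => [0]
  | unary t => t.depths.map (· + 1)
  | binary l r => (l.depths ++ r.depths).map (· + 1)

/-- `max_i (w_i + ℓ_i)` for a tree with `n ≥ 1` leaves (the supremum is over the finite, nonempty
index set `Fin n`, so it is a maximum). -/
noncomputable def cost {n : ℕ} (w : Fin n → ℝ) (T : BinTree) : ℝ :=
  ⨆ i : Fin n, (w i + (T.depths.getD i 0 : ℕ))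

/-- `T` is a (binary) alphabetic minimax tree for the sequence `w`: it has `n` leaves and minimizes
`max_i (w_i + ℓ_i)` among all ordered binary trees with `n` leaves. -/
def IsAlphabeticMinimax {n : ℕ} (w : Fin n → ℝ) (T : BinTree) : Prop :=
  T.numLeaves = n ∧ ∀ T' : BinTree, T'.numLeaves = n → T.cost w ≤ T'.cost w

end BinTree

/-! ### A random access machine with word arrays and real arrays

Programs are finite pieces of syntax. The memory consists of arrays of words (natural numbers) and
arrays of reals; a scalar variable is an array of which only cell `0` is used. Every word that is
stored, and every address that is stored to, has to be smaller than the bound `B` of the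
machine, which will be polynomial in the input size, so that words have `O(log n)` bits. Reals can be
added, subtracted, compared and rounded, but not multiplied or divided. -/

namespace RealRAM

/-- A memory content: `s.word a i` is cell `i` of the word array `a`, and `s.real a i` is cell `i`
of the real array `a`. -/
structure State where
  word : ℕ → ℕ → ℕ
  real : ℕ → ℕ → ℝ

namespace State

/-- Store `v` in cell `i` of the word array `a`. -/
def setWord (s : State) (a i v : ℕ) : State :=
  { s with word := Function.update s.word a (Function.update (s.word a) i v) }

/-- Store `x` in cell `i` of the real array `a`. -/
noncomputable def setReal (s : State) (a i : ℕ) (x : ℝ) : State :=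
  { s with real := Function.update s.real a (Function.update (s.real a) i x) }

end State

/-- Word expressions. Subtraction is truncated at `0`, division rounds down and gives `0` if the
divisor is `0`. -/
inductive WExpr where
  | const (c : ℕ)
  | read (a : ℕ) (i : WExpr)
  | add (e f : WExpr)
  | sub (e f : WExpr)
  | mul (e f : WExpr)
  | div (e f : WExpr)

/-- The value of a word expression. -/
def WExpr.eval (s : State) : WExpr → ℕ
  | const c => c
  | read a i => s.word a (i.eval s)
  | add e f => e.eval s + f.eval s
  | sub e f => e.eval s - f.eval s
  | mul e f => e.eval s * f.eval s
  | div e f => e.eval s / f.eval s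

/-- Real expressions. -/
inductive RExpr where
  | ofWord (e : WExpr)
  | read (a : ℕ) (i : WExpr)
  | add (e f : RExpr)
  | sub (e f : RExpr)
  | floor (e : RExpr)
  | ceil (e : RExpr)

/-- The value of a real expression. -/
noncomputable def RExpr.eval (s : State) : RExpr → ℝ
  | ofWord e => (e.eval s : ℝ)
  | read a i => s.real a (i.eval s)
  | add e f => e.eval s + f.eval s
  | sub e f => e.eval s - f.eval s
  | floor e => (⌊e.eval s⌋ : ℝ)
  | ceil e => (⌈e.eval s⌉ : ℝ)

/-- Tests. -/
inductive Cond where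
  | wordLt (e f : WExpr)
  | realLt (e f : RExpr)
  | not (c : Cond)
  | and (c d : Cond)

/-- The truth value of a test. -/
def Cond.Holds (s : State) : Cond → Prop
  | wordLt e f => e.eval s < f.eval s
  | realLt e f => e.eval s < f.eval s
  | not c => ¬ c.Holds s
  | and c d => c.Holds s ∧ d.Holds s

/-- Programs. `storeFloor a i e` rounds the real `e` down (to `0` if it is negative) and stores the
result as a word. -/
inductive Program where
  | storeWord (a : ℕ) (i e : WExpr)
  | storeReal (a : ℕ) (i : WExpr) (e : RExpr)
  | storeFloor (a : ℕ) (i : WExpr) (e : RExpr)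
  | seq (p q : Program)
  | ite (c : Cond) (p q : Program)
  | loop (c : Cond) (p : Program)

/-- `Exec B p s t s'`: on the machine with bound `B`, the program `p` started with memory `s` halts
after `t` steps with memory `s'`. Every store and every evaluation of a test is one step; the
expressions that occur in it have a size that depends only on the program. A store of a word that is
not below `B`, or to an address that is not below `B`, cannot be executed, so such a run does not
halt. `loop c p` executes `p` as long as `c` holds. -/
inductive Exec (B : ℕ) : Program → State → ℕ → State → Prop where
  | storeWord (a : ℕ) (i e : WExpr) (s : State) (hi : i.eval s < B) (he : e.eval s < B) :
      Exec B (.storeWord a i e) s 1 (s.setWord a (i.eval s) (e.eval s))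
  | storeReal (a : ℕ) (i : WExpr) (e : RExpr) (s : State) (hi : i.eval s < B) :
      Exec B (.storeReal a i e) s 1 (s.setReal a (i.eval s) (e.eval s))
  | storeFloor (a : ℕ) (i : WExpr) (e : RExpr) (s : State) (hi : i.eval s < B)
      (he : ⌊e.eval s⌋₊ < B) :
      Exec B (.storeFloor a i e) s 1 (s.setWord a (i.eval s) ⌊e.eval s⌋₊)
  | seq (p q : Program) (s₀ s₁ s₂ : State) (t₁ t₂ : ℕ)
      (hp : Exec B p s₀ t₁ s₁) (hq : Exec B q s₁ t₂ s₂) :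
      Exec B (.seq p q) s₀ (t₁ + t₂) s₂
  | iteTrue (c : Cond) (p q : Program) (s s' : State) (t : ℕ)
      (hc : c.Holds s) (hp : Exec B p s t s') :
      Exec B (.ite c p q) s (t + 1) s'
  | iteFalse (c : Cond) (p q : Program) (s s' : State) (t : ℕ)
      (hc : ¬ c.Holds s) (hq : Exec B q s t s') :
      Exec B (.ite c p q) s (t + 1) s'
  | loopTrue (c : Cond) (p : Program) (s₀ s₁ s₂ : State) (t₁ t₂ : ℕ)
      (hc : c.Holds s₀) (hp : Exec B p s₀ t₁ s₁) (hl : Exec B (.loop c p) s₁ t₂ s₂) :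
      Exec B (.loop c p) s₀ (t₁ + t₂ + 1) s₂
  | loopFalse (c : Cond) (p : Program) (s : State) (hc : ¬ c.Holds s) :
      Exec B (.loop c p) s 1 s

/-- The initial memory for the input `w`: cell `0` of word array `0` holds `n`, cells
`0, …, n - 1` of real array `0` hold the weights, and all other cells hold `0`. -/
noncomputable def inputState {n : ℕ} (w : Fin n → ℝ) : State where
  word a i := if a = 0 ∧ i = 0 then n else 0
  real a i := if h : a = 0 ∧ i < n then w ⟨i, h.2⟩ else 0

/-- The node at address `v` is the root of a stored copy of the given tree whose leaves are labelled
`k, k + 1, …` from left to right. Word arrays `1` and `2` hold the pointers to the left and the right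
child (a node with one child has only a left pointer, a leaf has none, and `0` is the null pointer),
and word array `3` holds the labels of the leaves. Since the labels of the leaves are distinct,
different nodes of the tree have different addresses. -/
def Stores (s : State) : ℕ → ℕ → BinTree → Prop
  | v, k, .leaf => s.word 1 v = 0 ∧ s.word 2 v = 0 ∧ s.word 3 v = k
  | v, k, .unary t => s.word 1 v ≠ 0 ∧ s.word 2 v = 0 ∧ Stores s (s.word 1 v) k t
  | v, k, .binary l r => s.word 1 v ≠ 0 ∧ s.word 2 v ≠ 0 ∧
      Stores s (s.word 1 v) k l ∧ Stores s (s.word 2 v) (k + l.numLeaves) r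

/-- The tree that a memory content holds as output: its root is at the address in cell `0` of word
array `0`, and its leaves are labelled `0, 1, …` from left to right. -/
def Outputs (s : State) (T : BinTree) : Prop :=
  Stores s (s.word 0 0) 0 T

end RealRAM

/-- The number `d` of distinct integers among `⌈w_1⌉, …, ⌈w_n⌉`. -/
noncomputable def numCeils {n : ℕ} (w : Fin n → ℝ) : ℕ :=
  (Finset.univ.image fun i => ⌈w i⌉).card

/-!
A tree with leaf depths `ℓ i` has cost at most `M` if and only if `ℓ i ≤ ⌊M - w i⌋` for all `i`. Write
`M = c + h - 1 + f`, where `c` is the maximum of the rounded weights `⌈w i⌉`, `h` is a natural number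
and `0 ≤ f ≤ 1`. Measuring heights from below, the root has height `n + h`, and leaf `i` has height
`n - c + ⌈w i⌉`, plus one if the fraction `F i = w i - ⌈w i⌉ + 1` exceeds the threshold `f`. A tree with
leaves of prescribed heights exists if and only if the rounded Kraft sum `kraft`, in which intervals
of length `2 ^ height` are placed from left to right at multiples of their lengths, is at most
`2 ^ (n + h)`. This is `feasible_of_tree` in one direction, and in the other one the greedy construction
of `runs_buildProg`, which keeps a stack of finished nodes and takes linear time. Hence it suffices to
find the least `h` which is feasible for `f = 1` (`runs_rootProg`, about `log log n` tests, as
`h ≤ ⌈log₂ n⌉`), and then a feasible `f` such that no fraction lies strictly between it and a smaller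
infeasible one (`isAlphabeticMinimax_of`).

The numbers in the Kraft sum are far too large for a word. A test therefore does not compute it, but
compresses the sequence of leaves on a stack of blocks `(height, count)`: a block that is lower than
both of its neighbours is merged into them, which does not change the sum (`itemSum_compress`). This
takes linear time, and in the end the sequence collapses into a single block, whose count decides the
test (`compress_test`, `runs_testProg`).

A binary search among all fractions would take `log n` tests. Let `s` be a power of two of the order of
`log n`. Sorting only blocks of size `s²` takes `O(n log log n)` steps, and sorting a sample, namely
every `s`-th entry of the blocks, takes `O(n)`. After `log₂ s` tests at entries of the sample, only
`O(n / s + s)` fractions lie strictly between the bounds for the threshold (`countP_le_of_sample`). The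
leaves with other fractions now have known heights, and compressing the sequence with them leaves
at most `O(d)` blocks after each of the remaining leaves, because the heights of the blocks between
two of them form a unimodal sequence of at most `2 d + 1` values (`good_compress`,
`Unimodal.length_le`). So the remaining `O(log n)` tests cost `O(d n / s)` each, up to lower order terms,
which is `O(n d)` in total (`running_time_le`).

Running times are established with `Runs`, a total correctness judgement whose loop rule
`Runs.loop` pays for iterations with a potential.
-/

namespace RealRAM

/-! ### Reasoning about programs -/

instance (c : ℕ) : OfNat WExpr c := ⟨.const c⟩
instance : Add WExpr := ⟨.add⟩
instance : Sub WExpr := ⟨.sub⟩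
instance : Mul WExpr := ⟨.mul⟩
instance : Div WExpr := ⟨.div⟩
instance : Add RExpr := ⟨.add⟩
instance : Sub RExpr := ⟨.sub⟩

@[simp] theorem WExpr.eval_ofNat (s : State) (c : ℕ) :
    WExpr.eval s (no_index (OfNat.ofNat c : WExpr)) = OfNat.ofNat c := rfl
@[simp] theorem WExpr.eval_read (s : State) (a : ℕ) (i : WExpr) :
    WExpr.eval s (.read a i) = s.word a (i.eval s) := rfl
@[simp] theorem WExpr.eval_add (s : State) (e f : WExpr) :
    WExpr.eval s (e + f) = e.eval s + f.eval s := rfl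
@[simp] theorem WExpr.eval_sub (s : State) (e f : WExpr) :
    WExpr.eval s (e - f) = e.eval s - f.eval s := rfl
@[simp] theorem WExpr.eval_mul (s : State) (e f : WExpr) :
    WExpr.eval s (e * f) = e.eval s * f.eval s := rfl
@[simp] theorem WExpr.eval_div (s : State) (e f : WExpr) :
    WExpr.eval s (e / f) = e.eval s / f.eval s := rfl
@[simp] theorem RExpr.eval_ofWord (s : State) (e : WExpr) :
    RExpr.eval s (.ofWord e) = (e.eval s : ℝ) := rfl
@[simp] theorem RExpr.eval_read (s : State) (a : ℕ) (i : WExpr) :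
    RExpr.eval s (.read a i) = s.real a (i.eval s) := rfl
@[simp] theorem RExpr.eval_add (s : State) (e f : RExpr) :
    RExpr.eval s (e + f) = e.eval s + f.eval s := rfl
@[simp] theorem RExpr.eval_sub (s : State) (e f : RExpr) :
    RExpr.eval s (e - f) = e.eval s - f.eval s := rfl
@[simp] theorem RExpr.eval_ceil (s : State) (e : RExpr) :
    RExpr.eval s (.ceil e) = (⌈e.eval s⌉ : ℝ) := rfl
@[simp] theorem Cond.holds_wordLt (s : State) (e f : WExpr) :
    Cond.Holds s (.wordLt e f) ↔ e.eval s < f.eval s := Iff.rfl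
@[simp] theorem Cond.holds_realLt (s : State) (e f : RExpr) :
    Cond.Holds s (.realLt e f) ↔ e.eval s < f.eval s := Iff.rfl
@[simp] theorem Cond.holds_not (s : State) (c : Cond) :
    Cond.Holds s (.not c) ↔ ¬ c.Holds s := Iff.rfl
@[simp] theorem Cond.holds_and (s : State) (c d : Cond) :
    Cond.Holds s (.and c d) ↔ c.Holds s ∧ d.Holds s := Iff.rfl

/-- The scalar word variable kept in cell `0` of the word array `a`. -/
abbrev wvar (a : ℕ) : WExpr := .read a 0

/-- The scalar real variable kept in cell `0` of the real array `a`. -/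
abbrev rvar (a : ℕ) : RExpr := .read a 0

infixr:30 " ⨾ " => Program.seq

namespace State

@[simp] theorem real_setWord (s : State) (a i v : ℕ) : (s.setWord a i v).real = s.real := rfl
@[simp] theorem word_setReal (s : State) (a i : ℕ) (x : ℝ) : (s.setReal a i x).word = s.word := rfl
@[simp] theorem word_setWord_self (s : State) (a i v : ℕ) :
    (s.setWord a i v).word a = Function.update (s.word a) i v := by simp [setWord]
@[simp] theorem real_setReal_self (s : State) (a i : ℕ) (x : ℝ) :
    (s.setReal a i x).real a = Function.update (s.real a) i x := by simp [setReal]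
@[simp] theorem word_setWord_of_ne (s : State) {a b : ℕ} (i v : ℕ) (h : b ≠ a) :
    (s.setWord a i v).word b = s.word b := by simp [setWord, h]
@[simp] theorem real_setReal_of_ne (s : State) {a b : ℕ} (i : ℕ) (x : ℝ) (h : b ≠ a) :
    (s.setReal a i x).real b = s.real b := by simp [setReal, h]

end State

namespace Program

/-- The word arrays that a program may store to. -/
def wordWrites : Program → List ℕ
  | storeWord a _ _ => [a]
  | storeReal _ _ _ => []
  | storeFloor a _ _ => [a]
  | seq p q => p.wordWrites ++ q.wordWrites
  | ite _ p q => p.wordWrites ++ q.wordWrites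
  | loop _ p => p.wordWrites

/-- The real arrays that a program may store to. -/
def realWrites : Program → List ℕ
  | storeWord _ _ _ => []
  | storeReal a _ _ => [a]
  | storeFloor _ _ _ => []
  | seq p q => p.realWrites ++ q.realWrites
  | ite _ p q => p.realWrites ++ q.realWrites
  | loop _ p => p.realWrites

end Program

theorem Exec.word_eq {B : ℕ} {p : Program} {s s' : State} {t : ℕ} (h : Exec B p s t s') {a : ℕ}
    (ha : a ∉ p.wordWrites) : s'.word a = s.word a := by
  induction h <;> simp_all [Program.wordWrites]

theorem Exec.real_eq {B : ℕ} {p : Program} {s s' : State} {t : ℕ} (h : Exec B p s t s') {a : ℕ}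
    (ha : a ∉ p.realWrites) : s'.real a = s.real a := by
  induction h <;> simp_all [Program.realWrites]

/-- From memory `s` the program halts, and its running time and final memory satisfy `Q`. -/
def Runs (B : ℕ) (p : Program) (s : State) (Q : ℕ → State → Prop) : Prop :=
  ∃ t s', Exec B p s t s' ∧ Q t s'

namespace Runs

variable {B : ℕ} {p q : Program} {s : State} {Q Q' : ℕ → State → Prop}

theorem mono (h : Runs B p s Q) (hQ : ∀ t s', Q t s' → Q' t s') : Runs B p s Q' := by
  obtain ⟨t, s', h, hq⟩ := h
  exact ⟨t, s', h, hQ _ _ hq⟩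

/-- Arrays that the program does not store to keep their contents. -/
theorem frame (h : Runs B p s Q) : Runs B p s fun t s' => Q t s' ∧
    (∀ a ∉ p.wordWrites, s'.word a = s.word a) ∧ ∀ a ∉ p.realWrites, s'.real a = s.real a := by
  obtain ⟨t, s', h, hq⟩ := h
  exact ⟨t, s', h, hq, fun a ha => h.word_eq ha, fun a ha => h.real_eq ha⟩

theorem storeWord {a : ℕ} {i e : WExpr} (hi : i.eval s < B) (he : e.eval s < B)
    (h : Q 1 (s.setWord a (i.eval s) (e.eval s))) : Runs B (.storeWord a i e) s Q :=
  ⟨_, _, .storeWord a i e s hi he, h⟩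

theorem storeReal {a : ℕ} {i : WExpr} {e : RExpr} (hi : i.eval s < B)
    (h : Q 1 (s.setReal a (i.eval s) (e.eval s))) : Runs B (.storeReal a i e) s Q :=
  ⟨_, _, .storeReal a i e s hi, h⟩

theorem storeFloor {a : ℕ} {i : WExpr} {e : RExpr} (hi : i.eval s < B) (he : ⌊e.eval s⌋₊ < B)
    (h : Q 1 (s.setWord a (i.eval s) ⌊e.eval s⌋₊)) : Runs B (.storeFloor a i e) s Q :=
  ⟨_, _, .storeFloor a i e s hi he, h⟩

theorem seq (h : Runs B p s fun t s' => Runs B q s' fun u s'' => Q (t + u) s'') :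
    Runs B (p ⨾ q) s Q := by
  obtain ⟨t, s', h, u, s'', h', hq⟩ := h
  exact ⟨_, _, .seq _ _ _ _ _ _ _ h h', hq⟩

theorem ite {c : Cond} (h : c.Holds s → Runs B p s fun t => Q (t + 1))
    (h' : ¬ c.Holds s → Runs B q s fun t => Q (t + 1)) : Runs B (.ite c p q) s Q := by
  by_cases hc : c.Holds s
  · obtain ⟨t, s', h, hq⟩ := h hc
    exact ⟨_, _, .iteTrue _ _ _ _ _ _ hc h, hq⟩
  · obtain ⟨t, s', h, hq⟩ := h' hc
    exact ⟨_, _, .iteFalse _ _ _ _ _ _ hc h, hq⟩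

/-- The rule for loops: `R g s` says that the memory `s` represents the abstract value `g`, and the
potential `φ g` pays for the remaining steps. -/
theorem loop {G : Type*} {R : G → State → Prop} {φ : G → ℕ} {c : Cond} {g : G} (hg : R g s)
    (hstep : ∀ g s, R g s → c.Holds s →
      Runs B p s fun t s' => ∃ g', R g' s' ∧ t + 1 + φ g' ≤ φ g) :
    Runs B (.loop c p) s fun t s' => ∃ g', R g' s' ∧ ¬ c.Holds s' ∧ t + φ g' ≤ φ g + 1 := by
  induction hn : φ g using Nat.strong_induction_on generalizing g s with
  | _ n ih =>
    by_cases hc : c.Holds s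
    · obtain ⟨t, s', h, g', hg', ht⟩ := hstep g s hg hc
      obtain ⟨u, s'', h', g'', hg'', hc', hu⟩ := ih (φ g') (by omega) hg' rfl
      exact ⟨_, _, .loopTrue _ _ _ _ _ _ _ hc h h', g'', hg'', hc', by omega⟩
    · exact ⟨_, _, .loopFalse _ _ _ hc, g, hg, hc, by omega⟩

end Runs

end RealRAM

/-! ### Rounding up to multiples of powers of two -/

/-- The least multiple of `2 ^ k` that is at least `x`. -/
def roundUp (k x : ℕ) : ℕ := (x + (2 ^ k - 1)) / 2 ^ k * 2 ^ k

theorem dvd_roundUp (k x : ℕ) : 2 ^ k ∣ roundUp k x := Dvd.intro_left _ rfl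

theorem roundUp_le_iff {k x y : ℕ} (h : 2 ^ k ∣ y) : roundUp k x ≤ y ↔ x ≤ y := by
  obtain ⟨z, rfl⟩ := h
  have hk : 0 < 2 ^ k := by positivity
  unfold roundUp
  rw [mul_comm (2 ^ k) z, mul_le_mul_iff_left₀ hk, ← Nat.lt_succ_iff, Nat.div_lt_iff_lt_mul hk,
    Nat.succ_mul]
  omega

theorem le_roundUp (k x : ℕ) : x ≤ roundUp k x := (roundUp_le_iff (dvd_roundUp k x)).1 le_rfl

theorem roundUp_of_dvd {k x : ℕ} (h : 2 ^ k ∣ x) : roundUp k x = x :=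
  le_antisymm ((roundUp_le_iff h).2 le_rfl) (le_roundUp k x)

theorem roundUp_mono {k x y : ℕ} (h : x ≤ y) : roundUp k x ≤ roundUp k y :=
  (roundUp_le_iff (dvd_roundUp k y)).2 (h.trans (le_roundUp k y))

theorem roundUp_le_roundUp {j k x : ℕ} (h : j ≤ k) : roundUp j x ≤ roundUp k x :=
  (roundUp_le_iff ((pow_dvd_pow 2 h).trans (dvd_roundUp k x))).2 (le_roundUp k x)

theorem roundUp_roundUp {j k x : ℕ} (h : j ≤ k) : roundUp k (roundUp j x) = roundUp k x :=
  le_antisymm ((roundUp_le_iff (dvd_roundUp k x)).2 (roundUp_le_roundUp h))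
    (roundUp_mono (le_roundUp j x))

theorem roundUp_add {k x y : ℕ} (h : 2 ^ k ∣ x) : roundUp k (x + y) = x + roundUp k y := by
  apply le_antisymm
  · exact (roundUp_le_iff (h.add (dvd_roundUp k y))).2 (Nat.add_le_add_left (le_roundUp k y) _)
  · have h1 : x ≤ roundUp k (x + y) := (Nat.le_add_right _ _).trans (le_roundUp _ _)
    have h2 : roundUp k y ≤ roundUp k (x + y) - x :=
      (roundUp_le_iff (Nat.dvd_sub (dvd_roundUp _ _) h)).2 (by
        have := le_roundUp k (x + y); omega)
    omega

theorem roundUp_mul_pow {j k c : ℕ} (h : j ≤ k) :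
    roundUp k (c * 2 ^ j) = (c + (2 ^ (k - j) - 1)) / 2 ^ (k - j) * 2 ^ k := by
  have e : 2 ^ k = 2 ^ (k - j) * 2 ^ j := by rw [← pow_add]; congr 1; omega
  have e2 : (c + (2 ^ (k - j) - 1)) / 2 ^ (k - j) * 2 ^ k = roundUp (k - j) c * 2 ^ j := by
    rw [e, ← mul_assoc]; rfl
  have hj : 0 < 2 ^ j := by positivity
  rw [e2]
  apply le_antisymm
  · refine (roundUp_le_iff ?_).2 (Nat.mul_le_mul_right _ (le_roundUp _ _))
    rw [e]
    exact Nat.mul_dvd_mul_right (dvd_roundUp _ _) _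
  · obtain ⟨z, hz⟩ := dvd_roundUp k (c * 2 ^ j)
    have h1 := le_roundUp k (c * 2 ^ j)
    rw [hz, e, mul_right_comm] at h1 ⊢
    exact Nat.mul_le_mul_right _
      ((roundUp_le_iff (Dvd.intro _ rfl)).2 (Nat.le_of_mul_le_mul_right h1 hj))

theorem roundUp_succ_two_mul (k x : ℕ) : roundUp (k + 1) (2 * x) = 2 * roundUp k x := by
  have e : 2 ^ (k + 1) = 2 * 2 ^ k := pow_succ' 2 k
  apply le_antisymm
  · exact (roundUp_le_iff (e ▸ Nat.mul_dvd_mul_left 2 (dvd_roundUp k x))).2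
      (Nat.mul_le_mul_left 2 (le_roundUp k x))
  · obtain ⟨z, hz⟩ := dvd_roundUp (k + 1) (2 * x)
    have h1 := le_roundUp (k + 1) (2 * x)
    rw [hz, e, mul_assoc] at h1 ⊢
    exact Nat.mul_le_mul_left 2 ((roundUp_le_iff (Dvd.intro _ rfl)).2 (by omega))

/-! ### The generalized Kraft sum -/

/-- The rounded Kraft sum: starting at `x`, place intervals of the lengths `2 ^ k`, for the heights
`k` in the list, one after the other from left to right, each at a multiple of its length. -/
def kraft (x : ℕ) (ks : List ℕ) : ℕ := ks.foldl (fun x k => roundUp k x + 2 ^ k) x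

@[simp] theorem kraft_nil (x : ℕ) : kraft x [] = x := rfl
@[simp] theorem kraft_cons (x k : ℕ) (ks : List ℕ) :
    kraft x (k :: ks) = kraft (roundUp k x + 2 ^ k) ks := rfl
theorem kraft_append (x : ℕ) (ks ls : List ℕ) : kraft x (ks ++ ls) = kraft (kraft x ks) ls :=
  List.foldl_append

theorem le_kraft (x : ℕ) (ks : List ℕ) : x ≤ kraft x ks := by
  induction ks generalizing x with
  | nil => exact le_rfl
  | cons k ks ih => exact ((le_roundUp k x).trans (Nat.le_add_right _ _)).trans (ih _)

theorem kraft_mono {x y : ℕ} (h : x ≤ y) {ks ls : List ℕ} (hk : List.Forall₂ (· ≤ ·) ks ls) :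
    kraft x ks ≤ kraft y ls := by
  induction hk generalizing x y with
  | nil => exact h
  | cons hk _ ih =>
    exact ih (Nat.add_le_add ((roundUp_mono h).trans (roundUp_le_roundUp hk))
      (Nat.pow_le_pow_right two_pos hk))

theorem kraft_mono_left {x y : ℕ} (h : x ≤ y) (ks : List ℕ) : kraft x ks ≤ kraft y ks :=
  kraft_mono h (List.forall₂_same.2 fun _ _ => le_rfl)

theorem kraft_two_mul (x : ℕ) (ks : List ℕ) : kraft (2 * x) (ks.map (· + 1)) = 2 * kraft x ks := by
  induction ks generalizing x with
  | nil => rfl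
  | cons k ks ih =>
    rw [List.map_cons, kraft_cons, roundUp_succ_two_mul, pow_succ', ← Nat.mul_add, ih, kraft_cons]

theorem kraft_add {R : ℕ} (x : ℕ) {ks : List ℕ} (h : ∀ k ∈ ks, k ≤ R) :
    kraft (2 ^ R + x) ks = 2 ^ R + kraft x ks := by
  induction ks generalizing x with
  | nil => rfl
  | cons k ks ih =>
    rw [kraft_cons, roundUp_add (pow_dvd_pow 2 (h k (by simp))), Nat.add_assoc,
      ih _ fun j hj => h j (by simp [hj]), kraft_cons]

theorem kraft_le {H x y : ℕ} {ks : List ℕ} (h : ∀ k ∈ ks, k ≤ H) (hy : 2 ^ H ∣ y) (hxy : x ≤ y) :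
    kraft x ks ≤ y + ks.length * 2 ^ H := by
  induction ks generalizing x y with
  | nil => simpa using hxy
  | cons k ks ih =>
    have hk := h k (by simp)
    have h1 : roundUp k x ≤ y := (roundUp_le_iff ((pow_dvd_pow 2 hk).trans hy)).2 hxy
    have h2 : 2 ^ k ≤ 2 ^ H := Nat.pow_le_pow_right two_pos hk
    rw [kraft_cons, List.length_cons, Nat.succ_mul, Nat.add_comm (_ * _), ← Nat.add_assoc]
    exact ih (fun j hj => h j (by simp [hj])) (hy.add (dvd_refl _)) (Nat.add_le_add h1 h2)

/-- A leaf above the height `R` is rounded up to a multiple of `2 ^ (R + 1)`, which exceeds `0` if the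
sum starts beyond `0`, and takes at least as much again. -/
theorem four_mul_two_pow_le_kraft {R x : ℕ} {ks : List ℕ} (hx : 0 < x) (h : ∃ k ∈ ks, R < k) :
    4 * 2 ^ R ≤ kraft x ks := by
  induction ks generalizing x with
  | nil => simp at h
  | cons k ks ih =>
    by_cases hk : R < k
    · have h1 : 2 ^ (R + 1) ≤ 2 ^ k := Nat.pow_le_pow_right two_pos hk
      have h2 : 2 ^ k ≤ roundUp k x :=
        Nat.le_of_dvd (hx.trans_le (le_roundUp k x)) (dvd_roundUp k x)
      have h3 := le_kraft (roundUp k x + 2 ^ k) ks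
      rw [kraft_cons]
      rw [pow_succ] at h1
      omega
    · refine ih (by positivity) ?_
      simpa [hk] using h

namespace BinTree

theorem numLeaves_pos (T : BinTree) : 0 < T.numLeaves := by
  induction T <;> simp_all [numLeaves]

@[simp] theorem length_depths (T : BinTree) : T.depths.length = T.numLeaves := by
  induction T <;> simp_all [depths, numLeaves]

/-- The necessity of the Kraft condition: a tree whose leaves have at least the given heights, and
whose root has height `R`, occupies an interval of length `2 ^ R`. -/
theorem kraft_le_of_tree (T : BinTree) {R x : ℕ} {ks : List ℕ} (hx : 2 ^ R ∣ x)
    (h : List.Forall₂ (fun l k => l + k ≤ R) T.depths ks) : kraft x ks ≤ x + 2 ^ R := by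
  induction T generalizing R x ks with
  | leaf =>
    rw [depths, List.forall₂_cons_left_iff] at h
    obtain ⟨k, _, hk, h, rfl⟩ := h
    rw [List.forall₂_nil_left_iff] at h
    subst h
    have hk : k ≤ R := by omega
    rw [kraft_cons, kraft_nil, roundUp_of_dvd ((pow_dvd_pow 2 hk).trans hx)]
    exact Nat.add_le_add_left (Nat.pow_le_pow_right two_pos hk) _
  | unary T ih =>
    rw [depths, List.forall₂_map_left_iff] at h
    obtain ⟨R, rfl⟩ : ∃ S, R = S + 1 := by
      cases R with
      | zero =>
        have hl := numLeaves_pos T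
        rw [← length_depths] at hl
        obtain ⟨a, l, hal⟩ := List.exists_cons_of_length_pos hl
        rw [hal] at h
        cases h with
        | cons h _ => omega
      | succ S => exact ⟨S, rfl⟩
    have := ih ((pow_dvd_pow 2 (Nat.le_succ R)).trans hx) (h.imp fun a b hab => by omega)
    rw [pow_succ]
    omega
  | binary T U ihT ihU =>
    rw [depths, List.forall₂_map_left_iff] at h
    obtain ⟨R, rfl⟩ : ∃ S, R = S + 1 := by
      cases R with
      | zero =>
        have hl := numLeaves_pos T
        rw [← length_depths] at hl
        obtain ⟨a, l, hal⟩ := List.exists_cons_of_length_pos hl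
        rw [hal] at h
        cases h with
        | cons h _ => omega
      | succ S => exact ⟨S, rfl⟩
    have h' : List.Forall₂ (fun l k => l + k ≤ R) (T.depths ++ U.depths) ks :=
      h.imp fun a b hab => by omega
    have h₁ := List.forall₂_take T.depths.length h'
    have h₂ := List.forall₂_drop T.depths.length h'
    rw [List.take_left] at h₁
    rw [List.drop_left] at h₂
    have hR : 2 ^ R ∣ x := (pow_dvd_pow 2 (Nat.le_succ R)).trans hx
    have a1 := ihT hR h₁
    have a2 := ihU (hR.add (dvd_refl _)) h₂
    have a3 := kraft_mono_left a1 (ks.drop T.depths.length)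
    rw [← List.take_append_drop T.depths.length ks, kraft_append, pow_succ]
    omega

/-- The tree without its nodes with one child. -/
def contract : BinTree → BinTree
  | leaf => leaf
  | unary t => t.contract
  | binary l r => binary l.contract r.contract

@[simp] theorem numLeaves_contract (T : BinTree) : T.contract.numLeaves = T.numLeaves := by
  induction T <;> simp_all [contract, numLeaves]

theorem depths_contract (T : BinTree) :
    List.Forall₂ (fun a b => a ≤ b ∧ a < T.numLeaves) T.contract.depths T.depths := by
  induction T with
  | leaf => simp [contract, depths, numLeaves]
  | unary t ih =>
    rw [contract, depths, List.forall₂_map_right_iff]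
    exact ih.imp fun a b h => ⟨by omega, h.2⟩
  | binary l r ihl ihr =>
    rw [contract, depths, depths, List.forall₂_map_right_iff, List.forall₂_map_left_iff]
    have hl := numLeaves_pos l
    have hr := numLeaves_pos r
    refine List.rel_append (ihl.imp fun a b h => ?_) (ihr.imp fun a b h => ?_) <;>
      simp only [numLeaves] <;> omega

end BinTree

/-! ### Weighted items and their compression -/

/-- An item `(k, m, F)` stands for `m` consecutive leaves, whose height is `k` if the threshold is
at least `F`, and `k + 1` otherwise. Lists of items start with the rightmost item. -/
abbrev Item := ℕ × ℕ × ℝ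

/-- The height of the leaves of an item for the threshold `f`. -/
noncomputable def Item.height (f : ℝ) (e : Item) : ℕ := e.1 + if f < e.2.2 then 1 else 0

/-- The rounded Kraft sum of a list of items for the threshold `f`. -/
noncomputable def itemSum (f : ℝ) : List Item → ℕ
  | [] => 0
  | e :: l => roundUp (e.height f) (itemSum f l) + e.2.1 * 2 ^ e.height f

/-- The rounded Kraft sum, started at `x`, of a list of pairs `(k, m)`, the rightmost first: `m`
leaves of height `k`. -/
def blockSum (x : ℕ) : List (ℕ × ℕ) → ℕ
  | [] => x
  | e :: l => roundUp e.1 (blockSum x l) + e.2 * 2 ^ e.1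

/-- The number of nodes of height `k + j` that `c` consecutive nodes of height `k` give rise to. -/
def shrink (c j : ℕ) : ℕ := (c + (2 ^ j - 1)) / 2 ^ j

theorem shrink_le (c j : ℕ) : shrink c j ≤ c := by
  unfold shrink
  have : 0 < 2 ^ j := by positivity
  rcases Nat.eq_zero_or_pos c with rfl | hc
  · rw [Nat.div_eq_of_lt (by omega)]
  · rw [← Nat.lt_succ_iff, Nat.div_lt_iff_lt_mul this, Nat.succ_mul]
    have := Nat.le_mul_of_pos_right c this
    omega

theorem shrink_pos {c : ℕ} (j : ℕ) (hc : 0 < c) : 0 < shrink c j :=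
  Nat.div_pos (by omega) (by positivity)

/-- The powers of two only matter up to a bound for the counts. -/
theorem shrink_eq_min {c j b : ℕ} (hc : 0 < c) (hb : c ≤ b) :
    shrink c j = (c + min (2 ^ j) b - 1) / min (2 ^ j) b := by
  rcases le_total (2 ^ j) b with h | h
  · rw [min_eq_left h, shrink]
    congr 1
    have : 0 < 2 ^ j := by positivity
    omega
  · rw [min_eq_right h, shrink, Nat.div_eq_of_lt_le (k := 1), Nat.div_eq_of_lt_le (k := 1)] <;> omega

/-- Make the pairs left of a new leaf of height `b` disappear into larger ones. The rightmost pair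
`(t, c)` is merged while both the new leaf and the next pair are of larger height. -/
def absorb (b : ℕ) (t c : ℕ) : List (ℕ × ℕ) → List (ℕ × ℕ)
  | [] => [(t, c)]
  | (u, d) :: l =>
    if t < b ∧ t < u then
      if u ≤ b then absorb b u (d + shrink c (u - t)) l
      else (b, shrink c (b - t)) :: (u, d) :: l
    else (t, c) :: (u, d) :: l

/-- `absorb` for a possibly empty list. -/
def absorbTop (b : ℕ) : List (ℕ × ℕ) → List (ℕ × ℕ)
  | [] => []
  | (t, c) :: l => absorb b t c l

/-- Append `m` leaves of height `b` at the right. -/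
def pushTop (b m : ℕ) : List (ℕ × ℕ) → List (ℕ × ℕ)
  | [] => [(b, m)]
  | (t, c) :: l => if t = b then (t, c + m) :: l else (b, m) :: (t, c) :: l

/-- The arithmetic of `absorb`: if `c` intervals of length `2 ^ t` lie between a multiple of `2 ^ u` and an
interval of length `2 ^ b`, both longer, then intervals of length `2 ^ min u b` can replace them. -/
theorem roundUp_merge {b t u c : ℕ} (x : ℕ) (htb : t < b) (htu : t < u) (hx : 2 ^ u ∣ x) :
    roundUp b (roundUp t x + c * 2 ^ t)
      = roundUp b (roundUp (min u b) x + shrink c (min u b - t) * 2 ^ min u b) := by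
  have hv : t ≤ min u b := by omega
  have h1 : 2 ^ min u b ∣ x := (pow_dvd_pow 2 (min_le_left _ _)).trans hx
  rw [roundUp_of_dvd ((pow_dvd_pow 2 hv).trans h1), roundUp_of_dvd h1,
    ← roundUp_roundUp (min_le_right u b), roundUp_add h1, roundUp_mul_pow hv]
  rfl

theorem roundUp_blockSum_absorb (x b t c : ℕ) (l : List (ℕ × ℕ)) :
    roundUp b (blockSum x (absorb b t c l)) = roundUp b (blockSum x ((t, c) :: l)) := by
  induction l generalizing t c with
  | nil => rfl
  | cons e l ih =>
    obtain ⟨u, d⟩ := e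
    rw [absorb]
    split_ifs with h1 h2
    · rw [ih, blockSum, blockSum, blockSum, roundUp_merge _ h1.1 h1.2
        ((dvd_roundUp _ _).add (Dvd.intro_left _ rfl)), min_eq_left h2]
      simp only
      rw [roundUp_of_dvd (((dvd_roundUp u _)).add (Dvd.intro_left d rfl)), Nat.add_mul,
        Nat.add_assoc]
    · simp only [blockSum]
      rw [roundUp_merge _ h1.1 h1.2
        ((dvd_roundUp _ _).add (Dvd.intro_left _ rfl)), min_eq_right (by omega)]
    · rfl

theorem blockSum_pushTop_absorbTop (x b m : ℕ) (l : List (ℕ × ℕ)) :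
    blockSum x (pushTop b m (absorbTop b l)) = roundUp b (blockSum x l) + m * 2 ^ b := by
  have key : ∀ l, blockSum x (pushTop b m l) = roundUp b (blockSum x l) + m * 2 ^ b := by
    rintro (_ | ⟨⟨t, c⟩, l⟩)
    · rfl
    · rw [pushTop]
      split_ifs with h
      · subst h
        simp only [blockSum]
        rw [roundUp_of_dvd ((dvd_roundUp _ _).add (Dvd.intro_left _ rfl))]
        ring
      · rfl
  rw [key]
  cases l with
  | nil => rfl
  | cons e l => rw [absorbTop, roundUp_blockSum_absorb]

/-- The sequence increases strictly up to some position and decreases strictly from there on. -/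
def Unimodal : List ℕ → Prop
  | [] => True
  | [_] => True
  | x :: y :: l => Unimodal (y :: l) ∧ (x < y ∨ y < x ∧ (y :: l).Pairwise (· > ·))

theorem Unimodal.exists_append {l : List ℕ} (h : Unimodal l) :
    ∃ l₁ l₂, l = l₁ ++ l₂ ∧ l₁.Pairwise (· < ·) ∧ l₂.Pairwise (· > ·) := by
  induction l with
  | nil => exact ⟨[], [], rfl, .nil, .nil⟩
  | cons x l ih =>
    cases l with
    | nil => exact ⟨[x], [], rfl, by simp, .nil⟩
    | cons y l =>
      obtain ⟨h1, h2 | ⟨h2, h3⟩⟩ := h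
      · obtain ⟨l₁, l₂, e, p1, p2⟩ := ih h1
        cases l₁ with
        | nil => exact ⟨[x], l₂, by rw [e]; rfl, by simp, p2⟩
        | cons z l₁ =>
          obtain rfl : y = z := by simpa using congrArg List.head? e
          refine ⟨x :: y :: l₁, l₂, by rw [e]; rfl, ?_, p2⟩
          refine List.pairwise_cons.2 ⟨fun a ha => ?_, p1⟩
          rcases List.mem_cons.1 ha with rfl | ha
          · exact h2
          · exact h2.trans ((List.pairwise_cons.1 p1).1 a ha)
      · refine ⟨[], x :: y :: l, rfl, .nil, List.pairwise_cons.2 ⟨fun a ha => ?_, h3⟩⟩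
        rcases List.mem_cons.1 ha with rfl | ha
        · exact h2
        · exact ((List.pairwise_cons.1 h3).1 a ha).trans h2

/-- A unimodal sequence takes every value at most twice. So compressed blocks are few if there are few
different heights. -/
theorem Unimodal.length_le {l : List ℕ} (h : Unimodal l) {Λ : Finset ℕ} (hl : ∀ x ∈ l, x ∈ Λ) :
    l.length ≤ 2 * Λ.card := by
  obtain ⟨l₁, l₂, rfl, h1, h2⟩ := h.exists_append
  have n1 : l₁.Nodup := h1.imp fun h => h.ne
  have n2 : l₂.Nodup := h2.imp fun h => h.ne'
  have c1 := Finset.card_le_card (s := l₁.toFinset) (t := Λ) fun x hx => hl x (by simp_all)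
  have c2 := Finset.card_le_card (s := l₂.toFinset) (t := Λ) fun x hx => hl x (by simp_all)
  rw [List.toFinset_card_of_nodup n1] at c1
  rw [List.toFinset_card_of_nodup n2] at c2
  rw [List.length_append]
  omega

/-- `absorb` yields a list starting with some `(t', c')` which is ready for a leaf of height `b`. -/
theorem unimodal_absorb {b t c : ℕ} {l : List (ℕ × ℕ)}
    (h : Unimodal (((t, c) :: l).map Prod.fst)) :
    ∃ t' c' l', absorb b t c l = (t', c') :: l' ∧ Unimodal (t' :: l'.map Prod.fst) ∧
      (t' < b → (t' :: l'.map Prod.fst).Pairwise (· > ·)) := by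
  induction l generalizing t c with
  | nil => exact ⟨t, c, [], rfl, trivial, fun _ => by simp⟩
  | cons e l ih =>
    obtain ⟨u, d⟩ := e
    rw [absorb]
    split_ifs with h1 h2
    · exact ih h.1
    · exact ⟨_, _, _, rfl, ⟨h.1, .inl (by omega)⟩, fun h => absurd h (lt_irrefl _)⟩
    · refine ⟨_, _, _, rfl, h, fun htb => ?_⟩
      obtain ⟨h3, h4 | ⟨h4, h5⟩⟩ := h
      · exact absurd ⟨htb, h4⟩ h1
      · refine List.pairwise_cons.2 ⟨fun a ha => ?_, h5⟩
        rcases List.mem_cons.1 ha with rfl | ha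
        · exact h4
        · exact ((List.pairwise_cons.1 h5).1 a ha).trans h4

theorem unimodal_pushTop_absorbTop {b m : ℕ} {l : List (ℕ × ℕ)} (h : Unimodal (l.map Prod.fst)) :
    Unimodal ((pushTop b m (absorbTop b l)).map Prod.fst) := by
  cases l with
  | nil => trivial
  | cons e l =>
    obtain ⟨t, c, l', e, h1, h2⟩ := unimodal_absorb (b := b) h
    rw [absorbTop, e, pushTop]
    split_ifs with htb
    · exact h1
    · refine ⟨h1, ?_⟩
      rcases lt_or_gt_of_ne htb with h3 | h3
      · exact .inr ⟨h3, h2 h3⟩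
      · exact .inl h3

theorem fst_mem_absorb {b t c : ℕ} {l : List (ℕ × ℕ)} {Λ : Finset ℕ} (hb : b ∈ Λ) (ht : t ∈ Λ)
    (h : ∀ e ∈ l, e.1 ∈ Λ) : ∀ e ∈ absorb b t c l, e.1 ∈ Λ := by
  induction l generalizing t c with
  | nil => simpa [absorb] using ht
  | cons e l ih =>
    obtain ⟨u, d⟩ := e
    simp only [List.forall_mem_cons] at h
    rw [absorb]
    split_ifs with h1 h2
    · exact ih h.1 h.2
    · simpa [hb] using h
    · simpa [ht] using h

theorem snd_pos_absorb {b t c : ℕ} {l : List (ℕ × ℕ)} (hc : 0 < c)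
    (h : ∀ e ∈ l, 0 < e.2) : ∀ e ∈ absorb b t c l, 0 < e.2 := by
  induction l generalizing t c with
  | nil => simpa [absorb] using hc
  | cons e l ih =>
    obtain ⟨u, d⟩ := e
    simp only [List.forall_mem_cons] at h
    rw [absorb]
    split_ifs with h1 h2
    · exact ih (by have := h.1; omega) h.2
    · simpa [shrink_pos _ hc] using h
    · simpa [hc] using h

theorem sum_snd_absorb_le (b t c : ℕ) (l : List (ℕ × ℕ)) :
    ((absorb b t c l).map Prod.snd).sum ≤ c + (l.map Prod.snd).sum := by
  induction l generalizing t c with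
  | nil => simp [absorb]
  | cons e l ih =>
    obtain ⟨u, d⟩ := e
    rw [absorb]
    split_ifs with h1 h2
    · have := ih u (d + shrink c (u - t))
      have := shrink_le c (u - t)
      simp only [List.map_cons, List.sum_cons]
      omega
    · have := shrink_le c (b - t)
      simp only [List.map_cons, List.sum_cons]
      omega
    · simp

theorem absorb_ne_nil (b t c : ℕ) (l : List (ℕ × ℕ)) : absorb b t c l ≠ [] := by
  induction l generalizing t c with
  | nil => simp [absorb]
  | cons e l ih =>
    rw [absorb]
    split_ifs
    · exact ih _ _
    · simp
    · simp

/-- The leftmost height never changes. -/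
theorem getLast?_absorb (b t c : ℕ) (l : List (ℕ × ℕ)) :
    ((absorb b t c l).map Prod.fst).getLast? = (t :: l.map Prod.fst).getLast? := by
  induction l generalizing t c with
  | nil => simp [absorb]
  | cons e l ih =>
    obtain ⟨u, d⟩ := e
    rw [absorb]
    split_ifs
    · rw [ih]; simp
    · simp
    · simp

/-- A compressed sequence: first the blocks of known height to the right of the last item whose
height is not yet known, then all the other items. -/
abbrev Compressed := List (ℕ × ℕ) × List Item

namespace Compressed

/-- The items that a compressed sequence consists of. -/
def items (q : Compressed) : List Item := q.1.map (fun e => (e.1, e.2, (0 : ℝ))) ++ q.2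

open Classical in
/-- Append an item at the right. Its height is not known if its `F` lies strictly between the bounds
`lo` and `hi` for the threshold. -/
noncomputable def push (lo hi : ℝ) (q : Compressed) (e : Item) : Compressed :=
  if lo < e.2.2 ∧ e.2.2 < hi then ([], e :: q.items)
  else (pushTop (e.height lo) e.2.1 (absorbTop (e.height lo) q.1), q.2)

end Compressed

open Compressed

/-- The compression of a list of items, given bounds for the threshold. -/
noncomputable def compress (lo hi : ℝ) : List Item → Compressed
  | [] => ([], [])
  | e :: l => (compress lo hi l).push lo hi e

theorem itemSum_items {f : ℝ} (hf : 0 ≤ f) (q : Compressed) :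
    itemSum f q.items = blockSum (itemSum f q.2) q.1 := by
  obtain ⟨l, d⟩ := q
  induction l with
  | nil => rfl
  | cons e l ih =>
    simp only [items] at ih
    simp only [items, List.map_cons, List.cons_append, itemSum, blockSum, ih, Item.height,
      not_lt.2 hf, if_false, Nat.add_zero]

/-- Compression does not change the rounded Kraft sum for the thresholds between the bounds. -/
theorem itemSum_compress {lo hi f : ℝ} (hlo : 0 ≤ lo) (hf : lo ≤ f) (hf' : f < hi ∨ f = lo)
    (l : List Item) : itemSum f (compress lo hi l).items = itemSum f l := by
  have h0 : 0 ≤ f := hlo.trans hf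
  induction l with
  | nil => rfl
  | cons e l ih =>
    rw [compress, push]
    split_ifs with h
    · simp [items, itemSum, ← ih]
    · have : e.height lo = e.height f := by
        simp only [Item.height]
        congr 1
        by_cases h1 : lo < e.2.2
        · have h2 : f < e.2.2 := by
            rcases hf' with h3 | rfl
            · exact h3.trans_le (not_lt.1 fun h4 => h ⟨h1, h4⟩)
            · exact h1
          simp [h1, h2]
        · simp [h1, not_lt.2 ((not_lt.1 h1).trans hf)]
      rw [itemSum_items h0, blockSum_pushTop_absorbTop, this, itemSum, ← ih, itemSum_items h0]

/-- What holds of every compression of `l`; here `Λ` contains all heights that are possible. -/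
structure Compressed.Good (lo hi : ℝ) (Λ : Finset ℕ) (l : List Item) (q : Compressed) : Prop where
  unimodal : Unimodal (q.1.map Prod.fst)
  mem : ∀ e ∈ q.items, e.1 ∈ Λ ∧ (0 < e.2.2 → e.1 + 1 ∈ Λ)
  pos : ∀ e ∈ q.items, 0 < e.2.1
  sum_le : (q.items.map (·.2.1)).sum ≤ (l.map (·.2.1)).sum
  length_le : q.2.length ≤
    l.countP (fun e => lo < e.2.2 ∧ e.2.2 < hi) * (2 * Λ.card + 1)
  getLast : ∀ R m, l.getLast? = some (R, m, 0) → ∃ m', q.items.getLast? = some (R, m', 0)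
  head : ∀ R m, l.head? = some (R, m, 0) → ∃ m' l', q.1 = (R, m') :: l'

theorem forall_mem_items {q : Compressed} {P : Item → Prop} :
    (∀ e ∈ q.items, P e) ↔ (∀ e ∈ q.1, P (e.1, e.2, 0)) ∧ ∀ e ∈ q.2, P e := by
  simp only [items, List.mem_append, List.mem_map]
  constructor
  · exact fun h => ⟨fun e he => h _ (.inl ⟨e, he, rfl⟩), fun e he => h e (.inr he)⟩
  · rintro ⟨h1, h2⟩ e (⟨a, ha, rfl⟩ | he)
    · exact h1 a ha
    · exact h2 e he

theorem forall_mem_pushTop {b m : ℕ} {l : List (ℕ × ℕ)} {P : ℕ × ℕ → Prop} (hbm : P (b, m))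
    (h : ∀ e ∈ l, P e) (hadd : ∀ c, P (b, c) → P (b, c + m)) : ∀ e ∈ pushTop b m l, P e := by
  cases l with
  | nil => simpa [pushTop] using hbm
  | cons e l =>
    obtain ⟨t, c⟩ := e
    simp only [List.forall_mem_cons] at h
    rw [pushTop]
    split_ifs with htb
    · subst htb
      simp only [List.forall_mem_cons]
      exact ⟨hadd c h.1, h.2⟩
    · simp only [List.forall_mem_cons]
      exact ⟨hbm, h⟩

theorem sum_snd_pushTop (b m : ℕ) (l : List (ℕ × ℕ)) :
    ((pushTop b m l).map Prod.snd).sum = m + (l.map Prod.snd).sum := by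
  cases l with
  | nil => simp [pushTop]
  | cons e l =>
    rw [pushTop]
    split_ifs
    · simp only [List.map_cons, List.sum_cons]; omega
    · simp

theorem exists_pushTop (b m : ℕ) (l : List (ℕ × ℕ)) :
    ∃ m' l', pushTop b m l = (b, m') :: l' := by
  cases l with
  | nil => exact ⟨_, _, rfl⟩
  | cons e l =>
    rw [pushTop]
    split_ifs with h
    · exact ⟨_, _, by rw [h]⟩
    · exact ⟨_, _, rfl⟩

theorem getLast?_pushTop {b m : ℕ} {l : List (ℕ × ℕ)} (h : l ≠ []) :
    ((pushTop b m l).map Prod.fst).getLast? = (l.map Prod.fst).getLast? := by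
  cases l with
  | nil => exact absurd rfl h
  | cons e l =>
    rw [pushTop]
    split_ifs with h <;> simp

theorem sum_items (q : Compressed) : (q.items.map (·.2.1)).sum
    = (q.1.map Prod.snd).sum + (q.2.map (·.2.1)).sum := by
  simp only [items, List.map_append, List.map_map, List.sum_append]
  rfl

/-- The length of the compressed sequence is bounded by the number of items of unknown height, each of
which is followed by a unimodal sequence of blocks. -/
theorem good_compress {lo hi : ℝ} (hlo : 0 ≤ lo) {Λ : Finset ℕ} {l : List Item}
    (hΛ : ∀ e ∈ l, e.1 ∈ Λ ∧ (0 < e.2.2 → e.1 + 1 ∈ Λ)) (hpos : ∀ e ∈ l, 0 < e.2.1) :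
    Good lo hi Λ l (compress lo hi l) := by
  classical
  induction l with
  | nil => exact ⟨trivial, by simp [items, compress], by simp [items, compress],
      by simp [items, compress], by simp [compress], by simp, by simp⟩
  | cons e l ih =>
    simp only [List.forall_mem_cons] at hΛ hpos
    specialize ih hΛ.2 hpos.2
    set q := compress lo hi l with hq
    have hlen1 : q.1.length ≤ 2 * Λ.card := by
      have := ih.unimodal.length_le (Λ := Λ)
      rw [List.length_map] at this
      apply this
      simp only [List.mem_map]
      rintro x ⟨e, he, rfl⟩
      exact ((forall_mem_items.1 ih.mem).1 e he).1
    rw [compress, push, ← hq]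
    split_ifs with h
    · refine ⟨trivial, ?_, ?_, ?_, ?_, ?_, ?_⟩
      · simp only [items, List.map_nil, List.nil_append, List.forall_mem_cons]
        exact ⟨hΛ.1, ih.mem⟩
      · simp only [items, List.map_nil, List.nil_append, List.forall_mem_cons]
        exact ⟨hpos.1, ih.pos⟩
      · have := ih.sum_le
        simp only [items, List.map_nil, List.nil_append, List.map_cons, List.sum_cons] at this ⊢
        omega
      · rw [List.countP_cons_of_pos (by simpa using h)]
        have := ih.length_le
        simp only [items, List.length_cons, List.length_append, List.length_map]
        rw [add_one_mul (List.countP _ l)]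
        omega
      · intro R m hl
        cases l with
        | nil =>
          obtain rfl : e = (R, m, 0) := by simpa using hl
          exact absurd h.1 (not_lt.2 hlo)
        | cons e' l =>
          obtain ⟨m', hm⟩ := ih.getLast R m (by simpa using hl)
          refine ⟨m', ?_⟩
          simp only [items] at hm
          simp only [items, List.map_nil, List.nil_append, List.getLast?_cons, hm, Option.getD_some]
      · intro R m hl
        obtain rfl : e = (R, m, 0) := by simpa using hl
        exact absurd h.1 (not_lt.2 hlo)
    · have hb : e.height lo ∈ Λ := by
        rw [Item.height]
        split_ifs with h1
        · exact hΛ.1.2 (hlo.trans_lt h1)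
        · exact hΛ.1.1
      have hmem := forall_mem_items.1 ih.mem
      have hp := forall_mem_items.1 ih.pos
      have hsum := ih.sum_le
      rw [sum_items] at hsum
      refine ⟨unimodal_pushTop_absorbTop ih.unimodal, ?_, ?_, ?_, ?_, ?_, ?_⟩
      · refine forall_mem_items.2 ⟨?_, hmem.2⟩
        refine forall_mem_pushTop (P := fun x => x.1 ∈ Λ ∧ ((0 : ℝ) < 0 → x.1 + 1 ∈ Λ))
          ⟨hb, by simp⟩ ?_ fun _ h => h
        cases hq1 : q.1 with
        | nil => simp [absorbTop]
        | cons a l' =>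
          rw [hq1] at hmem
          simp only [List.forall_mem_cons] at hmem
          exact fun e he => ⟨fst_mem_absorb hb hmem.1.1.1 (fun e he => (hmem.1.2 e he).1) e he,
            by simp⟩
      · refine forall_mem_items.2 ⟨?_, hp.2⟩
        refine forall_mem_pushTop (P := fun x => 0 < x.2) hpos.1 ?_ fun _ h => by
          simp only at h ⊢; omega
        cases hq1 : q.1 with
        | nil => simp [absorbTop]
        | cons a l' =>
          rw [hq1] at hp
          simp only [List.forall_mem_cons] at hp
          exact snd_pos_absorb hp.1.1 hp.1.2
      · rw [sum_items, sum_snd_pushTop]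
        simp only [List.map_cons, List.sum_cons]
        have : ((absorbTop (e.height lo) q.1).map Prod.snd).sum ≤ (q.1.map Prod.snd).sum := by
          cases q.1 with
          | nil => simp [absorbTop]
          | cons a l' => simpa [absorbTop] using sum_snd_absorb_le _ a.1 a.2 l'
        omega
      · rw [List.countP_cons_of_neg (by simpa using h)]
        exact ih.length_le
      · intro R m hl
        have key : ∀ a b : List (ℕ × ℕ), a ≠ [] → b ≠ [] →
            (a.map Prod.fst).getLast? = (b.map Prod.fst).getLast? → ∀ m' : ℕ,
            (items (b, q.2)).getLast? = some (R, m', 0) →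
            ∃ m', (items (a, q.2)).getLast? = some (R, m', 0) := by
          intro a b ha hb hab m' hbl
          simp only [items, List.getLast?_append, List.getLast?_map] at hbl hab ⊢
          cases hq2 : q.2.getLast? with
          | some y => exact ⟨m', by simpa [hq2] using hbl⟩
          | none =>
            rw [hq2] at hbl
            have hx := List.getLast?_eq_some_getLast ha
            have hy := List.getLast?_eq_some_getLast hb
            rw [hx, hy, Option.map_some, Option.map_some, Option.some.injEq] at hab
            simp only [hx, hy, Option.map_some, Option.some.injEq, Option.none_or,
              Prod.mk.injEq] at hbl ⊢
            exact ⟨_, hab.trans hbl.1, rfl, trivial⟩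
        cases hq1 : q.1 with
        | nil =>
          cases l with
          | nil =>
            obtain rfl : e = (R, m, 0) := by simpa using hl
            have : q.2 = [] := by simp [hq, compress]
            refine ⟨m, ?_⟩
            simp [absorbTop, pushTop, items, this, Item.height, not_lt.2 hlo]
          | cons e' l =>
            obtain ⟨m', hm⟩ := ih.getLast R m (by simpa using hl)
            refine ⟨m', ?_⟩
            simp only [items, hq1, List.map_nil, List.nil_append] at hm
            simp [items, absorbTop, pushTop, List.getLast?_cons, hm]
        | cons a l' =>
          cases l with
          | nil => simp [hq, compress] at hq1
          | cons e' l =>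
            obtain ⟨m', hm⟩ := ih.getLast R m (by simpa using hl)
            refine key _ (a :: l') ?_ (by simp) ?_ m' ?_
            · obtain ⟨_, _, h⟩ := exists_pushTop (e.height lo) e.2.1
                (absorbTop (e.height lo) (a :: l'))
              simp [h]
            · rw [absorbTop, getLast?_pushTop (absorb_ne_nil _ _ _ _), getLast?_absorb]
              simp
            · rw [← hq1]
              exact hm
      · intro R m hl
        obtain rfl : e = (R, m, 0) := by simpa using hl
        have : Item.height lo (R, m, 0) = R := by simp [Item.height, not_lt.2 hlo]
        rw [this]
        exact exists_pushTop _ _ _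

theorem Compressed.Good.length_items_le {lo hi : ℝ} {Λ : Finset ℕ} {l : List Item}
    {q : Compressed} (h : Good lo hi Λ l q) : q.items.length ≤
      (l.countP (fun e => lo < e.2.2 ∧ e.2.2 < hi) + 1) * (2 * Λ.card + 1) := by
  have h1 := h.unimodal.length_le (Λ := Λ) (by
    simp only [List.mem_map]
    rintro x ⟨e, he, rfl⟩
    exact ((forall_mem_items.1 h.mem).1 e he).1)
  have h2 := h.length_le
  rw [items, List.length_append, List.length_map]
  rw [List.length_map] at h1
  rw [add_one_mul (List.countP _ l)]
  omega

theorem Compressed.Good.length_le_sum {lo hi : ℝ} {Λ : Finset ℕ} {l : List Item} {q : Compressed}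
    (h : Compressed.Good lo hi Λ l q) : q.items.length ≤ (l.map (·.2.1)).sum := by
  refine le_trans ?_ h.sum_le
  have := List.card_nsmul_le_sum (q.items.map (·.2.1)) 1 (by
    simp only [List.mem_map]
    rintro x ⟨e, he, rfl⟩
    exact h.pos e he)
  simpa using this

theorem four_mul_two_pow_le_blockSum {R x : ℕ} {l : List (ℕ × ℕ)} (hl : ∀ e ∈ l, 0 < e.2)
    (h : ∃ e ∈ l, R < e.1) (hx : 0 < x) : 4 * 2 ^ R ≤ blockSum x l := by
  have hpos : ∀ l : List (ℕ × ℕ), x ≤ blockSum x l := by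
    intro l
    induction l with
    | nil => exact le_rfl
    | cons e l ih => exact ih.trans ((le_roundUp e.1 _).trans (Nat.le_add_right _ _))
  induction l with
  | nil => simp at h
  | cons e l ih =>
    simp only [List.forall_mem_cons] at hl
    rw [blockSum]
    by_cases hk : R < e.1
    · have h1 : 2 ^ (R + 1) ≤ 2 ^ e.1 := Nat.pow_le_pow_right two_pos hk
      have h2 : 2 ^ e.1 ≤ roundUp e.1 (blockSum x l) :=
        Nat.le_of_dvd ((hx.trans_le (hpos l)).trans_le (le_roundUp _ _)) (dvd_roundUp _ _)
      have h3 := Nat.le_mul_of_pos_left (2 ^ e.1) hl.1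
      rw [pow_succ] at h1
      omega
    · have := ih hl.2 (by simpa [hk] using h)
      exact this.trans ((le_roundUp e.1 _).trans (Nat.le_add_right _ _))

/-- If the sequence begins and ends with a leaf of height `R`, then its compression for a known
threshold tells whether the rounded Kraft sum is at most `3 * 2 ^ R`. -/
theorem compress_test {f : ℝ} (hf : 0 ≤ f) {l : List Item} (hpos : ∀ e ∈ l, 0 < e.2.1) {R m m' : ℕ}
    (hhead : l.head? = some (R, m, 0)) (hlast : l.getLast? = some (R, m', 0)) :
    ∃ c l', (compress f f l).items = (R, c, 0) :: l' ∧
      (l' = [] ∧ c ≤ 3 ↔ itemSum f l ≤ 3 * 2 ^ R) := by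
  classical
  set Λ : Finset ℕ := (l.map (·.1)).toFinset ∪ (l.map (·.1 + 1)).toFinset with hΛ
  have hg : Good f f Λ l (compress f f l) := by
    refine good_compress hf (fun e he => ⟨?_, fun _ => ?_⟩) hpos
    · simp only [hΛ, Finset.mem_union, List.mem_toFinset, List.mem_map]
      exact .inl ⟨e, he, rfl⟩
    · simp only [hΛ, Finset.mem_union, List.mem_toFinset, List.mem_map]
      exact .inr ⟨e, he, rfl⟩
  set q := compress f f l with hq
  have hq2 : q.2 = [] := by
    have : l.countP (fun e => f < e.2.2 ∧ e.2.2 < f) = 0 := by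
      rw [List.countP_eq_zero]
      intro e _
      simp only [decide_eq_true_eq]
      exact fun h => lt_asymm h.1 h.2
    have h := hg.length_le
    rw [this, zero_mul] at h
    exact List.eq_nil_of_length_eq_zero (Nat.le_zero.1 h)
  obtain ⟨c, l', hq1⟩ := hg.head R m hhead
  obtain ⟨c', hlast'⟩ := hg.getLast R m' hlast
  have hit : q.items = (R, c, 0) :: l'.map (fun e => (e.1, e.2, (0 : ℝ))) := by
    simp [items, hq1, hq2]
  refine ⟨c, _, hit, ?_⟩
  rw [← itemSum_compress hf le_rfl (.inr rfl) l, itemSum_items hf, ← hq, hq1, hq2, itemSum]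
  cases l' with
  | nil =>
    simp only [List.map_nil, true_and, blockSum]
    rw [roundUp_of_dvd (dvd_zero _), zero_add, mul_le_mul_iff_left₀ (by positivity)]
  | cons e l' =>
    have hun := hg.unimodal
    rw [hq1] at hun
    have hps := (forall_mem_items.1 hg.pos).1
    rw [hq1] at hps
    simp only [List.forall_mem_cons] at hps
    -- The leftmost block has height `R`, so the block next to the right end is higher than `R`.
    obtain ⟨a, ha⟩ : ∃ a : List (ℕ × ℕ), e :: l' = a ++ [(R, c')] := by
      rw [hit, List.map_cons, List.getLast?_cons_cons,
        ← List.map_cons (f := fun e : ℕ × ℕ => (e.1, e.2, (0 : ℝ))), List.getLast?_map] at hlast'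
      obtain ⟨x, hx, hxe⟩ := Option.map_eq_some_iff.1 hlast'
      obtain ⟨a, ha⟩ := List.getLast?_eq_some_iff.1 hx
      refine ⟨a, ?_⟩
      simp only [Prod.mk.injEq] at hxe
      rw [ha, ← hxe.1, ← hxe.2.1]
    have hRe : R < e.1 := by
      obtain ⟨h1, h2 | ⟨h2, h3⟩⟩ := hun
      · exact h2
      · exfalso
        have hR : R ∈ e.1 :: l'.map Prod.fst := by
          rw [← List.map_cons, ha]; simp
        rcases List.mem_cons.1 hR with h4 | h4
        · simp only at h2; omega
        · have := (List.pairwise_cons.1 h3).1 R h4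
          simp only at h2; omega
    have hae : a ≠ [] := by
      rintro rfl
      simp only [List.nil_append, List.cons.injEq] at ha
      rw [ha.1] at hRe
      exact lt_irrefl _ hRe
    obtain ⟨a', rfl⟩ : ∃ a', a = e :: a' := by
      cases a with
      | nil => exact absurd rfl hae
      | cons x a => exact ⟨a, by simp_all⟩
    have hsplit : ∀ b₁ b₂ : List (ℕ × ℕ), blockSum 0 (b₁ ++ b₂) = blockSum (blockSum 0 b₂) b₁ := by
      intro b₁ b₂
      induction b₁ with
      | nil => rfl
      | cons x b₁ ih => simp [blockSum, ih]
    have hall : ∀ x ∈ e :: l', 0 < x.2 := by simpa using hps.2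
    rw [ha] at hall
    have h4 := four_mul_two_pow_le_blockSum (R := R) (l := e :: a') (x := blockSum 0 [(R, c')])
      (fun x hx => hall x (List.mem_append_left _ hx)) ⟨e, by simp, hRe⟩ (by
        have : 0 < c' := hall (R, c') (by simp)
        simp only [blockSum]; positivity)
    rw [← hsplit, ← ha] at h4
    have h5 := le_roundUp R (blockSum 0 (e :: l'))
    have h6 : 0 < 2 ^ R := by positivity
    rw [blockSum]
    simp only [List.map_cons, reduceCtorEq, false_and, false_iff, not_le]
    have : blockSum 0 (e :: l') ≤ roundUp R (blockSum 0 (e :: l')) + c * 2 ^ R :=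
      h5.trans (Nat.le_add_right _ _)
    omega

namespace RealRAM

/-! ### The arrays of the program

Names that begin with `v` stand for word variables, which are kept in cell `0` of an array of their
own, names with `a` for word arrays, and names with `r` for real arrays and real variables. The word
arrays `0`, …, `3` hold the input `n` and the output tree; real array `0` holds the input weights.

* `vN`, `vL`, `vStride`: the number `n` of leaves, `⌈log₂ n⌉`, and the least power of two that is not
  smaller than that;
* `aPow`: the powers of two, truncated at `n + 2`;
* `aItemK`, `aItemM`, `rItem`, `vItems`: the items and their number;
* `aStackK`, `aStackM`, `rStack`, `vStack`, `vBase`: the compressed items, their number, and the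
  number of those up to the last one of unknown height;
* `rCLo`, `rCHi`: the bounds for the threshold in a compression;
* `vLo`, `vHi`, `vMid`, `vGap`, `rF`, `rLo`, `rHi`: the positions and the thresholds of a binary
  search, and the length of an interval at which it stops;
* `rSort`, `rMerge`, `vLen`, `vTarget`, `vWidth`, `vP`, `vQ`, `vR`, `vSplit`, `vEnd`: the array that is
  sorted, the auxiliary array of merge sort, its length, the required size of the sorted blocks,
  their current size, and positions in a merge;
* `aHeight`, `rFrac`: the heights and the fractions of the leaves;
* `vRoot`, `aNode`, `aNodeK`, `vNodes`, `vNext`: the height of the root, the addresses and the heights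
  of the nodes without a parent, their number, and the least address that is not used;
* `vI`, `vJ`, `vHeight`, `rCeil`: counters, the height of the current leaf or item, and the maximum of
  the rounded weights. -/

notation "vN" => (4 : ℕ)
notation "vL" => (5 : ℕ)
notation "vStride" => (6 : ℕ)
notation "aPow" => (7 : ℕ)
notation "aItemK" => (8 : ℕ)
notation "aItemM" => (9 : ℕ)
notation "vItems" => (10 : ℕ)
notation "aStackK" => (11 : ℕ)
notation "aStackM" => (12 : ℕ)
notation "vStack" => (13 : ℕ)
notation "vBase" => (14 : ℕ)
notation "vJ" => (15 : ℕ)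
notation "vHeight" => (16 : ℕ)
notation "vLo" => (17 : ℕ)
notation "vHi" => (18 : ℕ)
notation "vGap" => (19 : ℕ)
notation "vMid" => (20 : ℕ)
notation "vLen" => (21 : ℕ)
notation "vTarget" => (22 : ℕ)
notation "vWidth" => (23 : ℕ)
notation "vP" => (24 : ℕ)
notation "vQ" => (25 : ℕ)
notation "vR" => (26 : ℕ)
notation "vSplit" => (27 : ℕ)
notation "vEnd" => (28 : ℕ)
notation "vI" => (29 : ℕ)
notation "aHeight" => (30 : ℕ)
notation "vRoot" => (31 : ℕ)
notation "vNext" => (32 : ℕ)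
notation "aNode" => (33 : ℕ)
notation "aNodeK" => (34 : ℕ)
notation "vNodes" => (35 : ℕ)
notation "rW" => (0 : ℕ)
notation "rCeil" => (1 : ℕ)
notation "rItem" => (2 : ℕ)
notation "rStack" => (3 : ℕ)
notation "rCLo" => (4 : ℕ)
notation "rCHi" => (5 : ℕ)
notation "rF" => (6 : ℕ)
notation "rLo" => (7 : ℕ)
notation "rHi" => (8 : ℕ)
notation "rSort" => (9 : ℕ)
notation "rMerge" => (10 : ℕ)
notation "rFrac" => (11 : ℕ)

/-! ### Compression on the machine -/

/-- The first `p` items that are kept in the arrays `K`, `M` and `F`, the last one first. -/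
def itemList (K M : ℕ → ℕ) (F : ℕ → ℝ) : ℕ → List Item
  | 0 => []
  | p + 1 => (K p, M p, F p) :: itemList K M F p

@[simp] theorem length_itemList (K M : ℕ → ℕ) (F : ℕ → ℝ) (p : ℕ) :
    (itemList K M F p).length = p := by
  induction p with
  | zero => rfl
  | succ p ih => rw [itemList, List.length_cons, ih]

theorem itemList_congr {K M K' M' : ℕ → ℕ} {F F' : ℕ → ℝ} {p : ℕ}
    (h : ∀ i < p, K i = K' i ∧ M i = M' i ∧ F i = F' i) :
    itemList K M F p = itemList K' M' F' p := by
  induction p with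
  | zero => rfl
  | succ p ih =>
    obtain ⟨h1, h2, h3⟩ := h p (Nat.lt_succ_self p)
    rw [itemList, itemList, ih fun i hi => h i (hi.trans (Nat.lt_succ_self p)), h1, h2, h3]

theorem itemList_eq_cons {K M : ℕ → ℕ} {F : ℕ → ℝ} {p : ℕ} {e : Item} {l : List Item}
    (h : itemList K M F p = e :: l) :
    ∃ p', p = p' + 1 ∧ K p' = e.1 ∧ M p' = e.2.1 ∧ F p' = e.2.2 ∧ itemList K M F p' = l := by
  cases p with
  | zero => simp [itemList] at h
  | succ p =>
    rw [itemList, List.cons.injEq] at h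
    exact ⟨p, rfl, by rw [← h.1], by rw [← h.1], by rw [← h.1], h.2⟩

/-- `shrink` as an expression, where the powers of two are looked up in a table. -/
def shrinkExpr (c j : WExpr) : WExpr := (c + .read aPow j - 1) / .read aPow j

/-- Merge the blocks at the top of the stack; see `absorb`. -/
def absorbProg : Program :=
  .loop (.and (.wordLt (wvar vBase + 1) (wvar vStack))
    (.and (.wordLt (.read aStackK (wvar vStack - 1)) (wvar vHeight))
      (.wordLt (.read aStackK (wvar vStack - 1)) (.read aStackK (wvar vStack - 2)))))
    (.ite (.wordLt (wvar vHeight) (.read aStackK (wvar vStack - 2)))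
      (.storeWord aStackM (wvar vStack - 1)
        (shrinkExpr (.read aStackM (wvar vStack - 1))
          (wvar vHeight - .read aStackK (wvar vStack - 1))) ⨾
        .storeWord aStackK (wvar vStack - 1) (wvar vHeight))
      (.storeWord aStackM (wvar vStack - 2)
        (.read aStackM (wvar vStack - 2) + shrinkExpr (.read aStackM (wvar vStack - 1))
          (.read aStackK (wvar vStack - 2) - .read aStackK (wvar vStack - 1))) ⨾
        .storeWord vStack 0 (wvar vStack - 1)))

/-- Push `m` leaves of the current height, where `m` is the count of the current item. -/
def pushProg : Program :=
  .ite (.and (.wordLt (wvar vBase) (wvar vStack))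
      (.and (.not (.wordLt (.read aStackK (wvar vStack - 1)) (wvar vHeight)))
        (.not (.wordLt (wvar vHeight) (.read aStackK (wvar vStack - 1))))))
    (.storeWord aStackM (wvar vStack - 1)
      (.read aStackM (wvar vStack - 1) + .read aItemM (wvar vJ)))
    (.storeWord aStackK (wvar vStack) (wvar vHeight) ⨾
      .storeWord aStackM (wvar vStack) (.read aItemM (wvar vJ)) ⨾
      .storeReal rStack (wvar vStack) (.ofWord 0) ⨾
      .storeWord vStack 0 (wvar vStack + 1))

/-- Push the current item as one whose height is not known. -/
def pushOpenProg : Program :=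
  .storeWord aStackK (wvar vStack) (.read aItemK (wvar vJ)) ⨾
  .storeWord aStackM (wvar vStack) (.read aItemM (wvar vJ)) ⨾
  .storeReal rStack (wvar vStack) (.read rItem (wvar vJ)) ⨾
  .storeWord vStack 0 (wvar vStack + 1) ⨾
  .storeWord vBase 0 (wvar vStack)

/-- Compress the items; see `compress`. -/
def compressProg : Program :=
  .storeWord vJ 0 0 ⨾ .storeWord vStack 0 0 ⨾ .storeWord vBase 0 0 ⨾
  .loop (.wordLt (wvar vJ) (wvar vItems))
    (.ite (.and (.realLt (rvar rCLo) (.read rItem (wvar vJ)))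
        (.realLt (.read rItem (wvar vJ)) (rvar rCHi)))
      pushOpenProg
      (.ite (.realLt (rvar rCLo) (.read rItem (wvar vJ)))
          (.storeWord vHeight 0 (.read aItemK (wvar vJ) + 1))
          (.storeWord vHeight 0 (.read aItemK (wvar vJ))) ⨾
        absorbProg ⨾ pushProg) ⨾
      .storeWord vJ 0 (wvar vJ + 1))

/-- The items on the stack. -/
def stackItems (s : State) : List Item :=
  itemList (s.word aStackK) (s.word aStackM) (s.real rStack) (s.word vStack 0)

/-- The table of powers of two, up to the exponent `H`, truncated at `D`. -/
def PowTable (H D : ℕ) (s : State) : Prop := ∀ j ≤ H, s.word aPow j = min (2 ^ j) D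

theorem eval_shrinkExpr {H D : ℕ} {s : State} (hs : PowTable H D s) {c j : WExpr}
    (hc : 0 < c.eval s) (hD : c.eval s ≤ D) (hj : j.eval s ≤ H) :
    (shrinkExpr c j).eval s = shrink (c.eval s) (j.eval s) := by
  simp [shrinkExpr, hs _ hj, shrink_eq_min hc hD]

theorem items_cons (e : ℕ × ℕ) (l : List (ℕ × ℕ)) (d : List Item) :
    Compressed.items (e :: l, d) = (e.1, e.2, (0 : ℝ)) :: Compressed.items (l, d) := rfl

/-- The length of the stack is the potential that pays for the iterations of the loop: all but the
last one shorten the stack. -/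
theorem runs_absorbProg {B H D b : ℕ} {l : List (ℕ × ℕ)} {d : List Item} {s : State}
    (hpow : PowTable H D s) (hH : H < B) (hD : D < B) (hb : s.word vHeight 0 = b)
    (hbH : b ≤ H) (hbase : s.word vBase 0 = d.length)
    (hstack : stackItems s = Compressed.items (l, d)) (hl : ∀ e ∈ l, 0 < e.2 ∧ e.1 ≤ H)
    (hsum : (l.map Prod.snd).sum + d.length ≤ D) :
    Runs B absorbProg s fun t s' => t + 4 * (absorbTop b l).length ≤ 4 * l.length + 5 ∧
      stackItems s' = Compressed.items (absorbTop b l, d) := by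
  classical
  let R : List (ℕ × ℕ) → State → Prop := fun g s' =>
    absorbTop b g = absorbTop b l ∧ PowTable H D s' ∧ s'.word vHeight 0 = b ∧
    s'.word vBase 0 = d.length ∧ stackItems s' = Compressed.items (g, d) ∧
    (∀ e ∈ g, 0 < e.2 ∧ e.1 ≤ H) ∧ (g.map Prod.snd).sum + d.length ≤ D
  let φ : List (ℕ × ℕ) → ℕ := fun g => 4 * g.length + if ∃ e ∈ g.head?, e.1 < b then 4 else 0
  have hlen : ∀ {g : List (ℕ × ℕ)}, (∀ e ∈ g, 0 < e.2 ∧ e.1 ≤ H) →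
      g.length ≤ (g.map Prod.snd).sum := by
    intro g hg
    induction g with
    | nil => simp
    | cons e g ih =>
      simp only [List.forall_mem_cons] at hg
      have := ih hg.2
      simp only [List.map_cons, List.sum_cons, List.length_cons]
      omega
  have hvs : ∀ {g : List (ℕ × ℕ)} {s' : State}, stackItems s' = Compressed.items (g, d) →
      s'.word vStack 0 = g.length + d.length := by
    intro g s' h
    have := congrArg List.length h
    simpa [stackItems, Compressed.items] using this
  refine (Runs.loop (R := R) (φ := φ) (g := l) ⟨rfl, hpow, hb, hbase, hstack, hl, hsum⟩ ?_).mono ?_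
  · rintro g s' ⟨h1, h2, h3, h4, h5, h6, h7⟩ ⟨hc1, hc2, hc3⟩
    have hsp := hvs h5
    have hgl := hlen h6
    simp only [Cond.holds_wordLt, WExpr.eval_read, WExpr.eval_add, WExpr.eval_sub,
      WExpr.eval_ofNat, h3, h4, hsp] at hc1 hc2 hc3
    obtain ⟨⟨t, c⟩, ⟨u, e⟩, g, rfl⟩ : ∃ x y g', g = x :: y :: g' := by
      match g, hc1 with
      | [], h => simp at h
      | [_], h => simp at h; omega
      | x :: y :: g', _ => exact ⟨x, y, g', rfl⟩
    rw [items_cons, items_cons, stackItems] at h5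
    obtain ⟨p', hp', hk1, hm1, hf1, h5⟩ := itemList_eq_cons h5
    obtain ⟨p, rfl, hk2, hm2, hf2, h5⟩ := itemList_eq_cons h5
    simp only [List.forall_mem_cons, List.map_cons, List.sum_cons, List.length_cons] at *
    obtain ⟨⟨hc0, htH⟩, ⟨he0, huH⟩, h6⟩ := h6
    have e1 : g.length + 1 + 1 + d.length - 1 = p + 1 := by omega
    have e2 : g.length + 1 + 1 + d.length - 2 = p := by omega
    rw [e1] at hc2 hc3
    rw [e2, hk1, hk2] at hc3
    rw [hk1] at hc2
    have hs1 := shrink_le c (b - t)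
    have hs2 := shrink_le c (u - t)
    have ea : WExpr.eval s' (shrinkExpr (.read aStackM (wvar vStack - 1))
          (wvar vHeight - .read aStackK (wvar vStack - 1))) = shrink c (b - t) := by
      rw [eval_shrinkExpr h2] <;> simp [hsp, e1, hk1, hm1, h3] <;> omega
    have eb : WExpr.eval s' (shrinkExpr (.read aStackM (wvar vStack - 1))
          (.read aStackK (wvar vStack - 2) - .read aStackK (wvar vStack - 1)))
        = shrink c (u - t) := by
      rw [eval_shrinkExpr h2] <;> simp [hsp, e1, e2, hk1, hk2, hm1] <;> omega
    refine Runs.ite (fun hcond => ?_) (fun hcond => ?_)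
    · simp only [Cond.holds_wordLt, WExpr.eval_read, WExpr.eval_sub,
        WExpr.eval_ofNat, h3, hsp, e2, hk2] at hcond
      refine .seq (.storeWord ?_ ?_ (.storeWord ?_ ?_ ⟨(b, shrink c (b - t)) :: (u, e) :: g, ?_, ?_⟩))
      · simp [hsp]; omega
      · rw [ea]; omega
      · simp [hsp]; omega
      · simp [h3]; omega
      · refine ⟨?_, ?_, by simp [h3], by simp [h4], ?_, ?_, ?_⟩
        · rw [← h1]
          simp only [absorbTop, absorb]
          rw [if_neg (by omega), if_pos ⟨hc2, hc3⟩, if_neg (by omega)]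
        · intro j hj; simpa using h2 j hj
        · rw [ea]
          simp only [stackItems, State.real_setWord, ne_eq,
            Nat.reduceEqDiff, not_false_eq_true, State.word_setWord_of_ne,
            State.word_setWord_self, WExpr.eval_sub, WExpr.eval_read, WExpr.eval_ofNat, hsp,
            e1, h3]
          rw [show g.length + 1 + 1 + d.length = p + 1 + 1 by omega, itemList, itemList, items_cons,
            items_cons, ← h5]
          simp only [Function.update_self, hf1, hf2, ne_eq, Nat.left_eq_add, one_ne_zero,
            not_false_eq_true, Function.update_of_ne, hk2, hm2]
          congr 2
          refine itemList_congr fun i hi => ?_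
          have h1 : i ≠ p + 1 := by omega
          simp [h1]
        · simp only [List.forall_mem_cons]
          exact ⟨⟨shrink_pos _ hc0, hbH⟩, ⟨he0, huH⟩, h6⟩
        · simp only [List.map_cons, List.sum_cons]; omega
      · simp only [φ, List.length_cons, List.head?_cons, Option.mem_def, Option.some.injEq,
          exists_eq_left', hc2, lt_irrefl, if_true, if_false]
        omega
    · simp only [Cond.holds_wordLt, WExpr.eval_read, WExpr.eval_sub,
        WExpr.eval_ofNat, h3, hsp, e2, hk2] at hcond
      refine .seq (.storeWord ?_ ?_ (.storeWord ?_ ?_ ⟨(u, e + shrink c (u - t)) :: g, ?_, ?_⟩))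
      · simp [hsp]; omega
      · rw [WExpr.eval_add, eb]; simp [hsp, e2, hm2]; omega
      · simp; omega
      · simp [hsp]; omega
      · refine ⟨?_, ?_, by simp [h3], by simp [h4], ?_, ?_, ?_⟩
        · rw [← h1]
          simp only [absorbTop]
          rw [absorb, if_pos ⟨hc2, hc3⟩, if_pos (by omega)]
        · intro j hj; simpa using h2 j hj
        · rw [WExpr.eval_add, eb]
          simp only [stackItems, State.real_setWord, ne_eq,
            Nat.reduceEqDiff, not_false_eq_true, State.word_setWord_of_ne,
            State.word_setWord_self, WExpr.eval_sub, WExpr.eval_read, WExpr.eval_ofNat, hsp,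
            e1, e2, hm2, Function.update_self]
          rw [itemList, items_cons, ← h5]
          simp only [Function.update_self, hf2, hk2]
          congr 1
          refine itemList_congr fun i hi => ?_
          have h1 : i ≠ p := by omega
          simp [h1]
        · simp only [List.forall_mem_cons]
          exact ⟨⟨by omega, huH⟩, h6⟩
        · simp only [List.map_cons, List.sum_cons]; omega
      · simp only [φ, List.length_cons, List.head?_cons, Option.mem_def, Option.some.injEq,
          exists_eq_left', hc2, if_true]
        split_ifs <;> omega
  · rintro t s' ⟨g, ⟨h1, h2, h3, h4, h5, h6, h7⟩, hc, ht⟩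
    have hg : absorbTop b g = g := by
      have hsp := hvs h5
      match g with
      | [] => rfl
      | [_] => rfl
      | (t, c) :: (u, e) :: g =>
        rw [items_cons, items_cons, stackItems] at h5
        obtain ⟨p', hp', hk1, hm1, hf1, h5⟩ := itemList_eq_cons h5
        obtain ⟨p, rfl, hk2, hm2, hf2, h5⟩ := itemList_eq_cons h5
        rw [absorbTop, absorb, if_neg]
        rintro ⟨h8, h9⟩
        apply hc
        simp only [List.length_cons] at hsp
        simp only [Cond.holds_and, Cond.holds_wordLt, WExpr.eval_read, WExpr.eval_add,
          WExpr.eval_sub, WExpr.eval_ofNat, h3, h4, hp',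
          show p + 1 + 1 - 1 = p + 1 by omega, show p + 1 + 1 - 2 = p by omega, hk1, hk2]
        exact ⟨by omega, h8, h9⟩
    rw [hg] at h1
    subst h1
    refine ⟨?_, h5⟩
    have : φ l ≤ 4 * l.length + 4 := by simp only [φ]; split_ifs <;> omega
    have : 4 * (absorbTop b l).length ≤ φ (absorbTop b l) := by simp only [φ]; omega
    omega

theorem word_stack_of_stackItems {s : State} {l : List Item} (h : stackItems s = l) :
    s.word vStack 0 = l.length := by
  rw [← h, stackItems, length_itemList]

theorem runs_pushProg {B D b m : ℕ} {l : List (ℕ × ℕ)} {d : List Item} {s : State}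
    (hD : D < B) (hb : s.word vHeight 0 = b) (hbB : b < B) (hm : s.word aItemM (s.word vJ 0) = m)
    (hbase : s.word vBase 0 = d.length) (hstack : stackItems s = Compressed.items (l, d))
    (hsum : ((pushTop b m l).map Prod.snd).sum ≤ D)
    (hlen : (pushTop b m l).length + d.length ≤ D) :
    Runs B pushProg s fun t s' => t ≤ 5 ∧ stackItems s' = Compressed.items (pushTop b m l, d) := by
  have hsp := word_stack_of_stackItems hstack
  rw [Compressed.items, List.length_append, List.length_map] at hsp
  simp only at hsp
  by_cases h : ∃ c l', l = (b, c) :: l'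
  · obtain ⟨c, l, rfl⟩ := h
    rw [pushTop, if_pos rfl] at hsum hlen ⊢
    simp only [List.length_cons, List.map_cons, List.sum_cons] at hsp hsum hlen
    rw [items_cons, stackItems] at hstack
    obtain ⟨p, hp, hk, hM, hF, hstack⟩ := itemList_eq_cons hstack
    simp only at hk hM hF
    refine Runs.ite (fun _ => ?_) fun hc => ?_
    · refine .storeWord ?_ ?_ ⟨by omega, ?_⟩
      · simp; omega
      · simp [hm, hp, hM]; omega
      · simp only [stackItems, WExpr.eval_sub, WExpr.eval_read, WExpr.eval_ofNat, hp,
          Nat.add_sub_cancel, WExpr.eval_add, hM, hm, ne_eq, Nat.reduceEqDiff, not_false_eq_true,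
          State.word_setWord_of_ne, State.word_setWord_self, State.real_setWord]
        rw [itemList, items_cons, ← hstack, Function.update_self, hk, hF]
        congr 1
        refine itemList_congr fun i hi => ?_
        have h1 : i ≠ p := by omega
        simp [h1]
    · exfalso
      apply hc
      simp [hp, hbase, hb, hk]
      omega
  · have hpush : pushTop b m l = (b, m) :: l := by
      match l with
      | [] => rfl
      | (t, c) :: l =>
        rw [pushTop, if_neg]
        rintro rfl
        exact h ⟨_, _, rfl⟩
    rw [hpush] at hsum hlen ⊢
    simp only [List.length_cons, List.map_cons, List.sum_cons] at hsp hsum hlen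
    refine Runs.ite (fun hc => ?_) fun _ => ?_
    · exfalso
      match l with
      | [] => simp [hsp, hbase] at hc
      | (t, c) :: l =>
        rw [items_cons, stackItems] at hstack
        obtain ⟨p, hp, hk, hM, hF, hstack⟩ := itemList_eq_cons hstack
        simp only [Cond.holds_and, Cond.holds_wordLt, WExpr.eval_read, WExpr.eval_ofNat, hbase,
          hp, Cond.holds_not, WExpr.eval_sub, add_tsub_cancel_right, hk, hb, not_lt] at hc
        have : t = b := le_antisymm hc.2.2 hc.2.1
        subst this
        exact h ⟨_, _, rfl⟩
    · refine .seq (.storeWord ?_ ?_ (.seq (.storeWord ?_ ?_ (.seq (.storeReal ?_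
        (.storeWord ?_ ?_ ⟨by omega, ?_⟩))))))
      · simp; omega
      · simp [hb, hbB]
      · simp; omega
      · simp [hm]; omega
      · simp; omega
      · simp; omega
      · simp [hsp]; omega
      · simp only [stackItems] at hstack
        simp only [stackItems, WExpr.eval_add, WExpr.eval_read, WExpr.eval_ofNat, hm, hb,
          ne_eq, Nat.reduceEqDiff, not_false_eq_true, State.word_setWord_of_ne,
          State.word_setReal, RExpr.eval_ofWord, Nat.cast_zero,
          State.word_setWord_self, State.real_setReal_self, State.real_setWord,
          Function.update_self]
        rw [itemList, items_cons, ← hstack]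
        simp only [Function.update_self]
        congr 1
        refine itemList_congr fun i hi => ?_
        have h1 : i ≠ s.word vStack 0 := by omega
        simp [h1]

theorem runs_pushOpenProg {B D H k m : ℕ} {x : ℝ} {l : List Item} {s : State}
    (hD : D < B) (hH : H < B) (hk : s.word aItemK (s.word vJ 0) = k)
    (hm : s.word aItemM (s.word vJ 0) = m) (hx : s.real rItem (s.word vJ 0) = x)
    (hstack : stackItems s = l) (hkH : k ≤ H) (hmD : m ≤ D) (hlen : l.length + 1 ≤ D) :
    Runs B pushOpenProg s fun t s' => t ≤ 5 ∧ stackItems s' = (k, m, x) :: l ∧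
      s'.word vBase 0 = l.length + 1 := by
  have hsp := word_stack_of_stackItems hstack
  simp only [stackItems] at hstack
  refine .seq (.storeWord ?_ ?_ (.seq (.storeWord ?_ ?_ (.seq (.storeReal ?_
        (.seq (.storeWord ?_ ?_ (.storeWord ?_ ?_ ⟨by omega, ?_, ?_⟩))))))))
  · simp; omega
  · simp; omega
  · simp; omega
  · simp; omega
  · simp; omega
  · simp; omega
  · simp; omega
  · simp; omega
  · simp; omega
  · simp only [stackItems, WExpr.eval_add, WExpr.eval_read, WExpr.eval_ofNat, hm, hk, hx,
      ne_eq, Nat.reduceEqDiff, not_false_eq_true, State.word_setWord_of_ne,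
      State.word_setReal, RExpr.eval_read, State.word_setWord_self, State.real_setReal_self,
      State.real_setWord, Function.update_self]
    rw [itemList, ← hstack]
    simp only [Function.update_self]
    congr 1
    refine itemList_congr fun i hi => ?_
    have h1 : i ≠ s.word vStack 0 := by omega
    simp [h1]
  · simp [hsp]

/-- The items that are to be processed. -/
def inputItems (s : State) : List Item :=
  itemList (s.word aItemK) (s.word aItemM) (s.real rItem) (s.word vItems 0)

/-- The memory is prepared for the compression of items: all heights are below `H`, and the counts
have a sum of at most `D`. -/
structure ItemsReady (H D : ℕ) (s : State) : Prop where
  pow : PowTable H D s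
  pos : ∀ e ∈ inputItems s, 0 < e.2.1
  height : ∀ e ∈ inputItems s, e.1 + 1 ≤ H
  sum_le : ((inputItems s).map (·.2.1)).sum ≤ D

theorem runs_compressProg {B H D : ℕ} {s : State} (hH : H < B) (hD : D < B)
    (hs : ItemsReady H D s) (hlo : 0 ≤ s.real rCLo 0) :
    Runs B compressProg s fun t s' => t ≤ 20 * s.word vItems 0 + 4 ∧
      stackItems s' = (compress (s.real rCLo 0) (s.real rCHi 0) (inputItems s)).items := by
  classical
  set lo := s.real rCLo 0 with hlo_def
  set hi := s.real rCHi 0 with hhi_def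
  set N := s.word vItems 0 with hN
  set pre : ℕ → List Item := itemList (s.word aItemK) (s.word aItemM) (s.real rItem) with hpre
  set q : ℕ → Compressed := fun j => compress lo hi (pre j) with hq
  have hsuffix : ∀ j ≤ N, pre j <:+ pre N := by
    intro j hj
    generalize N = M at hj
    induction M, hj using Nat.le_induction with
    | base => exact List.suffix_rfl
    | succ n _ ih => exact ih.trans (List.suffix_cons _ _)
  have hgood : ∀ j ≤ N, Compressed.Good lo hi (Finset.range (H + 1)) (pre j) (q j) := by
    intro j hj
    refine good_compress hlo (fun e he => ?_) fun e he => hs.pos e ((hsuffix j hj).subset he)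
    have := hs.height e ((hsuffix j hj).subset he)
    simp only [Finset.mem_range]
    exact ⟨by omega, fun _ => by omega⟩
  have hsumpre : ∀ j ≤ N, ((pre j).map (·.2.1)).sum ≤ D := by
    intro j hj
    obtain ⟨a, ha⟩ := hsuffix j hj
    have := hs.sum_le
    rw [inputItems, ← hN, ← hpre, ← ha, List.map_append, List.sum_append] at this
    omega
  have hND : N ≤ D := by
    have := List.card_nsmul_le_sum ((inputItems s).map (·.2.1)) 1 (by
      simp only [List.mem_map]
      rintro x ⟨e, he, rfl⟩
      exact hs.pos e he)
    have := this.trans hs.sum_le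
    simpa [inputItems] using this
  let R : ℕ → State → Prop := fun j s' => j ≤ N ∧ s'.word vJ 0 = j ∧
    stackItems s' = (q j).items ∧ s'.word vBase 0 = (q j).2.length ∧
    s'.word vItems = s.word vItems ∧ s'.word aPow = s.word aPow ∧
    s'.word aItemK = s.word aItemK ∧ s'.word aItemM = s.word aItemM ∧
    s'.real rItem = s.real rItem ∧ s'.real rCLo = s.real rCLo ∧ s'.real rCHi = s.real rCHi
  let φ : ℕ → ℕ := fun j => 20 * (N - j) + 4 * (q j).1.length
  refine .seq (.storeWord ?_ ?_ (.seq (.storeWord ?_ ?_ (.seq (.storeWord ?_ ?_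
    ((Runs.loop (R := R) (φ := φ) (g := 0) ?_ ?_).mono ?_))))))
  · simp; omega
  · simp; omega
  · simp; omega
  · simp; omega
  · simp; omega
  · simp; omega
  · refine ⟨Nat.zero_le _, ?_⟩
    simp [stackItems, itemList, q, pre, compress, Compressed.items]
  · rintro j s' ⟨hjN, hj, hst, hba, hR⟩ hc
    obtain ⟨e1, e2, e3, e4, e5, e6, e7⟩ := id hR
    simp only [Cond.holds_wordLt, WExpr.eval_read, WExpr.eval_ofNat, hj, e1] at hc
    rw [← hN] at hc
    have hpre' : pre (j + 1) = (s.word aItemK j, s.word aItemM j, s.real rItem j) :: pre j := rfl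
    have hg1 := hgood (j + 1) hc
    have hs1 := hsumpre (j + 1) hc
    have hl1 := hg1.length_le_sum.trans hs1
    have hsuml1 := hg1.sum_le.trans hs1
    have hmem := hs.height (s.word aItemK j, s.word aItemM j, s.real rItem j)
      ((hsuffix (j + 1) hc).subset (by rw [hpre']; simp))
    simp only at hmem
    have hq1 : q (j + 1)
        = (q j).push lo hi (s.word aItemK j, s.word aItemM j, s.real rItem j) := rfl
    have hgj := hgood j hjN
    have hsj := hgj.sum_le.trans (hsumpre j hjN)
    have hlj := hgj.length_le_sum.trans (hsumpre j hjN)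
    -- The last store of the loop body.
    have fin : ∀ s'' t, t + 2 + φ (j + 1) ≤ φ j → stackItems s'' = (q (j + 1)).items →
        s''.word vBase 0 = (q (j + 1)).2.length →
        (∀ a ∉ [aStackK, aStackM, vStack, vBase, vHeight], s''.word a = s'.word a) →
        (∀ a ∉ [rStack], s''.real a = s'.real a) →
        Runs B (.storeWord vJ 0 (wvar vJ + 1)) s'' fun u s' =>
          ∃ g, R g s' ∧ t + u + 1 + φ g ≤ φ j := by
      intro s'' t ht hst' hba' hw hr
      refine .storeWord ?_ ?_ ⟨j + 1, ⟨hc, ?_, ?_, ?_, ?_⟩, by omega⟩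
      · simp; omega
      · simp [hw vJ, hj]; omega
      · simp [hw vJ, hj]
      · rw [← hst']; simp [stackItems]
      · simp [hba']
      · simp [hw, hr, hR]
    refine .seq (Runs.ite (fun hopen => ?_) fun hdet => ?_)
    · have ho : lo < s.real rItem j ∧ s.real rItem j < hi := by
        simpa [hj, e5, e6, e7] using hopen
      have hqo : q (j + 1)
          = ([], (s.word aItemK j, s.word aItemM j, s.real rItem j) :: (q j).items) := by
        rw [hq1, Compressed.push, if_pos ho]
      rw [hqo] at hl1 hsuml1
      simp only [Compressed.items, List.map_nil, List.nil_append, List.length_cons,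
        List.map_cons, List.sum_cons] at hl1 hsuml1
      refine (runs_pushOpenProg (B := B) hD hH (by rw [hj, e3]) (by rw [hj, e4]) (by rw [hj, e5]) hst
        (by omega) (by omega) (by simp only [Compressed.items]; omega)).frame.mono ?_
      rintro t s'' ⟨⟨ht, h1, h2⟩, h3, h4⟩
      refine fin s'' (t + 1) ?_ ?_ ?_ (fun a ha => h3 a ?_) fun a ha => h4 a ?_
      · simp only [φ, hqo, List.length_nil]; omega
      · rw [h1, hqo]; rfl
      · rw [h2, hqo]; rfl
      · simp only [pushOpenProg, Program.wordWrites]; simp_all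
      · simp only [pushOpenProg, Program.realWrites]; simp_all
    · have hd : ¬ (lo < s.real rItem j ∧ s.real rItem j < hi) := by
        simpa [hj, e5, e6, e7] using hdet
      set b := Item.height lo (s.word aItemK j, s.word aItemM j, s.real rItem j) with hb
      have hqd : q (j + 1)
          = (pushTop b (s.word aItemM j) (absorbTop b (q j).1), (q j).2) := by
        rw [hq1, Compressed.push, if_neg hd]
      have hbH : b ≤ H := by
        simp only [hb, Item.height]; split_ifs <;> omega
      -- Storing the height of the item.
      have hstep : Runs B (.ite (.realLt (rvar rCLo) (.read rItem (wvar vJ)))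
          (.storeWord vHeight 0 (.read aItemK (wvar vJ) + 1))
          (.storeWord vHeight 0 (.read aItemK (wvar vJ)))) s' fun t s'' =>
          t ≤ 2 ∧ s'' = s'.setWord vHeight 0 b := by
        refine Runs.ite (fun h => ?_) fun h => ?_
        · have h' : lo < s.real rItem j := by simpa [hj, e5, e6] using h
          refine .storeWord ?_ ?_ ⟨by omega, ?_⟩
          · simp; omega
          · simp [hj, e3]; omega
          · simp [hj, e3, hb, Item.height, h']
        · have h' : ¬ lo < s.real rItem j := by simpa [hj, e5, e6] using h
          refine .storeWord ?_ ?_ ⟨by omega, ?_⟩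
          · simp; omega
          · simp [hj, e3]; omega
          · simp [hj, e3, hb, Item.height, h']
      refine .seq (hstep.mono ?_)
      rintro t1 _ ⟨ht1, rfl⟩
      have hmem' := forall_mem_items.1 hgj.mem
      have hpos' := forall_mem_items.1 hgj.pos
      rw [sum_items] at hsj
      have hdlen : (q j).2.length ≤ ((q j).2.map (·.2.1)).sum := by
        have := List.card_nsmul_le_sum ((q j).2.map (·.2.1)) 1 (by
          simp only [List.mem_map]
          rintro x ⟨e, he, rfl⟩
          exact hpos'.2 e he)
        simpa using this
      refine .seq ((runs_absorbProg (B := B) (H := H) (D := D) (b := b) (l := (q j).1)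
        (d := (q j).2) ?_ hH hD (by simp) hbH ?_ ?_ ?_ ?_).frame.mono ?_)
      · intro i hi
        simpa [e2] using hs.pow i hi
      · simpa using hba
      · simpa [stackItems] using hst
      · intro e he
        exact ⟨hpos'.1 e he, by simpa [Nat.lt_succ_iff] using (hmem'.1 e he).1⟩
      · omega
      · rintro t2 s2 ⟨⟨ht2, h1⟩, h2, h3⟩
        rw [hqd, sum_items] at hsuml1
        rw [hqd, Compressed.items, List.length_append, List.length_map] at hl1
        simp only at hsuml1 hl1
        simp only [absorbProg, Program.wordWrites, Program.realWrites] at h2 h3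
        refine (runs_pushProg (B := B) (D := D) (b := b) (m := s.word aItemM j) (d := (q j).2) hD
          ?_ (by omega) ?_ ?_ h1 ?_ ?_).frame.mono ?_
        · rw [h2 vHeight (by simp)]; simp
        · rw [h2 vJ (by simp), h2 aItemM (by simp)]; simp [hj, e4]
        · rw [h2 vBase (by simp)]; simpa using hba
        · omega
        · exact hl1
        · rintro t3 s3 ⟨⟨ht3, h4⟩, h5, h6⟩
          simp only [pushProg, Program.wordWrites, Program.realWrites] at h5 h6
          have := fin s3 (t1 + (t2 + t3) + 1) ?_ ?_ ?_ ?_ ?_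
          · exact this
          · simp only [φ, hqd]
            have : (pushTop b (s.word aItemM j) (absorbTop b (q j).1)).length
                ≤ (absorbTop b (q j).1).length + 1 := by
              cases absorbTop b (q j).1 with
              | nil => simp [pushTop]
              | cons e l => rw [pushTop]; split_ifs <;> simp
            omega
          · rw [h4, hqd]
          · rw [h5 vBase (by simp), h2 vBase (by simp), hqd]; simpa using hba
          · intro a ha
            simp only [List.mem_cons, not_or] at ha
            rw [h5 a (by simp; tauto), h2 a (by simp; tauto)]
            simp [ha]
          · intro a ha
            rw [h6 a (by simpa using ha), h3 a (by simp)]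
            simp
  · rintro t s' ⟨j, ⟨hjN, hj, hst, hba, e1, hR⟩, hc, ht⟩
    have hjN' : j = N := by
      simp only [Cond.holds_wordLt, WExpr.eval_read, WExpr.eval_ofNat, hj, e1] at hc
      omega
    subst hjN'
    refine ⟨?_, hst⟩
    have : φ 0 = 20 * N := by simp [φ, q, pre, itemList, compress]
    omega

/-! ### Sorting -/

/-- The multiset of the entries `A a, …, A (b - 1)`. -/
def slice (A : ℕ → ℝ) (a b : ℕ) : Multiset ℝ := ↑((List.Ico a b).map A)

theorem slice_self (A : ℕ → ℝ) (a : ℕ) : slice A a a = 0 := by simp [slice]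

theorem slice_succ (A : ℕ → ℝ) {a b : ℕ} (h : a ≤ b) :
    slice A a (b + 1) = slice A a b + {A b} := by
  rw [slice, List.Ico.succ_top h, List.map_append, ← Multiset.coe_add]
  rfl

theorem slice_add_slice (A : ℕ → ℝ) {a b c : ℕ} (hab : a ≤ b) (hbc : b ≤ c) :
    slice A a b + slice A b c = slice A a c := by
  rw [slice, slice, slice, ← List.Ico.append_consecutive hab hbc, List.map_append,
    ← Multiset.coe_add]

theorem slice_congr {A A' : ℕ → ℝ} {a b : ℕ} (h : ∀ i, a ≤ i → i < b → A i = A' i) :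
    slice A a b = slice A' a b := by
  rw [slice, slice]
  congr 1
  refine List.map_congr_left fun i hi => ?_
  rw [List.Ico.mem] at hi
  exact h i hi.1 hi.2

theorem mem_slice {A : ℕ → ℝ} {a b : ℕ} {x : ℝ} :
    x ∈ slice A a b ↔ ∃ i, a ≤ i ∧ i < b ∧ A i = x := by
  simp [slice, and_assoc]

/-- Every block of `g` consecutive entries is sorted. -/
def SortedBlocks (g : ℕ) (A : ℕ → ℝ) (N : ℕ) : Prop :=
  ∀ i j, i < j → j < N → i / g = j / g → A i ≤ A j

/-- The state of a pass of bottom-up merge sort which has written `T 0, …, T (r - 1)` and is about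
to merge `A p, …, A (m - 1)` with `A q, …, A (e - 1)`; the current block begins at `b`. -/
structure MergeInv (A : ℕ → ℝ) (w N : ℕ) (T : ℕ → ℝ) (r p q m e b : ℕ) : Prop where
  bp : b ≤ p
  pm : p ≤ m
  mq : m ≤ q
  qe : q ≤ e
  eN : e ≤ N
  sum : r + m = p + q
  dvd : 2 * w ∣ b
  eb : e ≤ b + 2 * w
  next : e = N ∨ 2 * w ∣ e
  left : ∀ i j, b ≤ i → i < j → j < m → A i ≤ A j
  right : ∀ i j, m ≤ i → i < j → j < e → A i ≤ A j
  perm : slice T 0 r = slice A 0 b + slice A b p + slice A m q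
  sorted : SortedBlocks (2 * w) T r
  le : ∀ i, b ≤ i → i < r → (∀ x, p ≤ x → x < m → T i ≤ A x) ∧ ∀ x, q ≤ x → x < e → T i ≤ A x

namespace MergeInv

variable {A : ℕ → ℝ} {w N : ℕ} {T : ℕ → ℝ} {r p q m e b : ℕ}

theorem init (A : ℕ → ℝ) (w N : ℕ) (T : ℕ → ℝ) : MergeInv A w N T 0 0 0 0 0 0 where
  bp := le_rfl
  pm := le_rfl
  mq := le_rfl
  qe := le_rfl
  eN := Nat.zero_le _
  sum := rfl
  dvd := dvd_zero _
  eb := Nat.zero_le _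
  next := .inr (dvd_zero _)
  left := by intros; omega
  right := by intros; omega
  perm := by simp [slice_self]
  sorted := by intro i j _ h; omega
  le := by intros; omega

theorem perm_of_eq (h : MergeInv A w N T e p q m e b) : slice T 0 e = slice A 0 e := by
  have h1 := h.pm
  have h2 := h.qe
  have h3 := h.sum
  have hp : p = m := by omega
  have hq : q = e := by omega
  subst hp hq
  rw [h.perm, slice_add_slice A (Nat.zero_le _) h.bp, slice_add_slice A (Nat.zero_le _) h.mq]

theorem div_eq {w b i : ℕ} (h : w ∣ b) (h1 : b ≤ i) (h2 : i < b + w) : i / w = b / w := by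
  obtain ⟨c, rfl⟩ := h
  have hw : 0 < w := by omega
  rw [Nat.mul_div_cancel_left _ hw]
  apply Nat.div_eq_of_lt_le
  · rwa [mul_comm]
  · rwa [Nat.succ_mul, mul_comm]

/-- The next pair of blocks. -/
theorem newBlock (h : MergeInv A w N T e p q m e b) (hA : SortedBlocks w A N) (he : e < N) :
    MergeInv A w N T e e (min (e + w) N) (min (e + w) N) (min (min (e + w) N + w) N) e where
  bp := le_rfl
  pm := by omega
  mq := le_rfl
  qe := by omega
  eN := min_le_right _ _
  sum := rfl
  dvd := h.next.resolve_left he.ne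
  eb := by omega
  next := by
    rcases le_total N (min (e + w) N + w) with h1 | h1
    · exact .inl (min_eq_right h1)
    · rw [min_eq_left h1]
      by_cases h2 : min (e + w) N + w = N
      · exact .inl h2
      · have : min (e + w) N + w = e + 2 * w := by omega
        rw [this]
        exact .inr ((h.next.resolve_left he.ne).add (dvd_refl _))
  left := fun i j h1 h2 h3 => by
    have hd : w ∣ e := (Dvd.intro_left 2 rfl).trans (h.next.resolve_left he.ne)
    refine hA i j h2 (by omega) ?_
    exact (div_eq hd h1 (by omega)).trans (div_eq hd (by omega) (by omega)).symm
  right := fun i j h1 h2 h3 => by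
    have hd : w ∣ e + w := ((Dvd.intro_left 2 rfl).trans (h.next.resolve_left he.ne)).add
      (dvd_refl _)
    refine hA i j h2 (by omega) ?_
    exact (div_eq hd (by omega) (by omega)).trans (div_eq hd (by omega) (by omega)).symm
  perm := by rw [h.perm_of_eq, slice_self, slice_self, add_zero, add_zero]
  sorted := h.sorted
  le := by intros; omega

theorem sorted_update (h : MergeInv A w N T r p q m e b) (hr : r < e) {x : ℝ}
    (hx : ∀ i, b ≤ i → i < r → T i ≤ x) : SortedBlocks (2 * w) (Function.update T r x) (r + 1) := by
  intro i j h1 h2 h3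
  rw [Function.update_of_ne (by omega)]
  rcases Nat.lt_succ_iff_lt_or_eq.1 h2 with h4 | rfl
  · rw [Function.update_of_ne (by omega)]
    exact h.sorted i j h1 h4 h3
  · rw [Function.update_self]
    refine hx i ?_ h1
    have e1 := h.eb
    have e2 := h.bp
    have e3 := h.mq
    have e4 := h.sum
    by_contra hc
    rw [div_eq h.dvd (by omega) (by omega : j < b + 2 * w)] at h3
    obtain ⟨c, hc'⟩ := h.dvd
    subst hc'
    have hw : 0 < 2 * w := by omega
    rw [Nat.mul_div_cancel_left _ hw] at h3
    have := (Nat.div_lt_iff_lt_mul hw).2 (show i < c * (2 * w) by rw [mul_comm]; omega)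
    omega

theorem slice_update (T : ℕ → ℝ) (r : ℕ) (x : ℝ) :
    slice (Function.update T r x) 0 (r + 1) = slice T 0 r + {x} := by
  rw [slice_succ _ (Nat.zero_le _), Function.update_self]
  congr 1
  exact slice_congr fun i _ hi => Function.update_of_ne hi.ne _ _

theorem stepLeft (h : MergeInv A w N T r p q m e b) (hp : p < m)
    (hq : q < e → A p ≤ A q) : MergeInv A w N (Function.update T r (A p)) (r + 1) (p + 1) q m e b where
  bp := h.bp.trans (Nat.le_succ _)
  pm := hp
  mq := h.mq
  qe := h.qe
  eN := h.eN
  sum := by have := h.sum; omega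
  dvd := h.dvd
  eb := h.eb
  next := h.next
  left := h.left
  right := h.right
  perm := by rw [slice_update, h.perm, slice_succ A h.bp]; abel
  sorted := h.sorted_update (by have := h.sum; have := h.qe; omega) fun i h1 h2 =>
    (h.le i h1 h2).1 p le_rfl hp
  le := by
    have hAq : ∀ x, q ≤ x → x < e → A p ≤ A x := fun x h1 h2 => by
      rcases h1.eq_or_lt with rfl | h1'
      · exact hq h2
      · exact (hq (h1.trans_lt h2)).trans (h.right q x h.mq h1' h2)
    intro i h1 h2
    rcases Nat.lt_succ_iff_lt_or_eq.1 h2 with h3 | rfl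
    · rw [Function.update_of_ne h3.ne]
      exact ⟨fun x h4 h5 => (h.le i h1 h3).1 x (by omega) h5, (h.le i h1 h3).2⟩
    · rw [Function.update_self]
      exact ⟨fun x h4 h5 => h.left p x h.bp h4 h5, hAq⟩

theorem stepRight (h : MergeInv A w N T r p q m e b) (hq : q < e)
    (hp : p < m → A q ≤ A p) : MergeInv A w N (Function.update T r (A q)) (r + 1) p (q + 1) m e b where
  bp := h.bp
  pm := h.pm
  mq := h.mq.trans (Nat.le_succ _)
  qe := hq
  eN := h.eN
  sum := by have := h.sum; omega
  dvd := h.dvd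
  eb := h.eb
  next := h.next
  left := h.left
  right := h.right
  perm := by rw [slice_update, h.perm, slice_succ A h.mq]; abel
  sorted := h.sorted_update (by have := h.sum; have := h.pm; omega) fun i h1 h2 =>
    (h.le i h1 h2).2 q le_rfl hq
  le := by
    have hAp : ∀ x, p ≤ x → x < m → A q ≤ A x := fun x h1 h2 => by
      rcases h1.eq_or_lt with rfl | h1'
      · exact hp h2
      · exact (hp (h1.trans_lt h2)).trans (h.left p x h.bp h1' h2)
    intro i h1 h2
    rcases Nat.lt_succ_iff_lt_or_eq.1 h2 with h3 | rfl
    · rw [Function.update_of_ne h3.ne]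
      exact ⟨(h.le i h1 h3).1, fun x h4 h5 => (h.le i h1 h3).2 x (by omega) h5⟩
    · rw [Function.update_self]
      exact ⟨hAp, fun x h4 h5 => h.right q x h.mq h4 h5⟩

end MergeInv

/-- Merge pairs of sorted blocks. -/
def mergeProg : Program :=
  .storeWord vR 0 0 ⨾ .storeWord vP 0 0 ⨾ .storeWord vQ 0 0 ⨾
  .storeWord vSplit 0 0 ⨾ .storeWord vEnd 0 0 ⨾
  .loop (.wordLt (wvar vR) (wvar vLen))
    (.ite (.wordLt (wvar vR) (wvar vEnd))
      (.storeWord vI 0 0)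
      (.storeWord vP 0 (wvar vR) ⨾
        .ite (.wordLt (wvar vR + wvar vWidth) (wvar vLen))
          (.storeWord vSplit 0 (wvar vR + wvar vWidth)) (.storeWord vSplit 0 (wvar vLen)) ⨾
        .storeWord vQ 0 (wvar vSplit) ⨾
        .ite (.wordLt (wvar vSplit + wvar vWidth) (wvar vLen))
          (.storeWord vEnd 0 (wvar vSplit + wvar vWidth)) (.storeWord vEnd 0 (wvar vLen))) ⨾
      .ite (.and (.wordLt (wvar vP) (wvar vSplit))
          (.not (.and (.wordLt (wvar vQ) (wvar vEnd))
            (.realLt (.read rSort (wvar vQ)) (.read rSort (wvar vP))))))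
        (.storeReal rMerge (wvar vR) (.read rSort (wvar vP)) ⨾
          .storeWord vP 0 (wvar vP + 1))
        (.storeReal rMerge (wvar vR) (.read rSort (wvar vQ)) ⨾
          .storeWord vQ 0 (wvar vQ + 1)) ⨾
      .storeWord vR 0 (wvar vR + 1))

/-- Copy the merged blocks back. -/
def copyBackProg : Program :=
  .storeWord vI 0 0 ⨾
  .loop (.wordLt (wvar vI) (wvar vLen))
    (.storeReal rSort (wvar vI) (.read rMerge (wvar vI)) ⨾ .storeWord vI 0 (wvar vI + 1))

/-- Sort blocks of the array, whose size is the least power of two that is at least the target. -/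
def sortProg : Program :=
  .storeWord vWidth 0 1 ⨾
  .loop (.wordLt (wvar vWidth) (wvar vTarget))
    (mergeProg ⨾ copyBackProg ⨾ .storeWord vWidth 0 (wvar vWidth + wvar vWidth))

theorem runs_mergeProg {B w N : ℕ} {s : State} (hw : s.word vWidth 0 = w)
    (hN : s.word vLen 0 = N) (hNB : N < B) (hA : SortedBlocks w (s.real rSort) N) (hw0 : 0 < w) :
    Runs B mergeProg s fun t s' => t ≤ 13 * N + 6 ∧
      slice (s'.real rMerge) 0 N = slice (s.real rSort) 0 N ∧
      SortedBlocks (2 * w) (s'.real rMerge) N := by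
  classical
  set A := s.real rSort with hAdef
  let R : ℕ → State → Prop := fun r s' =>
    (∃ p q m e b, MergeInv A w N (s'.real rMerge) r p q m e b ∧ s'.word vP 0 = p ∧
      s'.word vQ 0 = q ∧ s'.word vSplit 0 = m ∧ s'.word vEnd 0 = e) ∧ s'.word vR 0 = r ∧
    s'.word vLen 0 = N ∧ s'.word vWidth 0 = w ∧ s'.real rSort = A
  refine .seq (.storeWord ?_ ?_ (.seq (.storeWord ?_ ?_ (.seq (.storeWord ?_ ?_
    (.seq (.storeWord ?_ ?_ (.seq (.storeWord ?_ ?_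
    ((Runs.loop (R := R) (φ := fun r => 13 * (N - r)) (g := 0) ?_ ?_).mono ?_))))))))))
  any_goals simp; omega
  · exact ⟨⟨0, 0, 0, 0, 0, MergeInv.init _ _ _ _, by simp⟩, by simp [hw, hN, hAdef]⟩
  · rintro r s' ⟨⟨p, q, m, e, b, hI, hp, hq, hm, he⟩, hr, hN', hw', hA'⟩ hc
    simp only [Cond.holds_wordLt, WExpr.eval_read, WExpr.eval_ofNat, hr, hN'] at hc
    have hre : r ≤ e := by have := hI.pm; have := hI.qe; have := hI.sum; omega
    have heN := hI.eN
    -- After the first test, the current block is not exhausted.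
    have first : Runs B (.ite (.wordLt (wvar vR) (wvar vEnd))
        (.storeWord vI 0 0)
        (.storeWord vP 0 (wvar vR) ⨾
          .ite (.wordLt (wvar vR + wvar vWidth) (wvar vLen))
            (.storeWord vSplit 0 (wvar vR + wvar vWidth)) (.storeWord vSplit 0 (wvar vLen)) ⨾
          .storeWord vQ 0 (wvar vSplit) ⨾
          .ite (.wordLt (wvar vSplit + wvar vWidth) (wvar vLen))
            (.storeWord vEnd 0 (wvar vSplit + wvar vWidth)) (.storeWord vEnd 0 (wvar vLen))))
        s' fun t s'' => t ≤ 8 ∧ (∃ p q m e b, MergeInv A w N (s''.real rMerge) r p q m e b ∧ r < e ∧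
          s''.word vP 0 = p ∧ s''.word vQ 0 = q ∧ s''.word vSplit 0 = m ∧ s''.word vEnd 0 = e) ∧
          s''.word vR 0 = r ∧ s''.word vLen 0 = N ∧ s''.word vWidth 0 = w ∧
          s''.real rSort = A := by
      refine Runs.ite (fun h => ?_) fun h => ?_
      · simp only [Cond.holds_wordLt, WExpr.eval_read, WExpr.eval_ofNat, hr, he] at h
        refine .storeWord ?_ ?_ ⟨by omega, ⟨p, q, m, e, b, ?_, h, ?_⟩, ?_⟩
        · simp; omega
        · simp; omega
        · simpa using hI
        · simp [hp, hq, hm, he]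
        · simp [hr, hN', hw', hA']
      · simp only [Cond.holds_wordLt, WExpr.eval_read, WExpr.eval_ofNat, hr, he] at h
        obtain rfl : r = e := by omega
        have hB := hI.newBlock hA hc
        refine .seq (.storeWord ?_ ?_ (.seq (Runs.mono (Q := fun t s'' => t ≤ 2 ∧
          s'' = (s'.setWord vP 0 r).setWord vSplit 0 (min (r + w) N)) ?_ ?_)))
        · simp; omega
        · simp [hr]; omega
        · refine Runs.ite (fun h => ?_) fun h => ?_
          · simp [hr, hN', hw'] at h
            refine .storeWord ?_ ?_ ⟨by omega, ?_⟩
            · simp; omega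
            · simp [hr, hw']; omega
            · simp [hr, hw', min_eq_left h.le]
          · simp [hr, hN', hw'] at h
            refine .storeWord ?_ ?_ ⟨by omega, ?_⟩
            · simp; omega
            · simp [hN']; omega
            · simp [hr, hN', min_eq_right h]
        · rintro t1 _ ⟨ht1, rfl⟩
          refine .seq (.storeWord ?_ ?_ (Runs.mono (Q := fun t s'' => t ≤ 2 ∧
            s'' = (((s'.setWord vP 0 r).setWord vSplit 0 (min (r + w) N)).setWord vQ 0
              (min (r + w) N)).setWord vEnd 0 (min (min (r + w) N + w) N)) ?_ ?_))
          · simp; omega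
          · simp; omega
          · refine Runs.ite (fun h => ?_) fun h => ?_
            · simp only [Cond.holds_wordLt, WExpr.eval_add, WExpr.eval_read, WExpr.eval_ofNat,
                ne_eq, Nat.reduceEqDiff, not_false_eq_true, State.word_setWord_of_ne,
                State.word_setWord_self, Function.update_self, hw', hN'] at h
              refine .storeWord ?_ ?_ ⟨by omega, ?_⟩
              · simp; omega
              · simp [hw']; omega
              · simp [hw', min_eq_left h.le]
            · simp only [Cond.holds_wordLt, WExpr.eval_add, WExpr.eval_read, WExpr.eval_ofNat,
                ne_eq, Nat.reduceEqDiff, not_false_eq_true, State.word_setWord_of_ne,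
                State.word_setWord_self, Function.update_self, hw', hN', not_lt] at h
              refine .storeWord ?_ ?_ ⟨by omega, ?_⟩
              · simp; omega
              · simp [hN']; omega
              · simp [hN', min_eq_right h]
          · rintro t2 _ ⟨ht2, rfl⟩
            refine ⟨by omega, ⟨_, _, _, _, _, by simpa using hB, by omega, ?_⟩, ?_⟩
            · simp
            · simp [hr, hN', hw', hA']
    refine .seq (first.mono ?_)
    clear first hre heN he hm hq hp hI hr hN' hw' hA'
    clear p q m e b
    rintro t1 s1 ⟨ht1, ⟨p, q, m, e, b, hI, hre, hp, hq, hm, he⟩, hr, hN', hw', hA'⟩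
    have e1 := hI.pm
    have e2 := hI.qe
    have e3 := hI.sum
    have e4 := hI.eN
    have e5 := hI.mq
    refine .seq (Runs.mono (Q := fun t s'' => t ≤ 3 ∧
      (∃ p q m e b, MergeInv A w N (s''.real rMerge) (r + 1) p q m e b ∧ s''.word vP 0 = p ∧
      s''.word vQ 0 = q ∧ s''.word vSplit 0 = m ∧ s''.word vEnd 0 = e) ∧ s''.word vR 0 = r ∧
      s''.word vLen 0 = N ∧ s''.word vWidth 0 = w ∧ s''.real rSort = A) ?_ ?_)
    · refine Runs.ite (fun h => ?_) fun h => ?_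
      · simp only [Cond.holds_and, Cond.holds_not, Cond.holds_wordLt, Cond.holds_realLt,
          WExpr.eval_read, WExpr.eval_ofNat, RExpr.eval_read, hp, hq, hm, he, hA', not_and,
          not_lt] at h
        refine .seq (.storeReal ?_ (.storeWord ?_ ?_ ⟨by omega, ⟨_, _, _, _, b,
          ?_, rfl, rfl, rfl, rfl⟩, ?_⟩))
        · simp [hr]; omega
        · simp; omega
        · simp [hp]; omega
        · have := hI.stepLeft h.1 h.2
          simpa [hp, hq, hm, he, hA', hr] using this
        · simp [hr, hN', hw', hA']
      · simp only [Cond.holds_and, Cond.holds_not, Cond.holds_wordLt, Cond.holds_realLt,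
          WExpr.eval_read, WExpr.eval_ofNat, RExpr.eval_read, hp, hq, hm, he, hA', not_and] at h
        have hqe : q < e := by
          by_contra hqe
          exact h (by omega) fun h' => absurd h' hqe
        refine .seq (.storeReal ?_ (.storeWord ?_ ?_ ⟨by omega, ⟨_, _, _, _, b,
          ?_, rfl, rfl, rfl, rfl⟩, ?_⟩))
        · simp [hr]; omega
        · simp; omega
        · simp [hq]; omega
        · have := hI.stepRight hqe fun hpm => by_contra fun hlt =>
            h hpm fun _ hle => hlt hle.le
          simpa [hp, hq, hm, he, hA', hr] using this
        · simp [hr, hN', hw', hA']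
    · rintro t2 s2 ⟨ht2, ⟨p, q, m, e, b, hI, hp, hq, hm, he⟩, hr, hN', hw', hA'⟩
      refine .storeWord ?_ ?_ ⟨r + 1, ⟨⟨p, q, m, e, b, ?_, ?_⟩, ?_⟩, ?_⟩
      · simp; omega
      · simp [hr]; omega
      · simpa using hI
      · simp [hp, hq, hm, he]
      · simp [hr, hN', hw', hA']
      · omega
  · rintro t s' ⟨r, ⟨⟨p, q, m, e, b, hI, -⟩, hr, hN', -⟩, hc, ht⟩
    simp only [Cond.holds_wordLt, WExpr.eval_read, WExpr.eval_ofNat, hr, hN', not_lt] at hc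
    have e1 := hI.pm
    have e2 := hI.qe
    have e3 := hI.sum
    have e4 := hI.eN
    obtain rfl : r = e := by omega
    obtain rfl : r = N := by omega
    exact ⟨by simp at ht; omega, hI.perm_of_eq, hI.sorted⟩

theorem runs_copyBackProg {B N : ℕ} {s : State} (hN : s.word vLen 0 = N) (hNB : N < B) :
    Runs B copyBackProg s fun t s' => t ≤ 3 * N + 2 ∧
      ∀ i < N, s'.real rSort i = s.real rMerge i := by
  let R : ℕ → State → Prop := fun r s' => r ≤ N ∧ s'.word vI 0 = r ∧
    s'.word vLen 0 = N ∧ s'.real rMerge = s.real rMerge ∧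
    ∀ i < r, s'.real rSort i = s.real rMerge i
  refine .seq (.storeWord ?_ ?_
    ((Runs.loop (R := R) (φ := fun r => 3 * (N - r)) (g := 0) ?_ ?_).mono ?_))
  · simp; omega
  · simp; omega
  · exact ⟨Nat.zero_le _, by simp [hN]⟩
  · rintro r s' ⟨hrN, hr, hN', hT, h⟩ hc
    simp only [Cond.holds_wordLt, WExpr.eval_read, WExpr.eval_ofNat, hr, hN'] at hc
    refine .seq (.storeReal ?_ (.storeWord ?_ ?_ ⟨r + 1, ⟨hc, ?_, ?_, ?_, ?_⟩, by omega⟩))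
    · simp [hr]; omega
    · simp; omega
    · simp [hr]; omega
    · simp [hr]
    · simp [hN']
    · simp [hT]
    · intro i hi
      rcases Nat.lt_succ_iff_lt_or_eq.1 hi with h1 | rfl
      · simp [hr, h1.ne, h i h1]
      · simp [hr, hT]
  · rintro t s' ⟨r, ⟨hrN, hr, hN', hT, h⟩, hc, ht⟩
    simp only [Cond.holds_wordLt, WExpr.eval_read, WExpr.eval_ofNat, hr, hN', not_lt] at hc
    obtain rfl : r = N := by omega
    exact ⟨by simp at ht; omega, h⟩

theorem runs_sortProg {B N g : ℕ} {s : State} (hB : 1 < B) (hN : s.word vLen 0 = N) (hNB : N < B)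
    (hg : s.word vTarget 0 = g) (hgB : 2 * g < B) :
    Runs B sortProg s fun t s' => t ≤ (16 * N + 10) * Nat.clog 2 g + 2 ∧
      slice (s'.real rSort) 0 N = slice (s.real rSort) 0 N ∧
      SortedBlocks (2 ^ Nat.clog 2 g) (s'.real rSort) N := by
  let R : ℕ → State → Prop := fun i s' => i ≤ Nat.clog 2 g ∧ s'.word vWidth 0 = 2 ^ i ∧
    s'.word vLen 0 = N ∧ s'.word vTarget 0 = g ∧
    slice (s'.real rSort) 0 N = slice (s.real rSort) 0 N ∧ SortedBlocks (2 ^ i) (s'.real rSort) N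
  refine .seq (.storeWord ?_ ?_ ((Runs.loop (R := R)
    (φ := fun i => (16 * N + 10) * (Nat.clog 2 g - i)) (g := 0) ?_ ?_).mono ?_))
  · simp; omega
  · simpa using hB
  · refine ⟨Nat.zero_le _, by simp, by simp [hN], by simp [hg], by simp, ?_⟩
    intro i j h1 h2 h3
    simp at h3
    omega
  · rintro i s1 ⟨hi, hw, hN1, hg1, hperm, hsorted⟩ hc
    simp only [Cond.holds_wordLt, WExpr.eval_read, WExpr.eval_ofNat, hw, hg1] at hc
    have hi' : i < Nat.clog 2 g := (Nat.lt_clog_iff_pow_lt one_lt_two).2 hc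
    refine .seq ((runs_mergeProg (B := B) hw hN1 hNB hsorted (by positivity)).frame.mono ?_)
    rintro t2 s2 ⟨⟨ht2, h1, h2⟩, h3, h4⟩
    simp only [mergeProg, Program.wordWrites, Program.realWrites] at h3 h4
    refine .seq ((runs_copyBackProg (B := B) (N := N) ?_ hNB).frame.mono ?_)
    · rw [h3 vLen (by simp), hN1]
    rintro t3 s3 ⟨⟨ht3, h5⟩, h6, h7⟩
    simp only [copyBackProg, Program.wordWrites, Program.realWrites] at h6 h7
    have hw3 : s3.word vWidth 0 = 2 ^ i := by rw [h6 vWidth (by simp), h3 vWidth (by simp), hw]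
    refine .storeWord ?_ ?_ ⟨i + 1, ⟨hi', ?_, ?_, ?_, ?_, ?_⟩, ?_⟩
    · simp; omega
    · simp [hw3]; omega
    · simp [hw3]; ring
    · simp [h6 vLen, h3 vLen, hN1]
    · simp [h6 vTarget, h3 vTarget, hg1]
    · rw [State.real_setWord, slice_congr fun i _ hi => h5 i hi, h1, hperm]
    · intro a b hab hb hdiv
      rw [State.real_setWord, h5 a (by omega), h5 b hb]
      refine h2 a b hab hb ?_
      rwa [pow_succ'] at hdiv
    · obtain ⟨k, hk⟩ : ∃ k, Nat.clog 2 g - i = k + 1 := ⟨Nat.clog 2 g - i - 1, by omega⟩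
      have : Nat.clog 2 g - (i + 1) = k := by omega
      rw [this, hk, Nat.mul_succ]
      omega
  · rintro t s' ⟨i, ⟨hi, hw, hN1, hg1, hperm, hsorted⟩, hc, ht⟩
    simp only [Cond.holds_wordLt, WExpr.eval_read, WExpr.eval_ofNat, hw, hg1, not_lt] at hc
    obtain rfl : i = Nat.clog 2 g := le_antisymm hi ((Nat.clog_le_iff_le_pow one_lt_two).2 hc)
    refine ⟨?_, hperm, hsorted⟩
    simp only [Nat.sub_self, Nat.mul_zero, Nat.add_zero, Nat.sub_zero] at ht
    omega

/-! ### Tests and binary search -/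

/-- Compress the items for the known threshold `rF`. -/
def testProg : Program :=
  .storeReal rCLo 0 (rvar rF) ⨾ .storeReal rCHi 0 (rvar rF) ⨾ compressProg

/-- After `testProg`: the items collapse into at most three nodes of the height of the root, namely
the two leaves at both ends that have this height, and a single node for all leaves in between. -/
def testCond : Cond := .and (.wordLt (wvar vStack) 2) (.wordLt (.read aStackM 0) 4)

theorem runs_testProg {B H D R m m' : ℕ} {f : ℝ} {s : State} (hH : H < B) (hD : D < B)
    (hs : ItemsReady H D s) (hf : s.real rF 0 = f) (hf0 : 0 ≤ f)
    (hhead : (inputItems s).head? = some (R, m, 0))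
    (hlast : (inputItems s).getLast? = some (R, m', 0)) :
    Runs B testProg s fun t s' => t ≤ 20 * s.word vItems 0 + 6 ∧
      (testCond.Holds s' ↔ itemSum f (inputItems s) ≤ 3 * 2 ^ R) := by
  obtain ⟨c, l', h1, h2⟩ := compress_test hf0 hs.pos hhead hlast
  set s2 : State := (s.setReal rCLo 0 f).setReal rCHi 0 f with hs2
  have hin : inputItems s2 = inputItems s := by simp [inputItems, hs2]
  have hr : ItemsReady H D s2 := ⟨fun j hj => by simpa [hs2] using hs.pow j hj,
    hin.symm ▸ hs.pos, hin.symm ▸ hs.height, hin.symm ▸ hs.sum_le⟩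
  refine .seq (.storeReal ?_ (.seq (.storeReal ?_ ?_)))
  · simp; omega
  · simp; omega
  have e : ((s.setReal rCLo (WExpr.eval s 0) (RExpr.eval s (rvar rF))).setReal rCHi
      (WExpr.eval (s.setReal rCLo (WExpr.eval s 0) (RExpr.eval s (rvar rF))) 0)
      (RExpr.eval (s.setReal rCLo (WExpr.eval s 0) (RExpr.eval s (rvar rF))) (rvar rF))) = s2 := by
    simp [hs2, hf]
  rw [e]
  refine (runs_compressProg hH hD hr (by simpa [hs2] using hf0)).mono ?_
  rintro t s3 ⟨ht, hst⟩
  have hv : s2.word vItems 0 = s.word vItems 0 := by simp [hs2]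
  have hlo : s2.real rCLo 0 = f := by simp [hs2]
  have hhi : s2.real rCHi 0 = f := by simp [hs2]
  rw [hin, hlo, hhi, h1] at hst
  rw [hv] at ht
  refine ⟨by omega, ?_⟩
  rw [← h2]
  have hsp := word_stack_of_stackItems hst
  simp only [testCond, Cond.holds_and, Cond.holds_wordLt, WExpr.eval_read, WExpr.eval_ofNat, hsp,
    List.length_cons]
  cases l' with
  | nil =>
    rw [stackItems] at hst
    obtain ⟨p, hp, hk, hM, hF, -⟩ := itemList_eq_cons hst
    rw [hsp] at hp
    obtain rfl : p = 0 := by simpa using hp.symm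
    simp only [hM, List.length_nil, true_and]
    omega
  | cons e l' => simp

/-- Binary search for the first position where the test succeeds, down to an interval whose length
is at most `vGap`. The program `setup` prepares the test at the position `vMid`. -/
def searchProg (setup : Program) : Program :=
  .loop (.wordLt (wvar vLo + wvar vGap) (wvar vHi))
    (.storeWord vMid 0 ((wvar vLo + wvar vHi) / 2) ⨾ (setup ⨾ testProg) ⨾
      .ite testCond
        (.storeWord vHi 0 (wvar vMid) ⨾ .storeReal rHi 0 (rvar rF))
        (.storeWord vLo 0 (wvar vMid + 1) ⨾ .storeReal rLo 0 (rvar rF)))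

/-- `Pr m` says that the test succeeds at the position `m`, and `v m` is the threshold that belongs to
this position. The predicate need not be monotone: the search keeps a failure just below `vLo` and a
success at `vHi`, and each round halves the distance. -/
theorem runs_searchProg {B T N K r : ℕ} {setup : Program} {I : State → Prop} {Pr : ℕ → Prop}
    {v : ℕ → ℝ} {x y : ℝ} (hB : N < B)
    (hw : ∀ a ∈ [vLo, vHi, vGap, vMid], a ∉ setup.wordWrites)
    (hr : ∀ a ∈ [rLo, rHi], a ∉ setup.realWrites)
    (hstable : ∀ s s', I s → (∀ a ∉ [vLo, vHi, vMid], s'.word a = s.word a) →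
      (∀ a ∉ [rLo, rHi], s'.real a = s.real a) → I s')
    (hbody : ∀ s m, I s → s.word vMid 0 = m → m < N → Runs B (setup ⨾ testProg) s fun t s' =>
      t ≤ T ∧ I s' ∧ s'.real rF 0 = v m ∧ (testCond.Holds s' ↔ Pr m))
    (hK : N < 2 ^ r * (K + 1)) {s : State} (hs : I s) (hlo : s.word vLo 0 = 0)
    (hhi : s.word vHi 0 = N) (hgap : s.word vGap 0 = K) (hx : s.real rLo 0 = x)
    (hy : s.real rHi 0 = y) :
    Runs B (searchProg setup) s fun t s' => t ≤ (T + 5) * r + 1 ∧ I s' ∧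
      ∃ lo hi, s'.word vLo 0 = lo ∧ s'.word vHi 0 = hi ∧ lo ≤ hi ∧ hi ≤ N ∧ hi ≤ lo + K ∧
        (lo = 0 ∧ s'.real rLo 0 = x ∨ 0 < lo ∧ ¬ Pr (lo - 1) ∧ s'.real rLo 0 = v (lo - 1)) ∧
        (hi = N ∧ s'.real rHi 0 = y ∨ hi < N ∧ Pr hi ∧ s'.real rHi 0 = v hi) := by
  let R : ℕ → State → Prop := fun j s' => j ≤ r ∧ I s' ∧ s'.word vGap 0 = K ∧
    ∃ lo hi, s'.word vLo 0 = lo ∧ s'.word vHi 0 = hi ∧ lo ≤ hi ∧ hi ≤ N ∧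
        2 ^ j * (hi - lo) ≤ N ∧
        (lo = 0 ∧ s'.real rLo 0 = x ∨ 0 < lo ∧ ¬ Pr (lo - 1) ∧ s'.real rLo 0 = v (lo - 1)) ∧
        (hi = N ∧ s'.real rHi 0 = y ∨ hi < N ∧ Pr hi ∧ s'.real rHi 0 = v hi)
  refine (Runs.loop (R := R) (φ := fun j => (T + 5) * (r - j)) (g := 0) ?_ ?_).mono ?_
  · exact ⟨Nat.zero_le _, hs, hgap, 0, N, hlo, hhi, Nat.zero_le _, le_rfl, by simp,
      .inl ⟨rfl, hx⟩, .inl ⟨rfl, hy⟩⟩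
  · rintro j s1 ⟨hjr, hI, hg1, lo, hi, hlo1, hhi1, hle, hhiN, hpow, hL, hU⟩ hc
    simp only [Cond.holds_wordLt, WExpr.eval_read, WExpr.eval_ofNat, WExpr.eval_add, hlo1, hhi1,
      hg1] at hc
    have hj : j < r := by
      have h1 : 2 ^ j * (K + 1) < 2 ^ r * (K + 1) :=
        ((Nat.mul_le_mul_left _ (by omega)).trans hpow).trans_lt hK
      exact (Nat.pow_lt_pow_iff_right one_lt_two).1 (Nat.lt_of_mul_lt_mul_right h1)
    have hpot : (T + 5) * (r - j) = (T + 5) * (r - (j + 1)) + (T + 5) := by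
      rw [← Nat.mul_succ]; congr 1; omega
    set mid := (lo + hi) / 2 with hmid
    have hm1 : lo ≤ mid := by omega
    have hm2 : mid < hi := by omega
    refine .seq (.storeWord ?_ ?_ (.seq ((hbody _ mid ?_ ?_ ?_).frame.mono ?_)))
    · simp; omega
    · simp [hlo1, hhi1, ← hmid]; omega
    · refine hstable s1 _ hI (fun a ha => ?_) fun a ha => ?_
      · simp at ha; simp [ha]
      · simp
    · simp [hlo1, hhi1, ← hmid]
    · omega
    rintro t2 s2 ⟨⟨ht2, hI2, hv2, hP2⟩, hw2, hr2⟩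
    simp only [Program.wordWrites, Program.realWrites, List.mem_append, not_or] at hw2 hr2
    have wkeep : ∀ a ∈ [vLo, vHi, vGap, vMid], s2.word a = (s1.setWord vMid 0 mid).word a := by
      intro a ha
      have e : (wvar vLo + wvar vHi).eval s1 / 2 = mid := by simp [hlo1, hhi1, ← hmid]
      have e2 : s1.setWord vMid 0 mid = s1.setWord vMid (WExpr.eval s1 0)
          (((wvar vLo + wvar vHi) / 2).eval s1) := by rw [← e]; rfl
      rw [e2]
      refine hw2 a ⟨hw a ha, ?_⟩
      simp only [List.mem_cons, List.not_mem_nil, or_false] at ha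
      rcases ha with rfl | rfl | rfl | rfl <;> decide
    have rkeep : ∀ a ∈ [rLo, rHi], s2.real a = s1.real a := by
      intro a ha
      refine hr2 a ⟨hr a ha, ?_⟩
      simp only [List.mem_cons, List.not_mem_nil, or_false] at ha
      rcases ha with rfl | rfl <;> decide
    have w1 := wkeep vLo (by simp)
    have w2 := wkeep vHi (by simp)
    have w3 := wkeep vGap (by simp)
    have w4 := wkeep vMid (by simp)
    have r1 := rkeep rLo (by simp)
    have r2 := rkeep rHi (by simp)
    simp at w1 w2 w3 w4
    refine Runs.ite (fun h => ?_) fun h => ?_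
    · refine .seq (.storeWord ?_ ?_ (.storeReal ?_ ⟨j + 1, ⟨hj, ?_, ?_, lo, mid, ?_, ?_, hm1, by omega,
        ?_, ?_, ?_⟩, ?_⟩))
      · simp; omega
      · simp [w4]; omega
      · simp; omega
      · refine hstable s2 _ hI2 (fun a ha => ?_) fun a ha => ?_
        · simp at ha; simp [ha]
        · simp at ha; simp [ha]
      · simp [w3, hg1]
      · simp [w1, hlo1]
      · simp [w4]
      · calc 2 ^ (j + 1) * (mid - lo) = 2 ^ j * (2 * (mid - lo)) := by ring
          _ ≤ 2 ^ j * (hi - lo) := Nat.mul_le_mul_left _ (by omega)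
          _ ≤ N := hpow
      · simpa [r1] using hL
      · exact .inr ⟨by omega, hP2.1 h, by simp [hv2]⟩
      · omega
    · refine .seq (.storeWord ?_ ?_ (.storeReal ?_ ⟨j + 1, ⟨hj, ?_, ?_, mid + 1, hi, ?_, ?_, hm2,
        by omega, ?_, ?_, ?_⟩, ?_⟩))
      · simp; omega
      · simp [w4]; omega
      · simp; omega
      · refine hstable s2 _ hI2 (fun a ha => ?_) fun a ha => ?_
        · simp at ha; simp [ha]
        · simp at ha; simp [ha]
      · simp [w3, hg1]
      · simp [w4]
      · simp [w2, hhi1]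
      · calc 2 ^ (j + 1) * (hi - (mid + 1)) = 2 ^ j * (2 * (hi - (mid + 1))) := by ring
          _ ≤ 2 ^ j * (hi - lo) := Nat.mul_le_mul_left _ (by omega)
          _ ≤ N := hpow
      · exact .inr ⟨by omega, fun hp => h (hP2.2 hp), by simp [hv2]⟩
      · simpa [r2] using hU
      · omega
  · rintro t s' ⟨j, ⟨hjr, hI, hg1, lo, hi, hlo1, hhi1, hle, hhiN, hpow, hL, hU⟩, hc, ht⟩
    simp only [Cond.holds_wordLt, WExpr.eval_read, WExpr.eval_ofNat, WExpr.eval_add, hlo1, hhi1,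
      hg1, not_lt] at hc
    refine ⟨?_, hI, lo, hi, hlo1, hhi1, hle, hhiN, hc, hL, hU⟩
    simp only [Nat.sub_zero] at ht
    omega

/-- Prepare the test of the difference between the heights of the root and of the highest leaf. -/
def setupRootProg : Program :=
  .storeWord aItemK 0 (wvar vN + wvar vMid) ⨾
  .storeWord aItemK (wvar vN + 1) (wvar vN + wvar vMid) ⨾ .storeReal rF 0 (.ofWord 1)

/-- Prepare the test of an entry of the sorted array. -/
def setupSortedProg : Program := .storeReal rF 0 (.read rSort (wvar vMid))

/-- The items for leaves of the heights `a i`, with the fractions `F i`, between two leaves that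
have the height `R` of the root. These make the compression end in a single block of height `R`, since
the first and the last height in a sequence of items are not changed. -/
def wallItems (n R : ℕ) (a : ℕ → ℕ) (F : ℕ → ℝ) : List Item :=
  itemList (fun i => if i = 0 ∨ i = n + 1 then R else a (i - 1)) (fun _ => 1)
    (fun i => if i = 0 ∨ i = n + 1 then 0 else F (i - 1)) (n + 2)

theorem head?_wallItems (n R : ℕ) (a : ℕ → ℕ) (F : ℕ → ℝ) :
    (wallItems n R a F).head? = some (R, 1, 0) := by
  simp [wallItems, itemList]

theorem getLast?_itemList (K M : ℕ → ℕ) (F : ℕ → ℝ) (p : ℕ) :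
    (itemList K M F (p + 1)).getLast? = some (K 0, M 0, F 0) := by
  induction p with
  | zero => rfl
  | succ p ih => rw [itemList, List.getLast?_cons, ih]; rfl

theorem getLast?_wallItems (n R : ℕ) (a : ℕ → ℕ) (F : ℕ → ℝ) :
    (wallItems n R a F).getLast? = some (R, 1, 0) := by
  rw [wallItems, getLast?_itemList]; simp

theorem forall_mem_itemList {K M : ℕ → ℕ} {F : ℕ → ℝ} {p : ℕ} {P : Item → Prop} :
    (∀ e ∈ itemList K M F p, P e) ↔ ∀ i < p, P (K i, M i, F i) := by
  induction p with
  | zero => simp [itemList]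
  | succ p ih =>
    rw [itemList, List.forall_mem_cons, ih]
    constructor
    · rintro ⟨h1, h2⟩ i hi
      rcases Nat.lt_succ_iff_lt_or_eq.1 hi with h | rfl
      · exact h2 i h
      · exact h1
    · exact fun h => ⟨h p (Nat.lt_succ_self p), fun i hi => h i (hi.trans (Nat.lt_succ_self p))⟩

theorem sum_count_wallItems (n R : ℕ) (a : ℕ → ℕ) (F : ℕ → ℝ) :
    ((wallItems n R a F).map (·.2.1)).sum = n + 2 := by
  have : ∀ K F p, ((itemList K (fun _ => 1) F p).map (·.2.1)).sum = p := by
    intro K F p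
    induction p with
    | zero => rfl
    | succ p ih => rw [itemList, List.map_cons, List.sum_cons, ih, Nat.add_comm]
  exact this _ _ _

/-- The memory holds the items for the given leaves, except for the height of the root. -/
structure LeavesReady (n H : ℕ) (a : ℕ → ℕ) (F : ℕ → ℝ) (s : State) : Prop where
  pow : PowTable H (n + 2) s
  num : s.word vN 0 = n
  items : s.word vItems 0 = n + 2
  height : ∀ i < n, s.word aItemK (i + 1) = a i
  count : ∀ i < n + 2, s.word aItemM i = 1
  frac : ∀ i < n, s.real rItem (i + 1) = F i
  frac_zero : s.real rItem 0 = 0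
  frac_last : s.real rItem (n + 1) = 0

theorem itemsReady_of_eq {n H R : ℕ} {a : ℕ → ℕ} {F : ℕ → ℝ} {s : State}
    (hpow : PowTable H (n + 2) s) (ha : ∀ i < n, a i ≤ n) (hR : n ≤ R) (hRH : R + 1 ≤ H)
    (h : inputItems s = wallItems n R a F) : ItemsReady H (n + 2) s := by
  refine ⟨hpow, ?_, ?_, ?_⟩
  · rw [h, wallItems, forall_mem_itemList]; simp
  · rw [h, wallItems, forall_mem_itemList]
    intro i hi
    simp only
    split_ifs with h1
    · exact hRH
    · have := ha (i - 1) (by omega)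
      omega
  · rw [h, sum_count_wallItems]

theorem LeavesReady.runs_setupRootProg {B n H : ℕ} {a : ℕ → ℕ} {F : ℕ → ℝ} {s : State} {m : ℕ}
    (h : LeavesReady n H a F s) (hm : s.word vMid 0 = m) (hB : n + 1 < B) (hmB : n + m < B) :
    Runs B setupRootProg s fun t s' => t ≤ 3 ∧ LeavesReady n H a F s' ∧
      s'.real rF 0 = 1 ∧ inputItems s' = wallItems n (n + m) a F := by
  have hn := h.num
  have key : ∀ t s', t ≤ 3 ∧ LeavesReady n H a F s' ∧ s'.real rF 0 = 1 ∧
      s'.word aItemK 0 = n + m ∧ s'.word aItemK (n + 1) = n + m →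
      t ≤ 3 ∧ LeavesReady n H a F s' ∧ s'.real rF 0 = 1 ∧
      inputItems s' = wallItems n (n + m) a F := by
    rintro t s' ⟨ht, hl, hf, h0, h1⟩
    refine ⟨ht, hl, hf, ?_⟩
    rw [inputItems, wallItems, hl.items]
    refine itemList_congr fun i hi => ?_
    rcases Nat.eq_zero_or_pos i with rfl | hi0
    · simp [h0, hl.count 0 hi, hl.frac_zero]
    · obtain ⟨i, rfl⟩ : ∃ k, i = k + 1 := ⟨i - 1, by omega⟩
      by_cases hin : i = n
      · subst hin
        simp [h1, hl.count _ hi, hl.frac_last]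
      · simp [hin, hl.height i (by omega), hl.count _ hi, hl.frac i (by omega)]
  refine .seq (.storeWord ?_ ?_ (.seq (.storeWord ?_ ?_ (.storeReal ?_
    (key _ _ ⟨by omega, ⟨?_, ?_, ?_, ?_, ?_, ?_, ?_, ?_⟩, ?_, ?_, ?_⟩)))))
  · simp; omega
  · simp [hn, hm]; omega
  · simp [hn]; omega
  · simp [hn, hm]; omega
  · simp; omega
  · intro j hj; simpa using h.pow j hj
  · simpa using hn
  · simpa using h.items
  · intro i hi
    have := h.height i hi
    simp [hn, hm, hi.ne, this]
  · simpa using h.count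
  · simpa using h.frac
  · simpa using h.frac_zero
  · simpa using h.frac_last
  · simp
  · simp [hn, hm]
  · simp [hn, hm]

/-! ### Building the tree -/

/-- `Stores` for a tree all of whose nodes have addresses below `N`. -/
def StoresBelow (s : State) (N : ℕ) : ℕ → ℕ → BinTree → Prop
  | v, k, .leaf => v < N ∧ s.word 1 v = 0 ∧ s.word 2 v = 0 ∧ s.word 3 v = k
  | v, k, .unary t => v < N ∧ s.word 1 v ≠ 0 ∧ s.word 2 v = 0 ∧ StoresBelow s N (s.word 1 v) k t
  | v, k, .binary l r => v < N ∧ s.word 1 v ≠ 0 ∧ s.word 2 v ≠ 0 ∧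
      StoresBelow s N (s.word 1 v) k l ∧ StoresBelow s N (s.word 2 v) (k + l.numLeaves) r

theorem StoresBelow.stores {s : State} {N v k : ℕ} {T : BinTree} (h : StoresBelow s N v k T) :
    Stores s v k T := by
  induction T generalizing v k with
  | leaf => exact h.2
  | unary t ih => exact ⟨h.2.1, h.2.2.1, ih h.2.2.2⟩
  | binary l r ihl ihr => exact ⟨h.2.1, h.2.2.1, ihl h.2.2.2.1, ihr h.2.2.2.2⟩

theorem StoresBelow.lt {s : State} {N v k : ℕ} {T : BinTree} (h : StoresBelow s N v k T) :
    v < N := by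
  cases T <;> exact h.1

theorem StoresBelow.congr {s s' : State} {N N' v k : ℕ} {T : BinTree} (h : StoresBelow s N v k T)
    (hN : N ≤ N') (hs : ∀ a ∈ [1, 2, 3], ∀ u < N, s'.word a u = s.word a u) :
    StoresBelow s' N' v k T := by
  have h1 := fun u => hs 1 (by simp) u
  have h2 := fun u => hs 2 (by simp) u
  have h3 := fun u => hs 3 (by simp) u
  induction T generalizing v k with
  | leaf =>
    have hv := h.lt
    rw [StoresBelow, h1 v hv, h2 v hv, h3 v hv]
    exact ⟨hv.trans_le hN, h.2⟩
  | unary t ih =>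
    have hv := h.lt
    rw [StoresBelow, h1 v hv, h2 v hv]
    exact ⟨hv.trans_le hN, h.2.1, h.2.2.1, ih h.2.2.2⟩
  | binary l r ihl ihr =>
    have hv := h.lt
    rw [StoresBelow, h1 v hv, h2 v hv]
    exact ⟨hv.trans_le hN, h.2.1, h.2.2.1, ihl h.2.2.2.1, ihr h.2.2.2.2⟩

/-- The leaves of `T`, which are numbered from `c` on, can have the heights `k` if the root of `T`
has height `l`. -/
def FitsHeight (k : ℕ → ℕ) (c l : ℕ) (T : BinTree) : Prop :=
  ∀ j (hj : j < T.depths.length), T.depths[j] + k (c + j) ≤ l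

theorem fitsHeight_leaf {k : ℕ → ℕ} {c l : ℕ} (h : k c ≤ l) : FitsHeight k c l .leaf := by
  intro j hj
  obtain rfl : j = 0 := by simpa [BinTree.depths] using hj
  simpa [BinTree.depths] using h

theorem FitsHeight.mono {k : ℕ → ℕ} {c l l' : ℕ} {T : BinTree} (h : FitsHeight k c l T)
    (hl : l ≤ l') : FitsHeight k c l' T := fun j hj => (h j hj).trans hl

theorem FitsHeight.binary {k : ℕ → ℕ} {c l : ℕ} {T U : BinTree} (hT : FitsHeight k c l T)
    (hU : FitsHeight k (c + T.numLeaves) l U) : FitsHeight k c (l + 1) (.binary T U) := by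
  intro j hj
  simp only [BinTree.depths, List.length_map, List.length_append] at hj
  simp only [BinTree.depths, List.getElem_map]
  rw [List.getElem_append]
  split_ifs with h
  · have := hT j h
    omega
  · have := hU (j - T.depths.length) (by omega)
    rw [← BinTree.length_depths, show c + T.depths.length + (j - T.depths.length) = c + j by omega]
      at this
    omega

/-- The first `p` entries of the arrays `aNode` and `aNodeK` hold the roots of stored trees, and
their heights. The trees have the leaves `0, …, c - 1` altogether, and the list starts with the last
tree. -/
def NodeStack (s : State) (k : ℕ → ℕ) (N : ℕ) : ℕ → ℕ → List (BinTree × ℕ) → Prop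
  | p, c, [] => p = 0 ∧ c = 0
  | p, c, e :: G => ∃ p' c', p = p' + 1 ∧ c = c' + e.1.numLeaves ∧ s.word aNodeK p' = e.2 ∧
      0 < s.word aNode p' ∧ StoresBelow s N (s.word aNode p') c' e.1 ∧ FitsHeight k c' e.2 e.1 ∧
      NodeStack s k N p' c' G

theorem NodeStack.length {s : State} {k : ℕ → ℕ} {N p c : ℕ} {G : List (BinTree × ℕ)}
    (h : NodeStack s k N p c G) : p = G.length := by
  induction G generalizing p c with
  | nil => exact h.1
  | cons e G ih =>
    obtain ⟨p', c', rfl, -, -, -, -, -, h⟩ := h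
    rw [ih h, List.length_cons]

theorem NodeStack.congr {s s' : State} {k : ℕ → ℕ} {N N' p c : ℕ} {G : List (BinTree × ℕ)}
    (h : NodeStack s k N p c G) (hN : N ≤ N')
    (hs : ∀ a ∈ [1, 2, 3], ∀ u < N, s'.word a u = s.word a u)
    (hs' : ∀ i < p, s'.word aNode i = s.word aNode i ∧ s'.word aNodeK i = s.word aNodeK i) :
    NodeStack s' k N' p c G := by
  induction G generalizing p c with
  | nil => exact h
  | cons e G ih =>
    obtain ⟨p', c', rfl, hc, hk, h0, hst, hf, h⟩ := h
    obtain ⟨e1, e2⟩ := hs' p' (Nat.lt_succ_self _)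
    exact ⟨p', c', rfl, hc, by rw [e2, hk], by rwa [e1], by rw [e1]; exact hst.congr hN hs, hf,
      ih h fun i hi => hs' i (hi.trans (Nat.lt_succ_self _))⟩

/-- The total length of the intervals of the nodes. -/
def nodeSum (G : List (BinTree × ℕ)) : ℕ := (G.map fun e => 2 ^ e.2).sum

theorem dvd_nodeSum {b : ℕ} {G : List (BinTree × ℕ)} (h : ∀ e ∈ G, b ≤ e.2) :
    2 ^ b ∣ nodeSum G := by
  apply List.dvd_sum
  simp only [List.mem_map]
  rintro x ⟨e, he, rfl⟩
  exact pow_dvd_pow 2 (h e he)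

theorem roundUp_two_pow {l m : ℕ} (h : l ≤ m) : roundUp m (2 ^ l) = 2 ^ m :=
  le_antisymm ((roundUp_le_iff (dvd_refl _)).2 (Nat.pow_le_pow_right two_pos h))
    (Nat.le_of_dvd (lt_of_lt_of_le (by positivity) (le_roundUp m (2 ^ l))) (dvd_roundUp _ _))

/-- Nodes that become adjacent siblings are combined, and the last node is moved up as long as its
height is below `vHeight`. -/
def settleProg : Program :=
  .loop (.not (.and
      (.not (.and (.wordLt 1 (wvar vNodes))
        (.not (.wordLt (.read aNodeK (wvar vNodes - 1)) (.read aNodeK (wvar vNodes - 2))))))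
      (.not (.and (.wordLt 0 (wvar vNodes))
        (.wordLt (.read aNodeK (wvar vNodes - 1)) (wvar vHeight))))))
    (.ite (.and (.wordLt 1 (wvar vNodes))
        (.not (.wordLt (.read aNodeK (wvar vNodes - 1)) (.read aNodeK (wvar vNodes - 2)))))
      (.storeWord 1 (wvar vNext) (.read aNode (wvar vNodes - 2)) ⨾
        .storeWord 2 (wvar vNext) (.read aNode (wvar vNodes - 1)) ⨾
        .storeWord aNode (wvar vNodes - 2) (wvar vNext) ⨾
        .storeWord aNodeK (wvar vNodes - 2) (.read aNodeK (wvar vNodes - 2) + 1) ⨾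
        .storeWord vNodes 0 (wvar vNodes - 1) ⨾
        .storeWord vNext 0 (wvar vNext + 1))
      (.ite (.and (.wordLt 1 (wvar vNodes))
          (.wordLt (.read aNodeK (wvar vNodes - 2)) (wvar vHeight)))
        (.storeWord aNodeK (wvar vNodes - 1) (.read aNodeK (wvar vNodes - 2)))
        (.storeWord aNodeK (wvar vNodes - 1) (wvar vHeight))))

/-- What holds while the tree is built. Every leaf takes one address, and so does every
combination. -/
structure BuildInv (k : ℕ → ℕ) (c : ℕ) (G : List (BinTree × ℕ)) (s : State) : Prop where
  nodes : NodeStack s k (s.word vNext 0) (s.word vNodes 0) c G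
  sorted : G.Pairwise (·.2 ≤ ·.2)
  tail : G.tail.Pairwise (·.2 < ·.2)
  next : s.word vNext 0 + G.length = 2 * c + 1
  pos : 0 < s.word vNext 0
  fresh : ∀ v, s.word vNext 0 ≤ v → s.word 1 v = 0 ∧ s.word 2 v = 0

/-- Combine the last two nodes. -/
theorem BuildInv.combine {k : ℕ → ℕ} {c l : ℕ} {T U : BinTree} {G : List (BinTree × ℕ)} {s : State}
    (h : BuildInv k c ((U, l) :: (T, l) :: G) s) {p x : ℕ} (hp : s.word vNodes 0 = p + 2)
    (hx : s.word vNext 0 = x) :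
    BuildInv k c ((.binary T U, l + 1) :: G)
      ((((((s.setWord 1 x (s.word aNode p)).setWord 2 x (s.word aNode (p + 1))).setWord aNode p
        x).setWord aNodeK p (l + 1)).setWord vNodes 0 (p + 1)).setWord vNext 0 (x + 1)) := by
  obtain ⟨p1, c1, hp1, hc1, hk1, h01, hst1, hf1, p2, c2, hp2, hc2, hk2, h02, hst2, hf2, hn⟩ := h.nodes
  obtain rfl : p1 = p + 1 := by omega
  obtain rfl : p2 = p := by omega
  simp only at hc1 hk1 hst1 hf1 hc2 hk2 hst2 hf2
  have hs := h.sorted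
  have ht := h.tail
  have hnext := h.next
  have hpos := h.pos
  have hfresh := h.fresh
  rw [hx] at hst1 hst2 hn hnext hpos hfresh
  simp only [List.tail_cons, List.pairwise_cons, List.length_cons] at hs ht hnext
  refine ⟨?_, ?_, ?_, ?_, ?_, ?_⟩
  · refine ⟨p2, c2, by simp, by simp [hc1, hc2, BinTree.numLeaves, Nat.add_assoc], by simp,
      by simpa using hpos, ?_, hf2.binary (hc2 ▸ hf1), ?_⟩
    · have hst1' := hst1.congr (N' := x + 1)
        (s' := (((((s.setWord 1 x (s.word aNode p2)).setWord 2 x (s.word aNode (p2 + 1))).setWord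
          aNode p2 x).setWord aNodeK p2 (l + 1)).setWord vNodes 0 (p2 + 1)).setWord vNext 0 (x + 1))
        (Nat.le_succ _) (by
          simp only [List.forall_mem_cons, List.not_mem_nil, false_imp_iff, implies_true, and_true]
          refine ⟨fun u hu => ?_, fun u hu => ?_, fun u hu => ?_⟩ <;> simp [hu.ne])
      have hst2' := hst2.congr (N' := x + 1)
        (s' := (((((s.setWord 1 x (s.word aNode p2)).setWord 2 x (s.word aNode (p2 + 1))).setWord
          aNode p2 x).setWord aNodeK p2 (l + 1)).setWord vNodes 0 (p2 + 1)).setWord vNext 0 (x + 1))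
        (Nat.le_succ _) (by
          simp only [List.forall_mem_cons, List.not_mem_nil, false_imp_iff, implies_true, and_true]
          refine ⟨fun u hu => ?_, fun u hu => ?_, fun u hu => ?_⟩ <;> simp [hu.ne])
      rw [hc2] at hst1'
      have e : ((((((s.setWord 1 x (s.word aNode p2)).setWord 2 x (s.word aNode (p2 + 1))).setWord
          aNode p2 x).setWord aNodeK p2 (l + 1)).setWord vNodes 0 (p2 + 1)).setWord vNext 0
          (x + 1)).word aNode p2 = x := by simp
      rw [e]
      refine ⟨by simp, ?_, ?_, ?_, ?_⟩
      · simpa using h02.ne'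
      · simpa using h01.ne'
      · simpa using hst2'
      · simpa using hst1'
    · refine hn.congr (by simp) ?_ ?_
      · simp only [List.forall_mem_cons, List.not_mem_nil, false_imp_iff, implies_true, and_true]
        refine ⟨fun u hu => ?_, fun u hu => ?_, fun u hu => ?_⟩ <;> simp [hu.ne]
      · intro i hi
        simp [hi.ne]
  · exact List.pairwise_cons.2 ⟨fun e he => ht.1 e he, hs.2.2⟩
  · exact ht.2
  · simp; omega
  · simp
  · intro v hv
    simp only [State.word_setWord_self, Function.update_self] at hv
    have hvx : v ≠ x := by omega
    simpa [hvx] using hfresh v (by omega)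

/-- Move the last node up. -/
theorem BuildInv.lift {k : ℕ → ℕ} {c l l' : ℕ} {T : BinTree} {G : List (BinTree × ℕ)} {s : State}
    (h : BuildInv k c ((T, l) :: G) s) {p : ℕ} (hp : s.word vNodes 0 = p + 1) (hl : l ≤ l')
    (hG : ∀ e ∈ G, l' ≤ e.2) :
    BuildInv k c ((T, l') :: G) (s.setWord aNodeK p l') := by
  obtain ⟨p1, c1, hp1, hc1, hk1, h01, hst1, hf1, hn⟩ := h.nodes
  obtain rfl : p1 = p := by omega
  refine ⟨⟨p1, c1, by simpa using hp, hc1, by simp, by simpa using h01, ?_, hf1.mono hl, ?_⟩, ?_,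
    h.tail, ?_, ?_, ?_⟩
  · simpa using hst1.congr le_rfl (s' := s.setWord aNodeK p1 l') (by simp)
  · refine hn.congr (by simp) (by simp) fun i hi => ?_
    simp [hi.ne]
  · exact List.pairwise_cons.2 ⟨hG, (List.pairwise_cons.1 h.sorted).2⟩
  · simpa using h.next
  · simpa using h.pos
  · simpa using h.fresh

theorem runs_settleProg {B R b c X : ℕ} {k : ℕ → ℕ} {G : List (BinTree × ℕ)} {s : State}
    (hR : R < B) (hc : 2 * c + 1 < B) (hb : s.word vHeight 0 = b) (hbB : b < B)
    (hI : BuildInv k c G s) (hX : roundUp b (nodeSum G) = X) (hXR : X ≤ 2 ^ R) :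
    Runs B settleProg s fun t s' => ∃ G', t + 16 * G'.length ≤ 16 * G.length + 17 ∧
      BuildInv k c G' s' ∧ nodeSum G' = X ∧ G'.Pairwise (·.2 < ·.2) ∧ ∀ e ∈ G', b ≤ e.2 := by
  classical
  let I : List (BinTree × ℕ) → State → Prop := fun g s' =>
    BuildInv k c g s' ∧ s'.word vHeight 0 = b ∧ roundUp b (nodeSum g) = X
  let φ : List (BinTree × ℕ) → ℕ := fun g => 8 * (2 * g.length +
    (if ∃ x y g', g = x :: y :: g' ∧ x.2 = y.2 then 0 else 1) +
    (if ∃ x g', g = x :: g' ∧ x.2 < b then 1 else 0))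
  refine (Runs.loop (R := I) (φ := φ) (g := G) ⟨hI, hb, hX⟩ ?_).mono ?_
  · rintro g s1 ⟨hJ, hb1, hX1⟩ hcond
    have hlen := hJ.nodes.length
    have hnext := hJ.next
    have hgB : g.length < B := by omega
    have hnB : s1.word vNext 0 + g.length < B := by omega
    refine Runs.ite (fun h => ?_) fun h => ?_
    · simp only [Cond.holds_and, Cond.holds_wordLt, Cond.holds_not, WExpr.eval_read,
        WExpr.eval_ofNat, WExpr.eval_sub, hlen] at h
      obtain ⟨⟨U, l⟩, ⟨T, l'⟩, g, rfl⟩ : ∃ x y g', g = x :: y :: g' := by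
        match g, h.1 with
        | [], h => simp at h
        | [_], h => simp at h
        | x :: y :: g', _ => exact ⟨x, y, g', rfl⟩
      simp only [List.length_cons] at hlen hgB hnext hnB h
      obtain ⟨p1, c1, hp1, hc1, hk1, h01, hst1, hf1, p2, c2, hp2, hc2, hk2, h02, hst2, hf2, hn⟩ :=
        hJ.nodes
      obtain rfl : p1 = g.length + 1 := by omega
      obtain rfl : p2 = g.length := by omega
      have e1 : g.length + 1 + 1 - 1 = g.length + 1 := by omega
      have e2 : g.length + 1 + 1 - 2 = g.length := by omega
      rw [e1, e2, hk1, hk2] at h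
      obtain rfl : l = l' := by
        have := (List.pairwise_cons.1 hJ.sorted).1 (T, l') (by simp)
        simp only at this h
        omega
      have hV : nodeSum ((.binary T U, l + 1) :: g) = nodeSum ((U, l) :: (T, l) :: g) := by
        simp only [nodeSum, List.map_cons, List.sum_cons, pow_succ]
        omega
      have hl : l + 1 ≤ R := by
        have h1 : 2 ^ (l + 1) ≤ 2 ^ R := by
          refine le_trans ?_ ((le_roundUp b _).trans (hX1.trans_le hXR))
          rw [← hV]
          simp [nodeSum]
        exact (Nat.pow_le_pow_iff_right one_lt_two).1 h1
      have ha1 := hst1.lt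
      have ha2 := hst2.lt
      simp only at hk2
      refine .seq (.storeWord ?_ ?_ (.seq (.storeWord ?_ ?_ (.seq (.storeWord ?_ ?_
        (.seq (.storeWord ?_ ?_ (.seq (.storeWord ?_ ?_ (.storeWord ?_ ?_
        ⟨(.binary T U, l + 1) :: g, ⟨?_, ?_, ?_⟩, ?_⟩))))))))))
      · simp; omega
      · simp [hlen, e2]; omega
      · simp; omega
      · simp [hlen, e1]; omega
      · simp [hlen]; omega
      · simp; omega
      · simp [hlen]; omega
      · simp [hlen, e2, hk2]; omega
      · simp; omega
      · simp [hlen]; omega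
      · simp; omega
      · simp; omega
      · have := hJ.combine (p := g.length) hlen rfl
        simpa [hlen, e1, e2, hk2] using this
      · simpa using hb1
      · rw [hV, hX1]
      · have f1 : ∃ x y g', (U, l) :: (T, l) :: g = x :: y :: g' ∧ x.2 = y.2 :=
          ⟨_, _, _, rfl, rfl⟩
        simp only [φ, if_pos f1, List.length_cons]
        have f2 : (∃ x g', ((BinTree.binary T U, l + 1) : BinTree × ℕ) :: g = x :: g' ∧ x.2 < b) →
            ∃ x g', ((U, l) : BinTree × ℕ) :: (T, l) :: g = x :: g' ∧ x.2 < b := by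
          rintro ⟨x, g', he, hx⟩
          simp only [List.cons.injEq] at he
          refine ⟨_, _, rfl, ?_⟩
          rw [← he.1] at hx
          simp only at hx ⊢
          omega
        have i1 : ∀ (P : Prop) [Decidable P], (if P then 0 else 1 : ℕ) ≤ 1 := by
          intro P _; split_ifs <;> omega
        have i2 : ∀ (P P' : Prop) [Decidable P] [Decidable P'], (P' → P) →
            (if P' then 1 else 0 : ℕ) ≤ if P then 1 else 0 := by
          intro P P' _ _ h; split_ifs <;> first | omega | exact absurd (h ‹_›) ‹_›
        have := i1 (∃ x y g', ((BinTree.binary T U, l + 1) : BinTree × ℕ) :: g = x :: y :: g' ∧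
          x.2 = y.2)
        have := i2 _ _ f2
        linarith
    · have hne : ∃ x g', g = x :: g' ∧ x.2 < b := by
        match g with
        | [] => simp [hlen] at hcond
        | x :: g' =>
          refine ⟨x, g', rfl, ?_⟩
          obtain ⟨p1, c1, hp1, hc1, hk1, h01, hst1, hf1, hn⟩ := hJ.nodes
          have h1 := (not_and_or.1 hcond).resolve_left (fun h' => h (not_not.1 h'))
          have h2 := (not_not.1 h1).2
          simp only [Cond.holds_wordLt, WExpr.eval_read, WExpr.eval_ofNat, WExpr.eval_sub, hp1,
            Nat.add_sub_cancel, hk1, hb1] at h2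
          exact h2
      obtain ⟨⟨T, l⟩, g, rfl, hlb⟩ := hne
      simp only at hlb
      simp only [List.length_cons] at hlen hgB hnext hnB
      obtain ⟨p1, c1, hp1, hc1, hk1, h01, hst1, hf1, hn⟩ := id hJ.nodes
      obtain rfl : p1 = g.length := by omega
      -- The new height is `m`.
      have fin : ∀ m, l < m → m ≤ b → (∀ e ∈ g, m ≤ e.2) →
          (m = b ∨ ∃ y g', g = y :: g' ∧ y.2 = m) → ¬ (∃ y g', g = y :: g' ∧ l = y.2) →
          ∃ g', I g' (s1.setWord aNodeK g.length m) ∧ 4 + φ g' ≤ φ ((T, l) :: g) := by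
        intro m h1 h2 h3 h4 h5
        refine ⟨(T, m) :: g, ⟨hJ.lift hlen h1.le h3, by simpa using hb1, ?_⟩, ?_⟩
        · rw [← hX1]
          simp only [nodeSum, List.map_cons, List.sum_cons]
          have hd : 2 ^ m ∣ (g.map fun e => 2 ^ e.2).sum := dvd_nodeSum h3
          rw [Nat.add_comm, Nat.add_comm (2 ^ l), ← roundUp_roundUp h2 (x := _ + 2 ^ l),
            roundUp_add hd, roundUp_two_pow h1.le]
        · have f1 : ¬ ∃ x y g', ((T, l) : BinTree × ℕ) :: g = x :: y :: g' ∧ x.2 = y.2 := by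
            rintro ⟨x, y, g', he, hx⟩
            simp only [List.cons.injEq] at he
            exact h5 ⟨y, g', he.2, by rw [← hx, ← he.1]⟩
          have f2 : ∃ x g', ((T, l) : BinTree × ℕ) :: g = x :: g' ∧ x.2 < b := ⟨_, _, rfl, hlb⟩
          simp only [φ, if_neg f1, if_pos f2, List.length_cons]
          rcases h4 with rfl | ⟨y, g', rfl, rfl⟩
          · have f3 : ¬ ∃ x g', ((T, m) : BinTree × ℕ) :: g = x :: g' ∧ x.2 < m := by
              rintro ⟨x, g', he, hx⟩
              simp only [List.cons.injEq] at he
              rw [← he.1] at hx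
              exact lt_irrefl _ hx
            rw [if_neg f3]
            split_ifs <;> omega
          · have f3 : ∃ x z g'', ((T, y.2) : BinTree × ℕ) :: y :: g' = x :: z :: g'' ∧ x.2 = z.2 :=
              ⟨_, _, _, rfl, rfl⟩
            rw [if_pos f3]
            split_ifs <;> omega
      have hnot : ¬ ∃ y g', g = y :: g' ∧ l = y.2 := by
        rintro ⟨y, g', rfl, rfl⟩
        apply h
        obtain ⟨p2, c2, hp2, hc2, hk2, h02, hst2, hf2, hn⟩ := hn
        obtain rfl : g'.length = p2 := by simpa using hp2
        simp only [List.length_cons] at hlen hk1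
        simp [hlen, hk1, hk2]
      refine Runs.ite (fun h' => ?_) fun h' => ?_
      · match g with
        | [] => simp [hlen] at h'
        | y :: g' =>
          obtain ⟨p2, c2, hp2, hc2, hk2, h02, hst2, hf2, hn⟩ := hn
          obtain rfl : g'.length = p2 := by simpa using hp2
          have e2 : (y :: g').length + 1 - 2 = g'.length := by simp
          simp only [Cond.holds_and, Cond.holds_wordLt, WExpr.eval_read, WExpr.eval_ofNat,
            WExpr.eval_sub, hlen, hb1, e2, hk2] at h'
          have hly : l ≤ y.2 := (List.pairwise_cons.1 hJ.sorted).1 y (by simp)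
          have hly' : l ≠ y.2 := fun he => hnot ⟨y, g', rfl, he⟩
          refine .storeWord ?_ ?_ ?_
          · simp [hlen]; omega
          · simp only [WExpr.eval_read, WExpr.eval_ofNat, WExpr.eval_sub, hlen, e2, hk2]; omega
          · obtain ⟨g'', hg1, hg2⟩ := fin y.2 (by omega) h'.2.le (by
              have := List.pairwise_cons.1 (List.pairwise_cons.1 hJ.sorted).2
              simp only [List.forall_mem_cons]
              exact ⟨le_rfl, this.1⟩) (.inr ⟨y, g', rfl, rfl⟩) hnot
            refine ⟨g'', ?_, by omega⟩
            simp only [WExpr.eval_read, WExpr.eval_ofNat, WExpr.eval_sub, hlen, e2, hk2]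
            exact hg1
      · refine .storeWord ?_ ?_ ?_
        · simp [hlen]; omega
        · simp [hb1]; omega
        · obtain ⟨g'', hg1, hg2⟩ := fin b hlb le_rfl (by
            match g with
            | [] => simp
            | y :: g' =>
              obtain ⟨p2, c2, hp2, hc2, hk2, h02, hst2, hf2, hn⟩ := hn
              obtain rfl : g'.length = p2 := by simpa using hp2
              have e2 : (y :: g').length + 1 - 2 = g'.length := by simp
              simp only [Cond.holds_and, Cond.holds_wordLt, WExpr.eval_read, WExpr.eval_ofNat,
                WExpr.eval_sub, hlen, hb1, e2, hk2, not_and, not_lt] at h'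
              have h1 : b ≤ y.2 := h' (by simp)
              have := List.pairwise_cons.1 (List.pairwise_cons.1 hJ.sorted).2
              simp only [List.forall_mem_cons]
              exact ⟨h1, fun e he => h1.trans (this.1 e he)⟩) (.inl rfl) hnot
          refine ⟨g'', ?_, by omega⟩
          simp only [WExpr.eval_read, WExpr.eval_ofNat, WExpr.eval_sub, hlen, hb1,
            Nat.add_sub_cancel]
          exact hg1
  · rintro t s' ⟨g, ⟨hJ, hb1, hX1⟩, hcond, ht⟩
    have hlen := hJ.nodes.length
    simp only [Cond.holds_not, Cond.holds_and, not_not] at hcond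
    have hge : ∀ e ∈ g, b ≤ e.2 := by
      match g with
      | [] => simp
      | x :: g' =>
        obtain ⟨p1, c1, hp1, hc1, hk1, h01, hst1, hf1, hn⟩ := hJ.nodes
        have h2 := hcond.2
        simp only [Cond.holds_wordLt, WExpr.eval_read, WExpr.eval_ofNat, WExpr.eval_sub, hp1,
            Nat.add_sub_cancel, hk1, hb1, not_and, not_lt] at h2
        have h3 : b ≤ x.2 := h2 (by omega)
        simp only [List.forall_mem_cons]
        exact ⟨h3, fun e he => h3.trans ((List.pairwise_cons.1 hJ.sorted).1 e he)⟩
    have hlt : g.Pairwise (·.2 < ·.2) := by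
      match g with
      | [] => simp
      | [_] => simp
      | x :: y :: g' =>
        obtain ⟨p1, c1, hp1, hc1, hk1, h01, hst1, hf1, p2, c2, hp2, hc2, hk2, h02, hst2, hf2, hn⟩ :=
          hJ.nodes
        have h2 := hcond.1
        simp only [List.length_cons] at hlen
        obtain rfl : p1 = g'.length + 1 := by omega
        obtain rfl : p2 = g'.length := by omega
        have e1 : g'.length + 1 + 1 - 1 = g'.length + 1 := by omega
        have e2 : g'.length + 1 + 1 - 2 = g'.length := by omega
        simp only [Cond.holds_wordLt, WExpr.eval_read, WExpr.eval_ofNat, WExpr.eval_sub, hlen,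
            e1, e2, hk1, hk2, not_and, not_not] at h2
        have h3 : x.2 < y.2 := h2 (by omega)
        have h4 := hJ.tail
        simp only [List.tail_cons] at h4
        refine List.pairwise_cons.2 ⟨fun e he => ?_, h4⟩
        rcases List.mem_cons.1 he with rfl | he
        · exact h3
        · exact h3.trans ((List.pairwise_cons.1 h4).1 e he)
    refine ⟨g, ?_, hJ, ?_, hlt, hge⟩
    · have h1 : φ G ≤ 16 * G.length + 16 := by
        simp only [φ]; split_ifs <;> omega
      have h2 : 16 * g.length ≤ φ g := by simp only [φ]; omega
      omega
    · rw [← hX1, roundUp_of_dvd (dvd_nodeSum hge)]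

/-- Store a new leaf, whose height is `vHeight` and whose label is `vI`. -/
def leafProg : Program :=
  .storeWord 3 (wvar vNext) (wvar vI) ⨾
  .storeWord aNode (wvar vNodes) (wvar vNext) ⨾
  .storeWord aNodeK (wvar vNodes) (wvar vHeight) ⨾
  .storeWord vNodes 0 (wvar vNodes + 1) ⨾
  .storeWord vNext 0 (wvar vNext + 1)

/-- Build a tree whose root has height `vRoot`, for the threshold `rHi`. -/
def buildProg : Program :=
  -- Address `0` is the null pointer.
  .storeWord vNext 0 1 ⨾ .storeWord vNodes 0 0 ⨾ .storeWord vI 0 0 ⨾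
  .loop (.wordLt (wvar vI) (wvar vN))
    (.ite (.realLt (rvar rHi) (.read rFrac (wvar vI)))
        (.storeWord vHeight 0 (.read aHeight (wvar vI) + 1))
        (.storeWord vHeight 0 (.read aHeight (wvar vI))) ⨾
      settleProg ⨾ leafProg ⨾ .storeWord vI 0 (wvar vI + 1)) ⨾
  .storeWord vHeight 0 (wvar vRoot) ⨾ settleProg ⨾ .storeWord 0 0 (.read aNode 0)

theorem runs_leafProg {B b c : ℕ} {k : ℕ → ℕ} {G : List (BinTree × ℕ)} {s : State}
    (hcB : 2 * c + 2 < B) (hb : s.word vHeight 0 = b) (hbB : b < B) (hi : s.word vI 0 = c)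
    (hI : BuildInv k c G s) (hG : G.Pairwise (·.2 < ·.2)) (hGb : ∀ e ∈ G, b ≤ e.2) (hk : k c = b) :
    Runs B leafProg s fun t s' => t ≤ 5 ∧ BuildInv k (c + 1) ((.leaf, b) :: G) s' := by
  have hlen := hI.nodes.length
  have hnext := hI.next
  have hpos := hI.pos
  have hfresh := hI.fresh (s.word vNext 0) le_rfl
  refine .seq (.storeWord ?_ ?_ (.seq (.storeWord ?_ ?_ (.seq (.storeWord ?_ ?_
    (.seq (.storeWord ?_ ?_ (.storeWord ?_ ?_ ⟨by omega, ?_⟩))))))))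
  · simp; omega
  · simp; omega
  · simp; omega
  · simp; omega
  · simp; omega
  · simp; omega
  · simp; omega
  · simp; omega
  · simp; omega
  · simp; omega
  · refine ⟨⟨s.word vNodes 0, c, by simp, rfl, by simp [hb], by simpa using hpos, ?_,
      fitsHeight_leaf hk.le, ?_⟩, ?_, ?_, ?_, ?_, ?_⟩
    · simp [StoresBelow, hi, hfresh]
    · refine hI.nodes.congr (by simp) ?_ ?_
      · simp only [List.forall_mem_cons, List.not_mem_nil, false_imp_iff, implies_true, and_true]
        refine ⟨fun u hu => ?_, fun u hu => ?_, fun u hu => ?_⟩ <;> simp [hu.ne]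
      · intro i hi
        simp [hi.ne]
    · exact List.pairwise_cons.2 ⟨fun e he => hGb e he, hI.sorted⟩
    · exact hG
    · simp; omega
    · simp
    · intro v hv
      simp only [WExpr.eval_read, WExpr.eval_add, WExpr.eval_ofNat, State.word_setWord_self,
        Function.update_self, ne_eq, Nat.reduceEqDiff, not_false_eq_true,
        State.word_setWord_of_ne] at hv
      simpa using hI.fresh v (by omega)

theorem runs_buildProg {B n R : ℕ} {k : ℕ → ℕ} {s : State} (hn : 0 < n) (hnB : 2 * n + 2 < B)
    (hR : R < B) (hsn : s.word vN 0 = n) (hroot : s.word vRoot 0 = R)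
    (hk : ∀ i < n, k i = s.word aHeight i + if s.real rHi 0 < s.real rFrac i then 1 else 0)
    (hfresh : ∀ v, s.word 1 v = 0 ∧ s.word 2 v = 0)
    (hkraft : kraft 0 ((List.range n).map k) ≤ 2 ^ R) :
    Runs B buildProg s fun t s' => t ≤ 42 * n + 24 ∧ ∃ T : BinTree, T.numLeaves = n ∧
      Outputs s' T ∧ ∀ j (hj : j < T.depths.length), T.depths[j] + k j ≤ R := by
  set S : ℕ → ℕ := fun i => kraft 0 ((List.range i).map k) with hS
  have hSsucc : ∀ i, S (i + 1) = roundUp (k i) (S i) + 2 ^ k i := by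
    intro i
    simp only [hS, List.range_succ, List.map_append, kraft_append, List.map_cons, List.map_nil,
      kraft_cons, kraft_nil]
  have hSle : ∀ i ≤ n, S i ≤ 2 ^ R := by
    intro i hi
    refine le_trans ?_ hkraft
    generalize n = m at hi
    induction m, hi using Nat.le_induction with
    | base => exact le_rfl
    | succ m _ ih =>
      refine ih.trans ?_
      show S m ≤ S (m + 1)
      rw [hSsucc]
      exact (le_roundUp _ _).trans (Nat.le_add_right _ _)
  have hkR : ∀ i < n, k i ≤ R := by
    intro i hi
    have := hSle (i + 1) hi
    rw [hSsucc] at this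
    exact (Nat.pow_le_pow_iff_right one_lt_two).1 (by omega : 2 ^ k i ≤ 2 ^ R)
  let I : ℕ × List (BinTree × ℕ) → State → Prop := fun g s' => g.1 ≤ n ∧ s'.word vI 0 = g.1 ∧
    BuildInv k g.1 g.2 s' ∧ nodeSum g.2 = S g.1 ∧ s'.word vN = s.word vN ∧
    s'.word vRoot = s.word vRoot ∧ s'.word aHeight = s.word aHeight ∧ s'.real rHi = s.real rHi ∧
    s'.real rFrac = s.real rFrac
  refine .seq (.storeWord ?_ ?_ (.seq (.storeWord ?_ ?_ (.seq (.storeWord ?_ ?_ (.seq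
    ((Runs.loop (R := I) (φ := fun g => 42 * (n - g.1) + 16 * g.2.length) (g := (0, [])) ?_ ?_).mono
      ?_)))))))
  any_goals simp; omega
  · refine ⟨Nat.zero_le _, by simp, ⟨by simp [NodeStack], .nil, .nil, by simp, by simp, ?_⟩,
      by simp [nodeSum, hS], by simp⟩
    simpa using fun v _ => hfresh v
  · rintro ⟨i, G⟩ s1 ⟨hin, hi, hI, hV, e1, e2, e3, e4, e5⟩ hc
    simp only at hin hi hI hV
    simp only [Cond.holds_wordLt, WExpr.eval_read, WExpr.eval_ofNat, hi, e1, hsn] at hc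
    have hki := hk i hc
    have hkRi := hkR i hc
    have hSi := hSle (i + 1) hc
    rw [hSsucc] at hSi
    have hstep : Runs B (.ite (.realLt (rvar rHi) (.read rFrac (wvar vI)))
        (.storeWord vHeight 0 (.read aHeight (wvar vI) + 1))
        (.storeWord vHeight 0 (.read aHeight (wvar vI)))) s1 fun t s' =>
        t ≤ 2 ∧ s' = s1.setWord vHeight 0 (k i) := by
      refine Runs.ite (fun h => ?_) fun h => ?_
      · simp only [Cond.holds_realLt, RExpr.eval_read, WExpr.eval_read, WExpr.eval_ofNat, hi, e4,
          e5] at h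
        rw [if_pos h] at hki
        refine .storeWord ?_ ?_ ⟨by omega, ?_⟩
        · simp; omega
        · simp [hi, e3]; omega
        · simp [hi, e3, hki]
      · simp only [Cond.holds_realLt, RExpr.eval_read, WExpr.eval_read, WExpr.eval_ofNat, hi, e4,
          e5] at h
        rw [if_neg h] at hki
        refine .storeWord ?_ ?_ ⟨by omega, ?_⟩
        · simp; omega
        · simp [hi, e3]; omega
        · simp [hi, e3, hki]
    refine .seq (hstep.mono ?_)
    rintro t1 _ ⟨ht1, rfl⟩
    refine .seq ((runs_settleProg (B := B) (R := R) (b := k i) (c := i) (k := k) (G := G)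
      (X := roundUp (k i) (S i)) hR (by omega) (by simp) (by omega) ?_ (by rw [hV])
      ((Nat.le_add_right _ _).trans hSi)).frame.mono ?_)
    · refine ⟨hI.nodes.congr (by simp) ?_ (by simp), hI.sorted, hI.tail, by simpa using hI.next,
        by simpa using hI.pos, by simpa using hI.fresh⟩
      simp
    rintro t2 s2 ⟨⟨G', ht2, hI2, hV2, hG2, hGb2⟩, hw2, hr2⟩
    simp only [settleProg, Program.wordWrites, Program.realWrites] at hw2 hr2
    refine .seq ((runs_leafProg (B := B) (b := k i) (c := i) (k := k) (G := G') (by omega) ?_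
      (by omega) ?_ hI2 hG2 hGb2 rfl).frame.mono ?_)
    · rw [hw2 vHeight (by simp)]; simp
    · rw [hw2 vI (by simp)]; simpa using hi
    rintro t3 s3 ⟨⟨ht3, hI3⟩, hw3, hr3⟩
    simp only [leafProg, Program.wordWrites, Program.realWrites] at hw3 hr3
    have hi3 : s3.word vI 0 = i := by rw [hw3 vI (by simp), hw2 vI (by simp)]; simpa using hi
    refine .storeWord ?_ ?_ ⟨(i + 1, (.leaf, k i) :: G'), ⟨hc, ?_, ?_, ?_, ?_⟩, ?_⟩
    · simp; omega
    · simp [hi3]; omega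
    · simp [hi3]
    · refine ⟨hI3.nodes.congr (by simp) ?_ (by simp), hI3.sorted, hI3.tail, by simpa using hI3.next,
        by simpa using hI3.pos, by simpa using hI3.fresh⟩
      simp
    · rw [hSsucc, ← hV2]
      simp [nodeSum, Nat.add_comm]
    · simp [hw3, hr3, hw2, hr2, e1, e2, e3, e4, e5]
    · simp only [List.length_cons]; omega
  · rintro t1 s1 ⟨⟨i, G⟩, ⟨hin, hi, hI, hV, e1, e2, e3, e4, e5⟩, hc, ht1⟩
    simp only at hin hi hI hV ht1
    simp only [Cond.holds_wordLt, WExpr.eval_read, WExpr.eval_ofNat, hi, e1, hsn, not_lt] at hc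
    obtain rfl : i = n := le_antisymm hin hc
    have hX : roundUp R (S i) ≤ 2 ^ R := (roundUp_le_iff (dvd_refl _)).2 (hSle i le_rfl)
    refine .seq (.storeWord ?_ ?_ (.seq ((runs_settleProg (B := B) (R := R) (b := R) (c := i)
      (k := k) (G := G) (X := roundUp R (S i)) hR (by omega) (by simp [e2, hroot]) hR ?_ (by rw [hV])
      hX).mono ?_)))
    · simp; omega
    · simp [e2, hroot]; omega
    · refine ⟨hI.nodes.congr (by simp) ?_ (by simp), hI.sorted, hI.tail, by simpa using hI.next,
        by simpa using hI.pos, by simpa using hI.fresh⟩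
      simp
    rintro t2 s2 ⟨G', ht2, hI2, hV2, hG2, hGb2⟩
    have hnodes := hI2.nodes
    match G' with
    | [] =>
      have := hnodes.2
      omega
    | [(T, l)] =>
      obtain ⟨p1, c1, hp1, hc1, hk1, h01, hst1, hf1, rfl, rfl⟩ := hnodes
      have hl : l ≤ R := by
        have : 2 ^ l ≤ 2 ^ R := by
          refine le_trans ?_ (hV2.trans_le hX)
          simp [nodeSum]
        exact (Nat.pow_le_pow_iff_right one_lt_two).1 this
      have hlt := hst1.lt
      have hnx := hI2.next
      refine .storeWord ?_ ?_ ⟨?_, T, ?_, ?_, ?_⟩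
      · simp; omega
      · simp; omega
      · simp only [List.length_cons, List.length_nil] at ht2 ht1
        omega
      · simpa using hc1.symm
      · refine StoresBelow.stores (N := s2.word vNext 0) ?_
        have := hst1.congr le_rfl (s' := s2.setWord 0 0 (s2.word aNode 0)) (by simp)
        simpa using this
      · intro j hj
        have := hf1 j hj
        simp only [Nat.zero_add] at this
        omega
    | x :: y :: G'' =>
      exfalso
      have h1 : 2 ^ R ≤ 2 ^ x.2 := Nat.pow_le_pow_right two_pos (hGb2 x (by simp))
      have h2 : 0 < 2 ^ y.2 := by positivity
      have h3 := hV2.trans_le hX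
      simp only [nodeSum, List.map_cons, List.sum_cons] at h3
      omega

end RealRAM

/-! ### Minimax trees and the Kraft sum -/

/-- The height of a leaf of weight `x`, if the threshold is at least its fraction. Here `c` is the
maximum of the rounded weights. Heights are truncated at `0`, since a tree with `n` leaves need not
have leaves of depth `n` or more. -/
noncomputable def baseHeight (n : ℕ) (c : ℤ) (x : ℝ) : ℕ := ((n : ℤ) - c + ⌈x⌉).toNat

/-- The fraction of a weight `x`, which lies in `(0, 1]`. -/
noncomputable def fraction (x : ℝ) : ℝ := x - ⌈x⌉ + 1

/-- The height of a leaf of weight `x` for the threshold `f`. -/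
noncomputable def leafHeight (n : ℕ) (c : ℤ) (f x : ℝ) : ℕ :=
  baseHeight n c x + if f < fraction x then 1 else 0

/-- The Kraft condition for a tree of cost at most `c + h - 1 + f`: the root has height `n + h`. The
sum is started at the length of one interval of that height, so that it can be maintained together
with a leaf on the left of the tree. -/
def Feasible (n : ℕ) (w : ℕ → ℝ) (c : ℤ) (h : ℕ) (f : ℝ) : Prop :=
  kraft (2 ^ (n + h)) ((List.range n).map fun i => leafHeight n c f (w i)) ≤ 2 * 2 ^ (n + h)

theorem fraction_pos (x : ℝ) : 0 < fraction x := by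
  have := Int.ceil_lt_add_one x
  unfold fraction
  linarith

theorem fraction_le_one (x : ℝ) : fraction x ≤ 1 := by
  have := Int.le_ceil x
  unfold fraction
  linarith

theorem add_leafHeight_le {n : ℕ} {c : ℤ} {f x : ℝ} {h l : ℕ} (hf : f ≤ 1) (hl : l < n)
    (hx : x + l ≤ c + h - 1 + f) : l + leafHeight n c f x ≤ n + h := by
  have key : (l : ℤ) + ⌈x⌉ + (if f < fraction x then 1 else 0 : ℕ) ≤ c + h := by
    split_ifs with hfx
    · unfold fraction at hfx
      have : ((l + ⌈x⌉ : ℤ) : ℝ) < ((c + h : ℤ) : ℝ) := by push_cast; linarith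
      have := Int.cast_lt.1 this
      omega
    · have h1 := Int.ceil_lt_add_one x
      have : ((l + ⌈x⌉ : ℤ) : ℝ) < ((c + h + 1 : ℤ) : ℝ) := by push_cast; linarith
      have := Int.cast_lt.1 this
      omega
  unfold leafHeight baseHeight
  split_ifs at key ⊢ <;> omega

theorem le_of_add_leafHeight_le {n : ℕ} {c : ℤ} {f x : ℝ} {h l : ℕ} (hf : 0 ≤ f)
    (hl : l + leafHeight n c f x ≤ n + h) : x + l ≤ c + h - 1 + f := by
  have key : (l : ℤ) + ⌈x⌉ + (if f < fraction x then 1 else 0 : ℕ) ≤ c + h := by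
    unfold leafHeight baseHeight at hl
    split_ifs at hl ⊢ <;> omega
  have h1 := fraction_le_one x
  have hfr : (⌈x⌉ : ℝ) = x + 1 - fraction x := by unfold fraction; ring
  have key' : (l : ℝ) + ⌈x⌉ + (if f < fraction x then 1 else 0 : ℕ) ≤ c + h := by exact_mod_cast key
  split_ifs at key' with hfx
  · push_cast at key'; linarith
  · push_cast at key'; linarith

/-- Nodes with one child can be contracted, so that all depths are below `n`, and the truncation of the
heights at `0` does no harm. -/
theorem feasible_of_tree {n : ℕ} {w : ℕ → ℝ} {c : ℤ} {h : ℕ} {f : ℝ} (hf : f ≤ 1) {T : BinTree}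
    (hT : T.numLeaves = n)
    (hcost : ∀ i < n, w i + (T.depths.getD i 0 : ℕ) ≤ c + h - 1 + f) : Feasible n w c h f := by
  have h1 := T.contract.kraft_le_of_tree (R := n + h) (x := 2 ^ (n + h))
    (ks := (List.range n).map fun i => leafHeight n c f (w i)) (dvd_refl _) (by
      rw [List.forall₂_iff_get]
      refine ⟨by simp [hT], fun i hi hi' => ?_⟩
      have hd := T.depths_contract
      rw [List.forall₂_iff_get] at hd
      have hin : i < n := by simpa [hT] using hi
      have hiT : i < T.depths.length := by simpa [hT] using hin
      have := hd.2 i hi hiT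
      have h2 := hcost i hin
      rw [List.getD_eq_getElem _ _ hiT] at h2
      simp only [List.get_eq_getElem, hT] at this
      simp only [List.get_eq_getElem, List.getElem_map, List.getElem_range]
      refine add_leafHeight_le hf this.2 (le_trans ?_ h2)
      gcongr
      exact this.1)
  unfold Feasible
  omega

theorem leafHeight_antitone {n : ℕ} {c : ℤ} {f f' x : ℝ} (h : f ≤ f') :
    leafHeight n c f' x ≤ leafHeight n c f x := by
  unfold leafHeight
  split_ifs with h1 h2
  · exact le_rfl
  · exact absurd (h.trans_lt h1) h2
  · omega
  · exact le_rfl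

theorem Feasible.mono {n : ℕ} {w : ℕ → ℝ} {c : ℤ} {h : ℕ} {f f' : ℝ} (hF : Feasible n w c h f)
    (hf : f ≤ f') : Feasible n w c h f' := by
  refine le_trans (kraft_mono le_rfl ?_) hF
  rw [List.forall₂_map_left_iff, List.forall₂_map_right_iff, List.forall₂_same]
  exact fun _ _ => leafHeight_antitone hf

/-- Threshold `0` instead of `1` adds one to the height of every leaf, and a root that is higher by one
makes up for exactly this. -/
theorem Feasible.of_succ_zero {n : ℕ} {w : ℕ → ℝ} {c : ℤ} {h : ℕ} (hF : Feasible n w c (h + 1) 0) :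
    Feasible n w c h 1 := by
  have e : ((List.range n).map fun i => leafHeight n c 0 (w i))
      = ((List.range n).map fun i => leafHeight n c 1 (w i)).map (· + 1) := by
    rw [List.map_map]
    refine List.map_congr_left fun i _ => ?_
    simp [leafHeight, fraction_pos, fraction_le_one]
  unfold Feasible at hF ⊢
  rw [e, ← Nat.add_assoc, pow_succ', kraft_two_mul] at hF
  omega

theorem not_feasible_zero_zero {n : ℕ} {w : ℕ → ℝ} {c : ℤ} (hc : ∃ i < n, ⌈w i⌉ = c) :
    ¬ Feasible n w c 0 0 := by
  intro hF
  obtain ⟨i, hi, hic⟩ := hc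
  have := four_mul_two_pow_le_kraft (R := n) (x := 2 ^ n) (ks := (List.range n).map fun i => leafHeight n c 0 (w i))
    (by positivity) ⟨leafHeight n c 0 (w i), List.mem_map.2 ⟨i, by simpa using hi, rfl⟩, by
      simp [leafHeight, fraction_pos, baseHeight, hic]⟩
  have h2 : 0 < 2 ^ n := by positivity
  unfold Feasible at hF
  rw [Nat.add_zero] at hF
  omega

theorem baseHeight_le {n : ℕ} {c : ℤ} {x : ℝ} (h : ⌈x⌉ ≤ c) : baseHeight n c x ≤ n := by
  unfold baseHeight
  omega

/-- The root need not be higher than in a complete binary tree over leaves of the maximal height. -/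
theorem feasible_one {n : ℕ} {w : ℕ → ℝ} {c : ℤ} (hc : ∀ i < n, ⌈w i⌉ ≤ c) {L : ℕ}
    (hL : n ≤ 2 ^ L) : Feasible n w c L 1 := by
  have h := kraft_le (H := n) (x := 2 ^ (n + L)) (y := 2 ^ (n + L))
    (ks := (List.range n).map fun i => leafHeight n c 1 (w i)) (by
      simp only [List.mem_map, List.mem_range]
      rintro k ⟨i, hi, rfl⟩
      simpa [leafHeight, not_lt.2 (fraction_le_one (w i))] using baseHeight_le (hc i hi))
    (pow_dvd_pow 2 (Nat.le_add_right _ _)) le_rfl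
  refine h.trans ?_
  rw [List.length_map, List.length_range, two_mul, pow_add, mul_comm n]
  gcongr

/-- A feasible tree fits below a root of the right height. -/
theorem Feasible.kraft_le {n : ℕ} {w : ℕ → ℝ} {c : ℤ} {h : ℕ} {f : ℝ} (hF : Feasible n w c h f) :
    kraft 0 ((List.range n).map fun i => leafHeight n c f (w i)) ≤ 2 ^ (n + h) := by
  unfold Feasible at hF
  have h2 : 0 < 2 ^ (n + h) := by positivity
  rw [← Nat.add_zero (2 ^ (n + h)), kraft_add] at hF
  · omega
  · intro k hk
    by_contra hc
    have := four_mul_two_pow_le_kraft (R := n + h) h2 ⟨k, hk, not_le.1 hc⟩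
    rw [Nat.add_zero] at hF
    omega

/-- The search for the least threshold is finished if no fraction lies strictly between an
infeasible and a feasible threshold. -/
theorem isAlphabeticMinimax_of {n : ℕ} (hn : 0 < n) {w : ℕ → ℝ} {c : ℤ} {h : ℕ} {lo hi : ℝ}
    (hhi0 : 0 ≤ hi) (hhi : hi ≤ 1) (hFlo : ¬ Feasible n w c h lo) (hFhi : Feasible n w c h hi)
    (hgap : ∀ i < n, ¬ (lo < fraction (w i) ∧ fraction (w i) < hi)) {T : BinTree}
    (hT : T.numLeaves = n)
    (hd : ∀ j (hj : j < T.depths.length), T.depths[j] + leafHeight n c hi (w j) ≤ n + h) :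
    T.IsAlphabeticMinimax fun i : Fin n => w i := by
  have : Nonempty (Fin n) := ⟨⟨0, hn⟩⟩
  have hlohi : lo < hi := by
    by_contra hle
    exact hFlo (hFhi.mono (not_lt.1 hle))
  refine ⟨hT, fun T' hT' => ?_⟩
  have h1 : T.cost (fun i : Fin n => w i) ≤ c + h - 1 + hi := by
    refine ciSup_le fun i => ?_
    have hi' : (i : ℕ) < T.depths.length := by simp [hT]
    rw [List.getD_eq_getElem _ _ hi']
    exact le_of_add_leafHeight_le hhi0 (hd i hi')
  refine h1.trans ?_
  by_contra hlt
  rw [not_le] at hlt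
  set f := max lo (T'.cost (fun i : Fin n => w i) - (c + h - 1)) with hf
  have hflo : lo ≤ f := le_max_left _ _
  have hfhi : f < hi := max_lt hlohi (by linarith)
  have hF : Feasible n w c h f := by
    refine feasible_of_tree (hfhi.le.trans hhi) hT' fun i hi => ?_
    have h2 : w i + (T'.depths.getD i 0 : ℕ) ≤ T'.cost fun i : Fin n => w i :=
      le_ciSup (f := fun i : Fin n => w i + ((T'.depths.getD i 0 : ℕ) : ℝ))
        (Set.finite_range _).bddAbove ⟨i, hi⟩
    have h3 := le_max_right lo (T'.cost (fun i : Fin n => w i) - (c + h - 1))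
    linarith
  apply hFlo
  have e : ((List.range n).map fun i => leafHeight n c lo (w i))
      = (List.range n).map fun i => leafHeight n c f (w i) := by
    refine List.map_congr_left fun i hmem => ?_
    have hi' : i < n := by simpa using hmem
    unfold leafHeight
    congr 1
    by_cases h4 : lo < fraction (w i)
    · have h5 : hi ≤ fraction (w i) := not_lt.1 fun h5 => hgap i hi' ⟨h4, h5⟩
      simp [h4, hfhi.trans_le h5]
    · simp [h4, not_lt.2 ((not_lt.1 h4).trans hflo)]
  unfold Feasible
  rw [e]
  exact hF

namespace RealRAM

theorem itemSum_itemList (f : ℝ) (K : ℕ → ℕ) (F : ℕ → ℝ) (p : ℕ) :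
    itemSum f (itemList K (fun _ => 1) F p)
      = kraft 0 ((List.range p).map fun i => K i + if f < F i then 1 else 0) := by
  induction p with
  | zero => rfl
  | succ p ih =>
    rw [itemList, itemSum, ih, List.range_succ, List.map_append, kraft_append]
    simp [Item.height]

/-- The condition that is tested by compressing the items. -/
theorem itemSum_wallItems_le_iff {n : ℕ} {w : ℕ → ℝ} {c : ℤ} {h : ℕ} {f : ℝ} (hf : 0 ≤ f) :
    itemSum f (wallItems n (n + h) (fun i => baseHeight n c (w i)) fun i => fraction (w i))
      ≤ 3 * 2 ^ (n + h) ↔ Feasible n w c h f := by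
  rw [wallItems, itemSum_itemList, List.range_succ, List.map_append, kraft_append,
    List.range_succ_eq_map, List.map_cons, List.map_map]
  have e : ((List.range n).map ((fun i => (if i = 0 ∨ i = n + 1 then n + h else
      baseHeight n c (w (i - 1))) + if f < if i = 0 ∨ i = n + 1 then 0 else fraction (w (i - 1))
      then 1 else 0) ∘ Nat.succ)) = (List.range n).map fun i => leafHeight n c f (w i) := by
    refine List.map_congr_left fun i hi => ?_
    have hi' : i < n := by simpa using hi
    simp [hi'.ne, leafHeight]
  rw [e]
  have h0 : roundUp (n + h) 0 = 0 := roundUp_of_dvd (dvd_zero _)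
  simp only [true_or, or_true, if_true, not_lt.2 hf, if_false, Nat.add_zero, kraft_cons, kraft_nil,
    h0, Nat.zero_add, List.map_cons, List.map_nil]
  rw [Feasible, ← roundUp_le_iff (Dvd.intro_left 2 rfl)]
  omega

/-! ### Reading the input -/

/-- Compute the maximum of the rounded weights. -/
def ceilProg : Program :=
  .storeReal rCeil 0 (.ceil (rvar rW)) ⨾ .storeWord vI 0 0 ⨾
  .loop (.wordLt (wvar vI) (wvar vN))
    (.ite (.realLt (rvar rCeil) (.ceil (.read rW (wvar vI))))
        (.storeReal rCeil 0 (.ceil (.read rW (wvar vI))))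
        (.storeReal rCeil 0 (rvar rCeil)) ⨾
      .storeWord vI 0 (wvar vI + 1))

theorem runs_ceilProg {B n : ℕ} {s : State} (hn : 0 < n) (hnB : n < B) (hN : s.word vN 0 = n) :
    Runs B ceilProg s fun t s' => t ≤ 4 * n + 3 ∧ ∃ c : ℤ, s'.real rCeil 0 = c ∧
      (∀ i < n, ⌈s.real rW i⌉ ≤ c) ∧ ∃ i < n, ⌈s.real rW i⌉ = c := by
  let R : ℕ → State → Prop := fun i s' => i ≤ n ∧ s'.word vI 0 = i ∧ s'.word vN 0 = n ∧
    s'.real rW = s.real rW ∧ ∃ c : ℤ, s'.real rCeil 0 = c ∧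
      (∀ j < i, ⌈s.real rW j⌉ ≤ c) ∧ ∃ j < n, ⌈s.real rW j⌉ = c
  refine .seq (.storeReal ?_ (.seq (.storeWord ?_ ?_ ((Runs.loop (R := R)
    (φ := fun i => 4 * (n - i)) (g := 0) ?_ ?_).mono ?_))))
  · simp; omega
  · simp; omega
  · simp; omega
  · exact ⟨Nat.zero_le _, by simp, by simpa using hN, by simp, ⌈s.real rW 0⌉, by simp,
      by simp, 0, hn, rfl⟩
  · rintro i s1 ⟨hin, hi, hN1, hW, c, hc, hle, hex⟩ hlt
    simp only [Cond.holds_wordLt, WExpr.eval_read, WExpr.eval_ofNat, hi, hN1] at hlt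
    refine .seq (.ite (fun h => ?_) fun h => ?_)
    · simp only [Cond.holds_realLt, RExpr.eval_read, RExpr.eval_ceil, WExpr.eval_read,
        WExpr.eval_ofNat, hi, hc, hW, Int.cast_lt] at h
      refine .storeReal ?_ (.storeWord ?_ ?_ ⟨i + 1, ⟨hlt, ?_, ?_, ?_, ⌈s.real rW i⌉, ?_, ?_, ?_⟩, ?_⟩)
      · simp; omega
      · simp; omega
      · simp [hi]; omega
      · simp [hi]
      · simpa using hN1
      · simpa using hW
      · simp [hi, hW]
      · intro j hj
        rcases Nat.lt_succ_iff_lt_or_eq.1 hj with h1 | rfl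
        · exact (hle j h1).trans h.le
        · exact le_rfl
      · exact ⟨i, hlt, rfl⟩
      · omega
    · simp only [Cond.holds_realLt, RExpr.eval_read, RExpr.eval_ceil, WExpr.eval_read,
        WExpr.eval_ofNat, hi, hc, hW, Int.cast_lt, not_lt] at h
      refine .storeReal ?_ (.storeWord ?_ ?_ ⟨i + 1, ⟨hlt, ?_, ?_, ?_, c, ?_, ?_, hex⟩, ?_⟩)
      · simp; omega
      · simp; omega
      · simp [hi]; omega
      · simp [hi]
      · simpa using hN1
      · simpa using hW
      · simpa using hc
      · intro j hj
        rcases Nat.lt_succ_iff_lt_or_eq.1 hj with h1 | rfl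
        · exact hle j h1
        · exact h
      · omega
  · rintro t s' ⟨i, ⟨hin, hi, hN1, hW, c, hc, hle, hex⟩, hlt, ht⟩
    simp only [Cond.holds_wordLt, WExpr.eval_read, WExpr.eval_ofNat, hi, hN1, not_lt] at hlt
    obtain rfl : i = n := le_antisymm hin hlt
    exact ⟨by simp at ht; omega, c, hc, hle, hex⟩

/-- Tabulate the powers of two, truncated at `n + 2`. -/
def powProg : Program :=
  .storeWord aPow 0 1 ⨾ .storeWord vI 0 0 ⨾
  .loop (.wordLt (wvar vI) (wvar vN + wvar vN + 1))
    (.ite (.wordLt (.read aPow (wvar vI) + .read aPow (wvar vI)) (wvar vN + 2))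
        (.storeWord aPow (wvar vI + 1) (.read aPow (wvar vI) + .read aPow (wvar vI)))
        (.storeWord aPow (wvar vI + 1) (wvar vN + 2)) ⨾
      .storeWord vI 0 (wvar vI + 1))

theorem runs_powProg {B n : ℕ} {s : State} (hnB : 2 * n + 2 < B) (hN : s.word vN 0 = n) :
    Runs B powProg s fun t s' => t ≤ 8 * n + 7 ∧ PowTable (2 * n + 1) (n + 2) s' := by
  let R : ℕ → State → Prop := fun i s' => i ≤ 2 * n + 1 ∧ s'.word vI 0 = i ∧ s'.word vN 0 = n ∧
    PowTable i (n + 2) s'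
  refine .seq (.storeWord ?_ ?_ (.seq (.storeWord ?_ ?_ ((Runs.loop (R := R)
    (φ := fun i => 4 * (2 * n + 1 - i)) (g := 0) ?_ ?_).mono ?_))))
  any_goals simp; omega
  · refine ⟨Nat.zero_le _, by simp, by simpa using hN, fun j hj => ?_⟩
    obtain rfl : j = 0 := by omega
    simp
  · rintro i s1 ⟨hin, hi, hN1, hpow⟩ hlt
    simp only [Cond.holds_wordLt, WExpr.eval_read, WExpr.eval_ofNat, WExpr.eval_add, hi, hN1] at hlt
    have hp := hpow i le_rfl
    have hstep : ∀ v, v = min (2 ^ (i + 1)) (n + 2) →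
        PowTable (i + 1) (n + 2) ((s1.setWord aPow (i + 1) v).setWord vI 0 (i + 1)) := by
      rintro v rfl j hj
      rcases Nat.lt_succ_iff_lt_or_eq.1 (Nat.lt_succ_of_le hj) with h1 | rfl
      · have := hpow j (by omega)
        simp [h1.ne, this]
      · simp
    refine .seq (.ite (fun h => ?_) fun h => ?_)
    · simp only [Cond.holds_wordLt, WExpr.eval_read, WExpr.eval_ofNat, WExpr.eval_add, hi, hN1] at h
      refine .storeWord ?_ ?_ (.storeWord ?_ ?_ ⟨i + 1, ⟨by omega, ?_, ?_, ?_⟩, ?_⟩)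
      · simp [hi]; omega
      · simp [hi]; omega
      · simp; omega
      · simp [hi]; omega
      · simp [hi]
      · simpa using hN1
      · simpa [hi] using hstep _ (by rw [pow_succ]; omega)
      · omega
    · simp only [Cond.holds_wordLt, WExpr.eval_read, WExpr.eval_ofNat, WExpr.eval_add, hi, hN1,
        not_lt] at h
      refine .storeWord ?_ ?_ (.storeWord ?_ ?_ ⟨i + 1, ⟨by omega, ?_, ?_, ?_⟩, ?_⟩)
      · simp [hi]; omega
      · simp [hN1]; omega
      · simp; omega
      · simp [hi]; omega
      · simp [hi]
      · simpa using hN1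
      · simpa [hi, hN1] using hstep (n + 2) (by rw [pow_succ]; omega)
      · omega
  · rintro t s' ⟨i, ⟨hin, hi, hN1, hpow⟩, hlt, ht⟩
    simp only [Cond.holds_wordLt, WExpr.eval_read, WExpr.eval_ofNat, WExpr.eval_add, hi, hN1,
      not_lt] at hlt
    obtain rfl : i = 2 * n + 1 := by omega
    exact ⟨by simp at ht; omega, hpow⟩

/-- Compute the binary logarithm of `n`, and the least power of two that is at least as large. -/
def logProg : Program :=
  .storeWord vL 0 0 ⨾
  .loop (.wordLt (.read aPow (wvar vL)) (wvar vN)) (.storeWord vL 0 (wvar vL + 1)) ⨾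
  .storeWord vStride 0 1 ⨾
  .loop (.wordLt (wvar vStride) (wvar vL)) (.storeWord vStride 0 (wvar vStride + wvar vStride))

theorem clog_two_le (n : ℕ) : Nat.clog 2 n ≤ n :=
  (Nat.clog_le_iff_le_pow one_lt_two).2 Nat.lt_two_pow_self.le

theorem runs_logProg {B n : ℕ} {s : State} (hnB : 2 * n + 2 < B) (hN : s.word vN 0 = n)
    (hpow : PowTable (2 * n + 1) (n + 2) s) :
    Runs B logProg s fun t s' => t ≤ 4 * n + 4 ∧ s'.word vL 0 = Nat.clog 2 n ∧
      s'.word vStride 0 = 2 ^ Nat.clog 2 (Nat.clog 2 n) := by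
  have hL := clog_two_le n
  have hLL := clog_two_le (Nat.clog 2 n)
  let R : ℕ → State → Prop := fun i s' => i ≤ Nat.clog 2 n ∧ s'.word vL 0 = i ∧
    s'.word vN 0 = n ∧ s'.word aPow = s.word aPow
  let R' : ℕ → State → Prop := fun i s' => i ≤ Nat.clog 2 (Nat.clog 2 n) ∧
    s'.word vL 0 = Nat.clog 2 n ∧ s'.word vStride 0 = 2 ^ i
  refine .seq (.storeWord ?_ ?_ (.seq ((Runs.loop (R := R)
    (φ := fun i => 2 * (Nat.clog 2 n - i)) (g := 0) ?_ ?_).mono ?_)))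
  any_goals simp; omega
  · exact ⟨Nat.zero_le _, by simp, by simpa using hN, by simp⟩
  · rintro i s1 ⟨hin, hi, hN1, hp⟩ hlt
    simp only [Cond.holds_wordLt, WExpr.eval_read, WExpr.eval_ofNat, hi, hN1, hp,
      hpow i (by omega)] at hlt
    have h1 : i < Nat.clog 2 n := (Nat.lt_clog_iff_pow_lt one_lt_two).2 (by omega)
    refine .storeWord ?_ ?_ ⟨i + 1, ⟨h1, ?_, ?_, ?_⟩, ?_⟩
    · simp; omega
    · simp [hi]; omega
    · simp [hi]
    · simpa using hN1
    · simpa using hp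
    · omega
  · rintro t1 s1 ⟨i, ⟨hin, hi, hN1, hp⟩, hlt, ht⟩
    simp only [Cond.holds_wordLt, WExpr.eval_read, WExpr.eval_ofNat, hi, hN1, hp,
      hpow i (by omega)] at hlt
    obtain rfl : i = Nat.clog 2 n :=
      le_antisymm hin ((Nat.clog_le_iff_le_pow one_lt_two).2 (by omega))
    refine .seq (.storeWord ?_ ?_ ((Runs.loop (R := R')
      (φ := fun i => 2 * (Nat.clog 2 (Nat.clog 2 n) - i)) (g := 0) ?_ ?_).mono ?_))
    any_goals simp; omega
    · exact ⟨Nat.zero_le _, by simpa using hi, by simp⟩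
    · rintro j s2 ⟨hj, hl, hs⟩ hlt
      simp only [Cond.holds_wordLt, WExpr.eval_read, WExpr.eval_ofNat, hl, hs] at hlt
      have h1 := (Nat.lt_clog_iff_pow_lt one_lt_two).2 hlt
      refine .storeWord ?_ ?_ ⟨j + 1, ⟨h1, ?_, ?_⟩, ?_⟩
      · simp; omega
      · simp [hs]; omega
      · simpa using hl
      · simp [hs]; ring
      · omega
    · rintro t2 s2 ⟨j, ⟨hj, hl, hs⟩, hlt, ht'⟩
      simp only [Cond.holds_wordLt, WExpr.eval_read, WExpr.eval_ofNat, hl, hs, not_lt] at hlt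
      obtain rfl := le_antisymm hj ((Nat.clog_le_iff_le_pow one_lt_two).2 hlt)
      exact ⟨by omega, hl, hs⟩

/-- Compute the heights and the fractions of the leaves, and the items. -/
def itemsProg : Program :=
  .storeWord vI 0 0 ⨾
  .loop (.wordLt (wvar vI) (wvar vN))
    (.storeFloor aHeight (wvar vI)
        (.ofWord (wvar vN) - rvar rCeil + .ceil (.read rW (wvar vI))) ⨾
      .storeReal rFrac (wvar vI)
        (.read rW (wvar vI) - .ceil (.read rW (wvar vI)) + .ofWord 1) ⨾
      .storeWord aItemK (wvar vI + 1) (.read aHeight (wvar vI)) ⨾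
      .storeWord aItemM (wvar vI) 1 ⨾
      .storeReal rItem (wvar vI + 1) (.read rFrac (wvar vI)) ⨾
      .storeReal rSort (wvar vI) (.read rFrac (wvar vI)) ⨾
      .storeWord vI 0 (wvar vI + 1)) ⨾
  .storeWord aItemM (wvar vN) 1 ⨾ .storeWord aItemM (wvar vN + 1) 1 ⨾
  .storeWord vItems 0 (wvar vN + 2)

theorem runs_itemsProg {B n : ℕ} {w : ℕ → ℝ} {c : ℤ} {s : State} (hnB : n + 2 < B)
    (hN : s.word vN 0 = n) (hpow : PowTable (2 * n + 1) (n + 2) s)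
    (hw : ∀ i < n, s.real rW i = w i) (hrc : s.real rCeil 0 = c) (hc : ∀ i < n, ⌈w i⌉ ≤ c)
    (hI : s.real rItem = fun _ => 0) :
    Runs B itemsProg s fun t s' => t ≤ 8 * n + 5 ∧
      LeavesReady n (2 * n + 1) (fun i => baseHeight n c (w i)) (fun i => fraction (w i)) s' ∧
      (∀ i < n, s'.word aHeight i = baseHeight n c (w i)) ∧
      (∀ i < n, s'.real rFrac i = fraction (w i)) ∧ ∀ i < n, s'.real rSort i = fraction (w i) := by
  let R : ℕ → State → Prop := fun p s' => p ≤ n ∧ s'.word vI 0 = p ∧ s'.word vN 0 = n ∧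
    s'.word aPow = s.word aPow ∧ s'.real rW = s.real rW ∧ s'.real rCeil = s.real rCeil ∧
    (∀ i < p, s'.word aItemK (i + 1) = baseHeight n c (w i)) ∧
    (∀ i < p, s'.word aItemM i = 1) ∧ (∀ i < p, s'.real rItem (i + 1) = fraction (w i)) ∧
    s'.real rItem 0 = 0 ∧ s'.real rItem (n + 1) = 0 ∧
    (∀ i < p, s'.word aHeight i = baseHeight n c (w i)) ∧
    (∀ i < p, s'.real rFrac i = fraction (w i)) ∧ ∀ i < p, s'.real rSort i = fraction (w i)
  refine .seq (.storeWord ?_ ?_ (.seq ((Runs.loop (R := R)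
    (φ := fun i => 8 * (n - i)) (g := 0) ?_ ?_).mono ?_)))
  any_goals simp; omega
  · refine ⟨Nat.zero_le _, by simp, by simpa using hN, ?_⟩
    simp [hI]
  · rintro p s1 ⟨hpn, hp, hN1, e1, e2, e3, h1, h2, h3, h4, h5, h6, h7, h8⟩ hlt
    simp only [Cond.holds_wordLt, WExpr.eval_read, WExpr.eval_ofNat, hp, hN1] at hlt
    have hfl : ⌊(n : ℝ) - c + ⌈w p⌉⌋₊ = baseHeight n c (w p) := by
      rw [baseHeight, ← Int.floor_toNat]
      congr 1
      rw [Int.floor_eq_iff]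
      push_cast
      constructor <;> linarith
    have hfr : w p - ⌈w p⌉ + 1 = fraction (w p) := rfl
    have hle := baseHeight_le (n := n) (hc p hlt)
    have hwp := hw p hlt
    have hpn2 : p ≠ n := by omega
    refine .seq (.storeFloor ?_ ?_ (.seq (.storeReal ?_ (.seq (.storeWord ?_ ?_
      (.seq (.storeWord ?_ ?_ (.seq (.storeReal ?_ (.seq (.storeReal ?_ (.storeWord ?_ ?_
      ⟨p + 1, ⟨hlt, ?_, ?_, ?_, ?_, ?_, ?_, ?_, ?_, ?_, ?_, ?_, ?_, ?_⟩, ?_⟩))))))))))))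
    · simp [hp]; omega
    · simp [hp, hN1, e2, e3, hrc, hwp, hfl]; omega
    · simp [hp]; omega
    · simp [hp]; omega
    · simp [hp, hN1, e2, e3, hrc, hwp, hfl]; omega
    · simp [hp]; omega
    · simp; omega
    · simp [hp]; omega
    · simp [hp]; omega
    · simp; omega
    · simp [hp]; omega
    · simp [hp]
    · simpa using hN1
    · simpa using e1
    · simpa using e2
    · simpa using e3
    · intro i hi
      rcases Nat.lt_succ_iff_lt_or_eq.1 hi with h | rfl
      · simp [hp, h.ne, h1 i h]
      · simp [hp, hN1, e2, e3, hrc, hwp, hfl]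
    · intro i hi
      rcases Nat.lt_succ_iff_lt_or_eq.1 hi with h | rfl
      · simp [hp, h.ne, h2 i h]
      · simp [hp]
    · intro i hi
      rcases Nat.lt_succ_iff_lt_or_eq.1 hi with h | rfl
      · simp [hp, h.ne, h3 i h]
      · simp [hp, e2, hwp, hfr]
    · simp [hp, h4]
    · simp [hp, hpn2.symm, h5]
    · intro i hi
      rcases Nat.lt_succ_iff_lt_or_eq.1 hi with h | rfl
      · simp [hp, h.ne, h6 i h]
      · simp [hp, hN1, e2, e3, hrc, hwp, hfl]
    · intro i hi
      rcases Nat.lt_succ_iff_lt_or_eq.1 hi with h | rfl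
      · simp [hp, h.ne, h7 i h]
      · simp [hp, e2, hwp, hfr]
    · intro i hi
      rcases Nat.lt_succ_iff_lt_or_eq.1 hi with h | rfl
      · simp [hp, h.ne, h8 i h]
      · simp [hp, e2, hwp, hfr]
    · omega
  · rintro t s1 ⟨p, ⟨hpn, hp, hN1, e1, e2, e3, h1, h2, h3, h4, h5, h6, h7, h8⟩, hlt, ht⟩
    simp only [Cond.holds_wordLt, WExpr.eval_read, WExpr.eval_ofNat, hp, hN1, not_lt] at hlt
    obtain rfl : p = n := le_antisymm hpn hlt
    refine .seq (.storeWord ?_ ?_ (.seq (.storeWord ?_ ?_ (.storeWord ?_ ?_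
      ⟨?_, ⟨?_, ?_, ?_, ?_, ?_, ?_, ?_, ?_⟩, ?_, ?_, ?_⟩))))
    · simp [hN1]; omega
    · simp; omega
    · simp [hN1]; omega
    · simp; omega
    · simp; omega
    · simp [hN1]; omega
    · simp at ht; omega
    · intro j hj
      simpa [e1] using hpow j hj
    · simpa using hN1
    · simpa using hN1
    · simpa using h1
    · intro i hi
      by_cases hi1 : i = p + 1
      · simp [hi1, hN1]
      · by_cases hi2 : i = p
        · simp [hi2, hN1]
        · simp [hi1, hi2, hN1, h2 i (by omega)]
    · simpa using h3
    · simpa using h4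
    · simpa using h5
    · simpa using h6
    · simpa using h7
    · simpa using h8

/-- The memory holds the data of the leaves which all phases of the search use: their heights `a i`,
their fractions `F i`, the table of powers, `⌈log₂ n⌉`, and the least power of two that is not
smaller than that. The arrays of the tree are empty. -/
structure Leaves (n : ℕ) (a : ℕ → ℕ) (F : ℕ → ℝ) (s : State) : Prop where
  num : s.word vN 0 = n
  pow : PowTable (2 * n + 1) (n + 2) s
  log : s.word vL 0 = Nat.clog 2 n
  stride : s.word vStride 0 = 2 ^ Nat.clog 2 (Nat.clog 2 n)
  height : ∀ i < n, s.word aHeight i = a i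
  frac : ∀ i < n, s.real rFrac i = F i
  fresh : ∀ v, s.word 1 v = 0 ∧ s.word 2 v = 0

theorem Leaves.of_eq {n : ℕ} {a : ℕ → ℕ} {F : ℕ → ℝ} {s s' : State} (h : Leaves n a F s)
    (hw : ∀ b ∈ [1, 2, vN, vL, vStride, aPow, aHeight], s'.word b = s.word b)
    (hr : s'.real rFrac = s.real rFrac) : Leaves n a F s' := by
  simp only [List.forall_mem_cons, List.not_mem_nil, false_imp_iff, implies_true, and_true] at hw
  obtain ⟨h1, h2, h3, h4, h5, h6, h7⟩ := hw
  exact ⟨by rw [h3, h.num], fun j hj => by rw [h6, h.pow j hj], by rw [h4, h.log],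
    by rw [h5, h.stride], fun i hi => by rw [h7, h.height i hi], fun i hi => by rw [hr, h.frac i hi],
    fun v => by rw [h1, h2]; exact h.fresh v⟩

/-- Read the input. -/
def initProg : Program :=
  .storeWord vN 0 (wvar 0) ⨾ ceilProg ⨾ powProg ⨾ logProg ⨾ itemsProg

theorem runs_initProg {B n : ℕ} {w : ℕ → ℝ} {s : State} (hn : 0 < n) (hnB : 2 * n + 2 < B)
    (hN : s.word 0 0 = n) (hw : ∀ i < n, s.real rW i = w i) (hI : s.real rItem = fun _ => 0)
    (hfresh : ∀ v, s.word 1 v = 0 ∧ s.word 2 v = 0) :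
    Runs B initProg s fun t s' => t ≤ 24 * n + 20 ∧ ∃ c : ℤ, (∀ i < n, ⌈w i⌉ ≤ c) ∧
      (∃ i < n, ⌈w i⌉ = c) ∧
      LeavesReady n (2 * n + 1) (fun i => baseHeight n c (w i)) (fun i => fraction (w i)) s' ∧
      Leaves n (fun i => baseHeight n c (w i)) (fun i => fraction (w i)) s' ∧
      ∀ i < n, s'.real rSort i = fraction (w i) := by
  refine .seq (.storeWord ?_ ?_ (.seq ((runs_ceilProg hn (by omega) ?_).frame.mono ?_)))
  · simp; omega
  · simp [hN]; omega
  · simpa using hN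
  rintro t1 s1 ⟨⟨ht1, c, hc, hle, hex⟩, hw1, hr1⟩
  simp only [ceilProg, Program.wordWrites, Program.realWrites] at hw1 hr1
  have hN1 : s1.word vN 0 = n := by rw [hw1 vN (by simp)]; simp [hN]
  refine .seq ((runs_powProg hnB hN1).frame.mono ?_)
  rintro t2 s2 ⟨⟨ht2, hpow⟩, hw2, hr2⟩
  simp only [powProg, Program.wordWrites, Program.realWrites] at hw2 hr2
  have hN2 : s2.word vN 0 = n := by rw [hw2 vN (by simp), hN1]
  refine .seq ((runs_logProg hnB hN2 hpow).frame.mono ?_)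
  rintro t3 s3 ⟨⟨ht3, hL, hS⟩, hw3, hr3⟩
  simp only [logProg, Program.wordWrites, Program.realWrites] at hw3 hr3
  have hW : ∀ i < n, s1.real rW i = w i := by
    intro i hi
    rw [hr1 rW (by simp)]
    simpa using hw i hi
  have hW0 : ∀ i < n, ⌈((s.setWord vN (WExpr.eval s 0) (WExpr.eval s (wvar 0))).real rW i)⌉
      = ⌈w i⌉ := by
    intro i hi
    simp [hw i hi]
  refine (runs_itemsProg (B := B) (n := n) (w := w) (c := c) (by omega) ?_ ?_ ?_ ?_ ?_ ?_).frame.mono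
    ?_
  · rw [hw3 vN (by simp), hN2]
  · intro j hj; rw [hw3 aPow (by simp), hpow j hj]
  · intro i hi; rw [hr3 rW (by simp), hr2 rW (by simp), hW i hi]
  · rw [hr3 rCeil (by simp), hr2 rCeil (by simp), hc]
  · intro i hi; rw [← hW0 i hi]; exact hle i hi
  · rw [hr3 rItem (by simp), hr2 rItem (by simp), hr1 rItem (by simp)]; simpa using hI
  rintro t4 s4 ⟨⟨ht4, h1, h2, h3, h4⟩, hw4, hr4⟩
  simp only [itemsProg, Program.wordWrites, Program.realWrites] at hw4 hr4
  refine ⟨by omega, c, fun i hi => ?_, ?_, h1, ⟨h1.num, h1.pow, ?_, ?_, h2, h3, ?_⟩, h4⟩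
  · rw [← hW0 i hi]; exact hle i hi
  · obtain ⟨i, hi, h⟩ := hex
    exact ⟨i, hi, by rw [← hW0 i hi]; exact h⟩
  · rw [hw4 vL (by simp), hL]
  · rw [hw4 vStride (by simp), hS]
  · intro v
    rw [hw4 1 (by simp), hw4 2 (by simp), hw3 1 (by simp), hw3 2 (by simp), hw2 1 (by simp),
      hw2 2 (by simp), hw1 1 (by simp), hw1 2 (by simp)]
    simpa using hfresh v

/-! ### The height of the root -/

/-- Search for the height of the root, and prepare the search for the threshold. -/
def rootProg : Program :=
  .storeWord vLo 0 0 ⨾ .storeWord vHi 0 (wvar vL) ⨾ .storeWord vGap 0 0 ⨾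
  searchProg setupRootProg ⨾ .storeWord vMid 0 (wvar vLo) ⨾ setupRootProg ⨾
  .storeWord vRoot 0 (wvar vN + wvar vLo) ⨾ .storeReal rLo 0 (.ofWord 0) ⨾
  .storeReal rHi 0 (.ofWord 1)

theorem LeavesReady.of_eq {n H : ℕ} {a : ℕ → ℕ} {F : ℕ → ℝ} {s s' : State}
    (h : LeavesReady n H a F s)
    (hw : ∀ b ∈ [vN, aPow, aItemK, aItemM, vItems], s'.word b = s.word b)
    (hr : s'.real rItem = s.real rItem) : LeavesReady n H a F s' := by
  simp only [List.forall_mem_cons, List.not_mem_nil, false_imp_iff, implies_true, and_true] at hw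
  obtain ⟨h1, h2, h3, h4, h5⟩ := hw
  exact ⟨fun j hj => by rw [h2, h.pow j hj], by rw [h1, h.num], by rw [h5, h.items],
    fun i hi => by rw [h3, h.height i hi], fun i hi => by rw [h4, h.count i hi],
    fun i hi => by rw [hr, h.frac i hi], by rw [hr, h.frac_zero], by rw [hr, h.frac_last]⟩

theorem runs_rootProg {B n : ℕ} {w : ℕ → ℝ} {c : ℤ} {s : State} (hnB : 2 * n + 2 < B)
    (hn : 0 < n) (hle : ∀ i < n, ⌈w i⌉ ≤ c) (hex : ∃ i < n, ⌈w i⌉ = c)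
    (hl : LeavesReady n (2 * n + 1) (fun i => baseHeight n c (w i)) (fun i => fraction (w i)) s)
    (hL : s.word vL 0 = Nat.clog 2 n) :
    Runs B rootProg s fun t s' =>
      t ≤ (20 * n + 54) * (Nat.clog 2 (Nat.clog 2 n) + 1) + 11 ∧
      ∃ h ≤ Nat.clog 2 n, s'.word vRoot 0 = n + h ∧ s'.real rLo 0 = 0 ∧ s'.real rHi 0 = 1 ∧
        ¬ Feasible n w c h 0 ∧ Feasible n w c h 1 ∧
        ItemsReady (2 * n + 1) (n + 2) s' ∧
        inputItems s' = wallItems n (n + h) (fun i => baseHeight n c (w i))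
          (fun i => fraction (w i)) := by
  set L := Nat.clog 2 n with hLdef
  have hLn : L ≤ n := clog_two_le n
  have hLlt : L < n := by
    rcases Nat.lt_or_ge 1 n with h | h
    · have : n ≤ 2 ^ (n - 1) := by
        obtain ⟨m, rfl⟩ : ∃ m, n = m + 1 := ⟨n - 1, by omega⟩
        exact Nat.lt_two_pow_self
      have := (Nat.clog_le_iff_le_pow one_lt_two).2 this
      omega
    · have : n = 1 := by omega
      subst this
      simp [hLdef]
  set I : State → Prop := LeavesReady n (2 * n + 1) (fun i => baseHeight n c (w i))
    (fun i => fraction (w i)) with hIdef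
  have ha : ∀ i < n, (fun i => baseHeight n c (w i)) i ≤ n := fun i hi => baseHeight_le (hle i hi)
  refine .seq (.storeWord ?_ ?_ (.seq (.storeWord ?_ ?_ (.seq (.storeWord ?_ ?_
    (.seq ((runs_searchProg (B := B) (T := 20 * n + 49) (N := L) (K := 0)
      (r := Nat.clog 2 L + 1) (I := I) (Pr := fun m => Feasible n w c m 1) (v := fun _ => 1)
      (x := s.real rLo 0) (y := s.real rHi 0) (by omega) ?_ ?_ ?_ ?_ ?_ ?_ ?_ ?_ ?_ ?_
      ?_).mono ?_)))))))
  any_goals simp; omega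
  · simp [setupRootProg, Program.wordWrites]
  · simp [setupRootProg, Program.realWrites]
  · intro s1 s2 h1 hw hr
    refine h1.of_eq (fun b hb => hw b ?_) (hr _ (by simp))
    simp only [List.mem_cons, List.not_mem_nil, or_false] at hb ⊢
    omega
  · intro s1 m h1 hm hmL
    refine .seq ((h1.runs_setupRootProg hm (by omega) (by omega)).mono ?_)
    rintro t2 s2 ⟨ht2, h2, hF, hit⟩
    have hr := itemsReady_of_eq (R := n + m) h2.pow ha (by omega) (by omega) hit
    refine (runs_testProg (B := B) (by omega) (by omega) hr hF zero_le_one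
      (by rw [hit]; exact head?_wallItems _ _ _ _)
      (by rw [hit]; exact getLast?_wallItems _ _ _ _)).frame.mono ?_
    rintro t3 s3 ⟨⟨ht3, hc3⟩, hw3, hr3⟩
    rw [h2.items] at ht3
    refine ⟨by omega, h2.of_eq (fun b hb => hw3 b ?_) (hr3 _ (by decide)), ?_, ?_⟩
    · simp only [List.mem_cons, List.not_mem_nil, or_false] at hb
      rcases hb with rfl | rfl | rfl | rfl | rfl <;> decide
    · rw [hr3 rF (by decide), hF]
    · rw [hc3, hit]
      exact itemSum_wallItems_le_iff zero_le_one
  · have : L ≤ 2 ^ Nat.clog 2 L := Nat.le_pow_clog one_lt_two _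
    rw [pow_succ]
    have : 0 < 2 ^ Nat.clog 2 L := by positivity
    omega
  · exact hl.of_eq (by simp) (by simp)
  · simp
  · simp [hL]
  · simp
  · simp
  rintro t1 s1 ⟨ht1, h1, lo, hi, hlo, hhi, hlohi, hhiL, hgap, hLo, hHi⟩
  obtain rfl : lo = hi := by omega
  have hfeas : Feasible n w c lo 1 := by
    rcases hHi with ⟨rfl, -⟩ | ⟨-, h, -⟩
    · exact feasible_one hle (Nat.le_pow_clog one_lt_two _)
    · exact h
  have hinf : ¬ Feasible n w c lo 0 := by
    rcases hLo with ⟨rfl, -⟩ | ⟨h0, h, -⟩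
    · exact not_feasible_zero_zero hex
    · obtain ⟨m, rfl⟩ : ∃ m, lo = m + 1 := ⟨lo - 1, by omega⟩
      exact fun hF => h hF.of_succ_zero
  have h1' : LeavesReady n (2 * n + 1) (fun i => baseHeight n c (w i)) (fun i => fraction (w i))
      (s1.setWord vMid 0 lo) := h1.of_eq (by simp) (by simp)
  have hmid : s1.setWord vMid ((0 : WExpr).eval s1) ((wvar vLo).eval s1) = s1.setWord vMid 0 lo := by
    simp [hlo]
  refine .seq (.storeWord ?_ ?_ ?_)
  · simp; omega
  · simp; omega
  rw [hmid]
  refine .seq ((h1'.runs_setupRootProg (B := B) (m := lo) (by simp) (by omega)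
    (by omega)).frame.mono ?_)
  rintro t2 s2 ⟨⟨ht2, h2, -, hit⟩, hw2, hr2⟩
  have hlo2 : s2.word vLo 0 = lo := by
    rw [hw2 vLo (by decide)]
    simpa using hlo
  have hr := itemsReady_of_eq (R := n + lo) h2.pow ha (by omega) (by omega) hit
  have hn2 := h2.num
  refine .seq (.storeWord ?_ ?_ (.seq (.storeReal ?_ (.storeReal ?_
    ⟨?_, lo, hhiL, ?_, ?_, ?_, hinf, hfeas, ?_, ?_⟩))))
  · simp; omega
  · simp; omega
  · simp; omega
  · simp; omega
  · rw [show 20 * n + 49 + 5 = 20 * n + 54 by omega] at ht1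
    omega
  · simp [hlo2, hn2]
  · simp
  · simp
  · exact ⟨fun j hj => by simpa using hr.pow j hj, by simpa [inputItems] using hr.pos,
      by simpa [inputItems] using hr.height, by simpa [inputItems] using hr.sum_le⟩
  · simpa [inputItems] using hit

/-! ### The search for the threshold -/

theorem ItemsReady.of_eq {H D : ℕ} {s s' : State} (h : ItemsReady H D s)
    (hw : ∀ b ∈ [aPow, aItemK, aItemM, vItems], s'.word b = s.word b)
    (hr : s'.real rItem = s.real rItem) : ItemsReady H D s' ∧ inputItems s' = inputItems s := by
  simp only [List.forall_mem_cons, List.not_mem_nil, false_imp_iff, implies_true, and_true] at hw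
  obtain ⟨h1, h2, h3, h4⟩ := hw
  have e : inputItems s' = inputItems s := by rw [inputItems, inputItems, h2, h3, h4, hr]
  exact ⟨⟨fun j hj => by rw [h1, h.pow j hj], e ▸ h.pos, e ▸ h.height, e ▸ h.sum_le⟩, e⟩

theorem runs_searchSortedProg {B H D N K r R m m' : ℕ} {l : List Item} {Pr : ℝ → Prop} {s : State}
    (hH : H < B) (hD : D < B) (hNB : N < B) (hs : ItemsReady H D s) (hl : inputItems s = l)
    (hhead : l.head? = some (R, m, 0)) (hlast : l.getLast? = some (R, m', 0))
    (hsorted : ∀ i j, i < j → j < N → s.real rSort i ≤ s.real rSort j)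
    (hlo0 : 0 ≤ s.real rLo 0)
    (hrange : ∀ i < N, s.real rLo 0 ≤ s.real rSort i ∧ s.real rSort i ≤ s.real rHi 0)
    (hP : ∀ i < N, (itemSum (s.real rSort i) l ≤ 3 * 2 ^ R ↔ Pr (s.real rSort i)))
    (hPlo : ¬ Pr (s.real rLo 0)) (hPhi : Pr (s.real rHi 0)) (hK : N < 2 ^ r * (K + 1))
    (hlo : s.word vLo 0 = 0) (hhi : s.word vHi 0 = N) (hgap : s.word vGap 0 = K) :
    Runs B (searchProg setupSortedProg) s fun t s' => t ≤ (20 * l.length + 12) * r + 1 ∧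
      ¬ Pr (s'.real rLo 0) ∧ Pr (s'.real rHi 0) ∧
      s.real rLo 0 ≤ s'.real rLo 0 ∧ s'.real rHi 0 ≤ s.real rHi 0 ∧
      ∃ p, ∀ i < N, s'.real rLo 0 < s.real rSort i → s.real rSort i < s'.real rHi 0 →
        p ≤ i ∧ i < p + K := by
  set A := s.real rSort with hA
  refine (runs_searchProg (B := B) (T := 20 * l.length + 7) (N := N) (K := K) (r := r)
    (I := fun s' => ItemsReady H D s' ∧ inputItems s' = l ∧ s'.real rSort = A)
    (Pr := fun i => Pr (A i)) (v := A) (x := s.real rLo 0) (y := s.real rHi 0)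
    hNB ?_ ?_ ?_ ?_ hK ⟨hs, hl, rfl⟩ hlo hhi hgap rfl rfl).mono ?_
  · simp [setupSortedProg, Program.wordWrites]
  · simp [setupSortedProg, Program.realWrites]
  · rintro s1 s2 ⟨h1, h2, h3⟩ hw hr
    obtain ⟨h4, h5⟩ := h1.of_eq (s' := s2) (fun b hb => hw b (by
      simp only [List.mem_cons, List.not_mem_nil, or_false] at hb ⊢
      omega)) (hr _ (by simp))
    exact ⟨h4, h5.trans h2, (hr _ (by simp)).trans h3⟩
  · rintro s1 i ⟨h1, h2, h3⟩ hi hiN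
    have hlen : s1.word vItems 0 = l.length := by rw [← h2, inputItems, length_itemList]
    have h0 : 0 ≤ A i := hlo0.trans (hrange i hiN).1
    refine .seq (.storeReal ?_ ?_)
    · simp; omega
    have e : s1.setReal rF ((0 : WExpr).eval s1) (RExpr.eval s1 (.read rSort (wvar vMid)))
        = s1.setReal rF 0 (A i) := by simp [hi, h3]
    rw [e]
    obtain ⟨h4, h5⟩ := h1.of_eq (s' := s1.setReal rF 0 (A i)) (by simp) (by simp)
    rw [h2] at h5
    refine (runs_testProg (B := B) hH hD h4 (f := A i) (by simp) h0 (by rw [h5]; exact hhead)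
      (by rw [h5]; exact hlast)).frame.mono ?_
    rintro t3 s3 ⟨⟨ht3, hc3⟩, hw3, hr3⟩
    rw [State.word_setReal, hlen] at ht3
    obtain ⟨h6, h7⟩ := h4.of_eq (s' := s3) (fun b hb => hw3 b (by
      simp only [List.mem_cons, List.not_mem_nil, or_false] at hb
      rcases hb with rfl | rfl | rfl | rfl <;> decide)) (hr3 _ (by decide))
    refine ⟨by omega, ⟨h6, h7.trans h5, ?_⟩, ?_, ?_⟩
    · rw [hr3 _ (by decide)]; simpa using h3
    · rw [hr3 _ (by decide)]; simp
    · rw [hc3, h5]; exact hP i hiN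
  · rintro t s' ⟨ht, -, lo, hi, -, -, hlohi, hhiN, hgap', hLo, hHi⟩
    refine ⟨ht, ?_, ?_, ?_, ?_, lo, fun i hi' h1 h2 => ⟨?_, ?_⟩⟩
    · rcases hLo with ⟨-, h⟩ | ⟨-, h, h'⟩
      · rwa [h]
      · rwa [h']
    · rcases hHi with ⟨-, h⟩ | ⟨-, h, h'⟩
      · rwa [h]
      · rwa [h']
    · rcases hLo with ⟨-, h⟩ | ⟨h0, -, h'⟩
      · rw [h]
      · rw [h']
        exact (hrange _ (by omega)).1
    · rcases hHi with ⟨-, h⟩ | ⟨h0, -, h'⟩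
      · rw [h]
      · rw [h']
        exact (hrange _ h0).2
    · rcases hLo with ⟨h, -⟩ | ⟨h0, -, h'⟩
      · omega
      · by_contra hc
        rw [h'] at h1
        rcases Nat.lt_or_ge i (lo - 1) with h3 | h3
        · exact absurd h1 (not_lt.2 (hsorted _ _ h3 (by omega)))
        · obtain rfl : i = lo - 1 := by omega
          exact lt_irrefl _ h1
    · refine lt_of_lt_of_le ?_ hgap'
      rcases hHi with ⟨h, -⟩ | ⟨h0, -, h'⟩
      · omega
      · by_contra hc
        rw [h'] at h2
        rcases Nat.lt_or_ge hi i with h3 | h3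
        · exact absurd h2 (not_lt.2 (hsorted _ _ h3 hi'))
        · obtain rfl : i = hi := by omega
          exact lt_irrefl _ h2

/-! ### Sampling -/

theorem SortedBlocks.sorted {g N : ℕ} {A : ℕ → ℝ} (h : SortedBlocks g A N) (hN : N ≤ g) :
    ∀ i j, i < j → j < N → A i ≤ A j := fun i j hij hj =>
  h i j hij hj (by rw [Nat.div_eq_of_lt (by omega), Nat.div_eq_of_lt (by omega)])

theorem countP_slice (A : ℕ → ℝ) (n : ℕ) (P : ℝ → Prop) [DecidablePred P] :
    (slice A 0 n).countP P = ((Finset.range n).filter fun i => P (A i)).card := by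
  induction n with
  | zero => simp [slice]
  | succ n ih =>
    rw [slice_succ _ (Nat.zero_le _), Multiset.countP_add, ih, Finset.range_add_one,
      Finset.filter_insert]
    split_ifs with h
    · rw [Finset.card_insert_of_notMem (by simp)]
      simp [Multiset.countP_eq_card_filter, Multiset.filter_singleton, h]
    · simp [Multiset.countP_eq_card_filter, Multiset.filter_singleton, h]

theorem countP_slice_le {A : ℕ → ℝ} {n p K : ℕ} {P : ℝ → Prop} [DecidablePred P]
    (h : ∀ i < n, P (A i) → p ≤ i ∧ i < p + K) : (slice A 0 n).countP P ≤ K := by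
  rw [countP_slice]
  calc _ ≤ (Finset.Ico p (p + K)).card := Finset.card_le_card fun i hi => by
        simp only [Finset.mem_filter, Finset.mem_range] at hi
        exact Finset.mem_Ico.2 (h i hi.1 hi.2)
    _ = K := by simp

/-- If every `g`-th entry is sampled from blocks of `g²` sorted entries, and at most `K` entries of
the sample lie in an interval, then only few entries do: in each block, besides the ones that follow
such an entry of the sample, only the ones that follow the last entry of the sample below the
interval. -/
theorem countP_le_of_sample {S : ℕ → ℝ} {n g N K : ℕ} (hg : 0 < g) (hS : SortedBlocks (g * g) S n)
    (hN : ∀ j, j < N ↔ j * g < n) {lo hi : ℝ}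
    (hK : (slice (fun j => S (j * g)) 0 N).countP (fun x => lo < x ∧ x < hi) ≤ K) :
    (slice S 0 n).countP (fun x => lo < x ∧ x < hi) ≤ g * (K + (n / (g * g) + 1)) := by
  classical
  rw [countP_slice] at hK ⊢
  set act := (Finset.range n).filter fun i => lo < S i ∧ S i < hi with hact
  have h1 : act.card ≤ g * (act.image (· / g)).card := by
    refine Finset.card_le_mul_card_image _ _ fun j _ => ?_
    calc _ ≤ (Finset.Ico (j * g) (j * g + g)).card := Finset.card_le_card fun i hi => by
          simp only [Finset.mem_filter] at hi
          rw [Finset.mem_Ico, ← hi.2]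
          have := Nat.div_add_mod' i g
          have := Nat.mod_lt i hg
          omega
      _ = g := by simp
  refine h1.trans (Nat.mul_le_mul_left _ ?_)
  rw [← Finset.card_filter_add_card_filter_not (fun j => lo < S (j * g))]
  have hmem : ∀ j ∈ act.image (· / g), ∃ i < n, lo < S i ∧ S i < hi ∧ i / g = j ∧ j * g ≤ i := by
    intro j hj
    obtain ⟨i, hi, rfl⟩ := Finset.mem_image.1 hj
    simp only [hact, Finset.mem_filter, Finset.mem_range] at hi
    exact ⟨i, hi.1, hi.2.1, hi.2.2, rfl, Nat.div_mul_le_self _ _⟩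
  have hblock : ∀ i, i / g * g / (g * g) = i / (g * g) := by
    intro i
    rw [Nat.mul_div_mul_right _ _ hg, Nat.div_div_eq_div_mul]
  refine Nat.add_le_add (le_trans (Finset.card_le_card ?_) hK) ?_
  · intro j hj
    rw [Finset.mem_filter] at hj
    obtain ⟨i, hin, h2, h3, h4, h5⟩ := hmem j hj.1
    rw [Finset.mem_filter, Finset.mem_range, hN]
    refine ⟨by omega, hj.2, ?_⟩
    rcases h5.eq_or_lt with h6 | h6
    · rwa [h6]
    · refine (hS _ _ h6 hin ?_).trans_lt h3
      rw [← h4, hblock]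
  · rw [← Finset.card_range (n / (g * g) + 1)]
    refine Finset.card_le_card_of_injOn (fun j => j / g) (fun j hj => ?_) fun j hj j' hj' hjj => ?_
    · rw [Finset.mem_coe, Finset.mem_filter] at hj
      obtain ⟨i, hin, -, -, h4, h5⟩ := hmem j hj.1
      rw [Finset.mem_coe, Finset.mem_range, Nat.lt_succ_iff]
      show j / g ≤ _
      rw [← h4, Nat.div_div_eq_div_mul]
      exact Nat.div_le_div_right hin.le
    · rw [Finset.mem_coe, Finset.mem_filter] at hj hj'
      simp only at hjj
      have key : ∀ j j', j ∈ act.image (· / g) → ¬ lo < S (j' * g) → j' ∈ act.image (· / g) →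
          j / g = j' / g → ¬ j < j' := by
        intro j j' hj hlo hj' he hlt
        obtain ⟨i, hin, h2, h3, h4, h5⟩ := hmem j hj
        obtain ⟨i', hin', -, -, -, h5'⟩ := hmem j' hj'
        have h6 : i < j' * g := by
          rw [← Nat.div_lt_iff_lt_mul hg]
          omega
        refine hlo (h2.trans_le (hS _ _ h6 (by omega) ?_))
        rw [← Nat.div_div_eq_div_mul, h4, he, ← Nat.div_div_eq_div_mul, Nat.mul_div_cancel _ hg]
      have h1 := key j j' hj.1 hj'.2 hj'.1 hjj
      have h2 := key j' j hj'.1 hj.2 hj.1 hjj.symm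
      omega

/-- Keep only the entries whose positions are multiples of the stride. -/
def sampleProg : Program :=
  .storeWord vLen 0 0 ⨾
  .loop (.wordLt (wvar vLen * wvar vStride) (wvar vN))
    (.storeReal rSort (wvar vLen) (.read rSort (wvar vLen * wvar vStride)) ⨾
      .storeWord vLen 0 (wvar vLen + 1))

theorem runs_sampleProg {B n g : ℕ} {s : State} (hnB : n < B) (hg : 0 < g) (hN : s.word vN 0 = n)
    (hs : s.word vStride 0 = g) :
    Runs B sampleProg s fun t s' => t ≤ 3 * n + 2 ∧ ∃ N, s'.word vLen 0 = N ∧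
      (∀ j, j < N ↔ j * g < n) ∧ ∀ j < N, s'.real rSort j = s.real rSort (j * g) := by
  let R : ℕ → State → Prop := fun p s' => p ≤ n ∧ s'.word vLen 0 = p ∧ s'.word vN 0 = n ∧
    s'.word vStride 0 = g ∧ (∀ j < p, j * g < n) ∧ (∀ j < p, s'.real rSort j = s.real rSort (j * g)) ∧
    ∀ j, p ≤ j → s'.real rSort j = s.real rSort j
  refine .seq (.storeWord ?_ ?_ ((Runs.loop (R := R)
    (φ := fun p => 3 * (n - p)) (g := 0) ?_ ?_).mono ?_))
  any_goals simp; omega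
  · exact ⟨Nat.zero_le _, by simp, by simpa using hN, by simpa using hs, by simp, by simp, by simp⟩
  · rintro p s1 ⟨hpn, hp, hN1, hs1, h1, h2, h3⟩ hlt
    simp only [Cond.holds_wordLt, WExpr.eval_read, WExpr.eval_ofNat, WExpr.eval_mul, hp, hN1,
      hs1] at hlt
    have hle : p ≤ p * g := Nat.le_mul_of_pos_right _ hg
    refine .seq (.storeReal ?_ (.storeWord ?_ ?_ ⟨p + 1, ⟨by omega, ?_, ?_, ?_, ?_, ?_, ?_⟩, ?_⟩))
    · simp [hp]; omega
    · simp; omega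
    · simp [hp]; omega
    · simp [hp]
    · simpa using hN1
    · simpa using hs1
    · intro j hj
      rcases Nat.lt_succ_iff_lt_or_eq.1 hj with h | rfl
      · exact h1 j h
      · exact hlt
    · intro j hj
      rcases Nat.lt_succ_iff_lt_or_eq.1 hj with h | rfl
      · simp [hp, h.ne, h2 j h]
      · simp [hp, hs1, h3 _ hle]
    · intro j hj
      have : j ≠ p := by omega
      simp [hp, this, h3 j (by omega)]
    · omega
  · rintro t s' ⟨p, ⟨hpn, hp, hN1, hs1, h1, h2, h3⟩, hlt, ht⟩
    simp only [Cond.holds_wordLt, WExpr.eval_read, WExpr.eval_ofNat, WExpr.eval_mul, hp, hN1,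
      hs1, not_lt] at hlt
    refine ⟨by simp at ht; omega, p, hp, fun j => ⟨h1 j, fun h => ?_⟩, h2⟩
    by_contra hc
    have := Nat.mul_le_mul_right g (not_lt.1 hc)
    omega

/-- Sort blocks of the fractions, and sort a sample of them. -/
def sortSampleProg : Program :=
  .storeWord vLen 0 (wvar vN) ⨾ .storeWord vTarget 0 (wvar vStride * wvar vStride) ⨾ sortProg ⨾
  sampleProg ⨾ .storeWord vTarget 0 (wvar vLen) ⨾ sortProg

theorem runs_sortSampleProg {B n a : ℕ} {s : State} (hn : 0 < n) (hnB : 2 * n < B)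
    (haB : 2 * (2 ^ a * 2 ^ a) < B) (hN : s.word vN 0 = n) (hs : s.word vStride 0 = 2 ^ a) :
    Runs B sortSampleProg s fun t s' => ∃ N S, s'.word vLen 0 = N ∧
      t ≤ (16 * n + 10) * (2 * a) + (16 * N + 10) * Nat.clog 2 n + 3 * n + 9 ∧
      (∀ j, j < N ↔ j * 2 ^ a < n) ∧ slice S 0 n = slice (s.real rSort) 0 n ∧
      SortedBlocks (2 ^ a * 2 ^ a) S n ∧
      slice (s'.real rSort) 0 N = slice (fun j => S (j * 2 ^ a)) 0 N ∧
      ∀ i j, i < j → j < N → s'.real rSort i ≤ s'.real rSort j := by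
  have hclog : Nat.clog 2 (2 ^ a * 2 ^ a) = 2 * a := by
    rw [← pow_add, Nat.clog_pow _ _ one_lt_two, two_mul]
  have hpow : 2 ^ (2 * a) = 2 ^ a * 2 ^ a := by rw [two_mul, pow_add]
  refine .seq (.storeWord ?_ ?_ (.seq (.storeWord ?_ ?_ (.seq ((runs_sortProg (B := B) (N := n)
    (g := 2 ^ a * 2 ^ a) ?_ ?_ ?_ ?_ ?_).frame.mono ?_)))))
  any_goals simp; omega
  · simp [hs]; omega
  · omega
  · omega
  · simp [hs]
  · exact haB
  rintro t1 s1 ⟨⟨ht1, hp1, hb1⟩, hw1, hr1⟩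
  rw [hclog] at ht1 hb1
  rw [hpow] at hb1
  refine .seq ((runs_sampleProg (B := B) (n := n) (g := 2 ^ a) (by omega) (by positivity)
    ?_ ?_).frame.mono ?_)
  · rw [hw1 vN (by decide)]; simpa using hN
  · rw [hw1 vStride (by decide)]; simpa using hs
  rintro t2 s2 ⟨⟨ht2, N, hN2, hNiff, hA⟩, hw2, hr2⟩
  have hNn : N ≤ n := by
    by_contra hc
    have := (hNiff n).1 (by omega)
    have := Nat.le_mul_of_pos_right n (show 0 < 2 ^ a by positivity)
    omega
  refine .seq (.storeWord ?_ ?_ ((runs_sortProg (B := B) (N := N) (g := N) ?_ ?_ ?_ ?_ ?_).frame.mono ?_))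
  any_goals simp; omega
  · omega
  · omega
  · omega
  rintro t3 s3 ⟨⟨ht3, hp3, hb3⟩, hw3, -⟩
  refine ⟨N, s1.real rSort, ?_, ?_, hNiff, ?_, hb1, ?_, hb3.sorted (Nat.le_pow_clog one_lt_two _)⟩
  · rw [hw3 vLen (by decide)]; simpa using hN2
  · have : (16 * N + 10) * Nat.clog 2 N ≤ (16 * N + 10) * Nat.clog 2 n :=
      Nat.mul_le_mul_left _ (Nat.clog_mono_right _ hNn)
    omega
  · rw [hp1]; simp
  · rw [hp3, State.real_setWord]
    exact slice_congr fun j _ hj => hA j hj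

theorem le_div_add_one_of_lt_iff {n g N : ℕ} (hg : 0 < g) (hN : ∀ j, j < N ↔ j * g < n) :
    N ≤ n / g + 1 := by
  by_contra hc
  have h1 := (hN (n / g + 1)).1 (by omega)
  have h2 := (Nat.div_lt_iff_lt_mul hg).1 (Nat.lt_add_one (n / g))
  omega

/-- Search for the threshold in a sorted sample of the fractions. -/
def searchSampleProg : Program :=
  sortSampleProg ⨾ .storeWord vLo 0 0 ⨾ .storeWord vHi 0 (wvar vLen) ⨾
  .storeWord vGap 0 (wvar vLen / wvar vStride) ⨾ searchProg setupSortedProg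

/-- Only `O(n / 2 ^ a + 2 ^ a)` fractions are left between the thresholds that the search in the sample
finds. -/
theorem runs_searchSampleProg {B H D n a R m m' : ℕ} {l : List Item} {Pr : ℝ → Prop} {s : State}
    (hn : 0 < n) (hnB : 2 * n < B) (haB : 2 * (2 ^ a * 2 ^ a) < B) (hH : H < B) (hD : D < B)
    (hN : s.word vN 0 = n) (hstride : s.word vStride 0 = 2 ^ a)
    (hs : ItemsReady H D s) (hl : inputItems s = l)
    (hhead : l.head? = some (R, m, 0)) (hlast : l.getLast? = some (R, m', 0))
    (hlo0 : 0 ≤ s.real rLo 0)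
    (hrange : ∀ i < n, s.real rLo 0 ≤ s.real rSort i ∧ s.real rSort i ≤ s.real rHi 0)
    (hP : ∀ f, 0 ≤ f → (itemSum f l ≤ 3 * 2 ^ R ↔ Pr f))
    (hPlo : ¬ Pr (s.real rLo 0)) (hPhi : Pr (s.real rHi 0)) :
    Runs B searchSampleProg s fun t s' =>
      t ≤ (16 * n + 10) * (2 * a) + (16 * (n / 2 ^ a) + 26) * Nat.clog 2 n + 3 * n
        + (20 * l.length + 12) * a + 13 ∧
      ¬ Pr (s'.real rLo 0) ∧ Pr (s'.real rHi 0) ∧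
      s.real rLo 0 ≤ s'.real rLo 0 ∧ s'.real rHi 0 ≤ s.real rHi 0 ∧
      (slice (s.real rSort) 0 n).countP (fun x => s'.real rLo 0 < x ∧ x < s'.real rHi 0)
        ≤ 2 * (n / 2 ^ a) + 2 ^ a + 1 := by
  have hpos : 0 < 2 ^ a := by positivity
  refine .seq ((runs_sortSampleProg hn hnB haB hN hstride).frame.mono ?_)
  rintro t1 s1 ⟨⟨N, S, hN1, ht1, hNiff, hSs, hSb, hA, hAs⟩, hw1, hr1⟩
  have hNle := le_div_add_one_of_lt_iff hpos hNiff
  have hNn : N ≤ n := by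
    by_contra hc
    have := (hNiff n).1 (by omega)
    have := Nat.le_mul_of_pos_right n hpos
    omega
  have hstride1 : s1.word vStride 0 = 2 ^ a := by rw [hw1 vStride (by decide), hstride]
  refine .seq (.storeWord ?_ ?_ (.seq (.storeWord ?_ ?_ (.seq (.storeWord ?_ ?_ ?_)))))
  any_goals simp; omega
  · simp [hN1]
    have := Nat.div_le_self N (s1.word vStride 0)
    omega
  generalize hs2 : State.setWord _ vGap _ _ = s2
  have hw2 : ∀ b ∉ [vLo, vHi, vGap], s2.word b = s1.word b := by
    intro b hb
    simp only [List.mem_cons, not_or, List.not_mem_nil, not_false_eq_true, and_true] at hb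
    rw [← hs2]
    simp [hb]
  have hr2 : s2.real = s1.real := by rw [← hs2]; rfl
  obtain ⟨hI, hl2⟩ := hs.of_eq (s' := s2) (fun b hb => by
    simp only [List.mem_cons, List.not_mem_nil, or_false] at hb
    rcases hb with rfl | rfl | rfl | rfl <;>
    rw [hw2 _ (by decide), hw1 _ (by decide)]) (by rw [hr2, hr1 _ (by decide)])
  have elo : s2.real rLo = s.real rLo := by rw [hr2, hr1 _ (by decide)]
  have ehi : s2.real rHi = s.real rHi := by rw [hr2, hr1 _ (by decide)]
  have hrange2 : ∀ i < N, s.real rLo 0 ≤ s2.real rSort i ∧ s2.real rSort i ≤ s.real rHi 0 := by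
    intro i hi
    have h1 : s2.real rSort i ∈ slice (s1.real rSort) 0 N := by
      rw [hr2]; exact mem_slice.2 ⟨i, Nat.zero_le _, hi, rfl⟩
    rw [hA] at h1
    obtain ⟨j, -, hj, h2⟩ := mem_slice.1 h1
    have h3 : S (j * 2 ^ a) ∈ slice S 0 n :=
      mem_slice.2 ⟨_, Nat.zero_le _, (hNiff j).1 hj, rfl⟩
    rw [hSs] at h3
    obtain ⟨k, -, hk, h4⟩ := mem_slice.1 h3
    rw [← h2, ← h4]
    exact hrange k hk
  refine (runs_searchSortedProg (B := B) (N := N) (K := N / 2 ^ a) (r := a) (Pr := Pr) hH hD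
    (by omega) hI (hl2.trans hl) hhead hlast (by rw [hr2]; exact hAs) (by rw [elo]; exact hlo0)
    (by rw [elo, ehi]; exact hrange2) (fun i hi => hP _ (hlo0.trans (hrange2 i hi).1))
    (by rw [elo]; exact hPlo) (by rw [ehi]; exact hPhi) (Nat.lt_mul_div_succ N hpos)
    ?_ ?_ ?_).mono ?_
  · rw [← hs2]; simp
  · rw [← hs2]; simp [hN1]
  · rw [← hs2]; simp [hN1, hstride1]
  rintro t3 s3 ⟨ht3, h1, h2, h3, h4, p, h5⟩
  refine ⟨?_, h1, h2, by rwa [elo] at h3, by rwa [ehi] at h4, ?_⟩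
  · have : (16 * N + 10) * Nat.clog 2 n ≤ (16 * (n / 2 ^ a) + 26) * Nat.clog 2 n :=
      Nat.mul_le_mul_right _ (by omega)
    omega
  · have hc := countP_slice_le (A := s2.real rSort) (P := fun x => s3.real rLo 0 < x ∧
      x < s3.real rHi 0) fun i hi h => h5 i hi h.1 h.2
    rw [hr2, hA] at hc
    have h6 := countP_le_of_sample hpos hSb hNiff hc
    rw [hSs] at h6
    refine h6.trans ?_
    have h7 : 2 ^ a * (N / 2 ^ a) ≤ N := Nat.mul_div_le _ _
    have h8 : 2 ^ a * (n / (2 ^ a * 2 ^ a)) ≤ n / 2 ^ a := by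
      rw [← Nat.div_div_eq_div_mul]
      exact Nat.mul_div_le _ _
    rw [Nat.mul_add, Nat.mul_add, Nat.mul_one]
    omega

/-! ### The search among the remaining fractions -/

/-- Replace the items by the stack. -/
def copyStackProg : Program :=
  .storeWord vJ 0 0 ⨾
  .loop (.wordLt (wvar vJ) (wvar vStack))
    (.storeWord aItemK (wvar vJ) (.read aStackK (wvar vJ)) ⨾
      .storeWord aItemM (wvar vJ) (.read aStackM (wvar vJ)) ⨾
      .storeReal rItem (wvar vJ) (.read rStack (wvar vJ)) ⨾
      .storeWord vJ 0 (wvar vJ + 1)) ⨾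
  .storeWord vItems 0 (wvar vStack)

theorem runs_copyStackProg {B p : ℕ} {s : State} (hpB : p < B) (hp : s.word vStack 0 = p)
    (hK : ∀ j < p, s.word aStackK j < B) (hM : ∀ j < p, s.word aStackM j < B) :
    Runs B copyStackProg s fun t s' => t ≤ 5 * p + 3 ∧ inputItems s' = stackItems s := by
  let R : ℕ → State → Prop := fun j s' => j ≤ p ∧ s'.word vJ 0 = j ∧ s'.word vStack = s.word vStack ∧
    s'.word aStackK = s.word aStackK ∧ s'.word aStackM = s.word aStackM ∧
    s'.real rStack = s.real rStack ∧
    ∀ i < j, s'.word aItemK i = s.word aStackK i ∧ s'.word aItemM i = s.word aStackM i ∧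
      s'.real rItem i = s.real rStack i
  refine .seq (.storeWord ?_ ?_ (.seq ((Runs.loop (R := R) (φ := fun j => 5 * (p - j)) (g := 0)
    ?_ ?_).mono ?_)))
  any_goals simp; omega
  · exact ⟨Nat.zero_le _, by simp, by simp, by simp, by simp, by simp, by simp⟩
  · rintro j s1 ⟨hjp, hj, e1, e2, e3, e4, h⟩ hlt
    simp only [Cond.holds_wordLt, WExpr.eval_read, WExpr.eval_ofNat, hj, e1, hp] at hlt
    have hKj := hK j hlt
    have hMj := hM j hlt
    refine .seq (.storeWord ?_ ?_ (.seq (.storeWord ?_ ?_ (.seq (.storeReal ?_ (.storeWord ?_ ?_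
      ⟨j + 1, ⟨hlt, ?_, ?_, ?_, ?_, ?_, ?_⟩, ?_⟩))))))
    · simp [hj]; omega
    · simpa [hj, e2] using hKj
    · simp [hj]; omega
    · simpa [hj, e3] using hMj
    · simp [hj]; omega
    · simp; omega
    · simp [hj]; omega
    · simp [hj]
    · simpa using e1
    · simpa using e2
    · simpa using e3
    · simpa using e4
    · intro i hi
      rcases Nat.lt_succ_iff_lt_or_eq.1 hi with h1 | rfl
      · simp [hj, h1.ne, h i h1]
      · simp [hj, e2, e3, e4]
    · omega
  · rintro t s1 ⟨j, ⟨hjp, hj, e1, e2, e3, e4, h⟩, hlt, ht⟩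
    simp only [Cond.holds_wordLt, WExpr.eval_read, WExpr.eval_ofNat, hj, e1, hp, not_lt] at hlt
    obtain rfl : j = p := le_antisymm hjp hlt
    refine .storeWord ?_ ?_ ⟨by simp at ht; omega, ?_⟩
    · simp; omega
    · simp [e1, hp]; omega
    · simp only [inputItems, stackItems, WExpr.eval_ofNat, WExpr.eval_read, e1, hp,
        State.word_setWord_self, Function.update_self, State.real_setWord]
      refine itemList_congr fun i hi => ?_
      simpa using h i hi

/-- Compress the items for the thresholds from `rLo` to `rHi`. -/
def compressItemsProg : Program :=
  .storeReal rCLo 0 (rvar rLo) ⨾ .storeReal rCHi 0 (rvar rHi) ⨾ compressProg ⨾ copyStackProg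

theorem runs_compressItemsProg {B H D : ℕ} {Λ : Finset ℕ} {l : List Item} {s : State}
    (hH : H < B) (hD : D < B) (hs : ItemsReady H D s) (hl : inputItems s = l)
    (hlo : 0 ≤ s.real rLo 0) (hΛ : ∀ e ∈ l, e.1 ∈ Λ ∧ (0 < e.2.2 → e.1 + 1 ∈ Λ))
    (hΛH : ∀ x ∈ Λ, x < H) :
    Runs B compressItemsProg s fun t s' => t ≤ 20 * l.length + 5 * D + 9 ∧ ItemsReady H D s' ∧
      inputItems s' = (compress (s.real rLo 0) (s.real rHi 0) l).items := by
  have hlen : s.word vItems 0 = l.length := by rw [← hl, inputItems, length_itemList]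
  have hgood := good_compress (hi := s.real rHi 0) hlo hΛ (hl ▸ hs.pos)
  have hsum := hl ▸ hs.sum_le
  refine .seq (.storeReal ?_ (.seq (.storeReal ?_ ?_)))
  any_goals simp; omega
  generalize hs2 : State.setReal _ rCHi _ _ = s2
  obtain ⟨hI, hl2⟩ := hs.of_eq (s' := s2) (by rw [← hs2]; simp) (by rw [← hs2]; simp)
  have elo : s2.real rCLo 0 = s.real rLo 0 := by rw [← hs2]; simp
  have ehi : s2.real rCHi 0 = s.real rHi 0 := by rw [← hs2]; simp
  refine .seq ((runs_compressProg hH hD hI (by rw [elo]; exact hlo)).frame.mono ?_)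
  rintro t3 s3 ⟨⟨ht3, hst⟩, hw3, -⟩
  rw [elo, ehi, hl2, hl] at hst
  have e2 : s2.word vItems 0 = l.length := by rw [← hs2]; simpa using hlen
  rw [e2] at ht3
  have hp := word_stack_of_stackItems hst
  have hlenD := hgood.length_le_sum.trans hsum
  set q := (compress (s.real rLo 0) (s.real rHi 0) l).items with hq
  have hq1 : ∀ e ∈ stackItems s3, e.1 + 1 ≤ H ∧ 0 < e.2.1 ∧ e.2.1 ≤ D := by
    rw [hst]
    exact fun e he => ⟨hΛH _ (hgood.mem e he).1, hgood.pos e he,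
      (List.single_le_sum (by simp) _ (List.mem_map_of_mem (f := fun e : Item => e.2.1) he)).trans (hgood.sum_le.trans hsum)⟩
  rw [stackItems, forall_mem_itemList, hp] at hq1
  refine (runs_copyStackProg (B := B) (p := q.length) (by omega) hp (fun j hj => ?_)
    fun j hj => ?_).frame.mono ?_
  · have := (hq1 j hj).1; simp only at this; omega
  · have := (hq1 j hj).2.2; simp only at this; omega
  rintro t4 s4 ⟨⟨ht4, hit⟩, hw4, -⟩
  rw [hst] at hit
  refine ⟨by omega, ⟨?_, ?_, ?_, ?_⟩, hit⟩
  · intro j hj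
    rw [hw4 _ (by decide), hw3 _ (by decide), hI.pow j hj]
  · rw [hit]; exact hgood.pos
  · rw [hit]; exact fun e he => hΛH _ (hgood.mem e he).1
  · rw [hit]; exact hgood.sum_le.trans hsum

/-- Collect the fractions strictly between `rLo` and `rHi`. -/
def collectProg : Program :=
  .storeWord vLen 0 0 ⨾ .storeWord vI 0 0 ⨾
  .loop (.wordLt (wvar vI) (wvar vN))
    (.ite (.and (.realLt (rvar rLo) (.read rFrac (wvar vI)))
          (.realLt (.read rFrac (wvar vI)) (rvar rHi)))
        (.storeReal rSort (wvar vLen) (.read rFrac (wvar vI)) ⨾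
          .storeWord vLen 0 (wvar vLen + 1))
        (.storeWord vLen 0 (wvar vLen)) ⨾
      .storeWord vI 0 (wvar vI + 1))

theorem runs_collectProg {B n : ℕ} {s : State} (hnB : n < B) (hN : s.word vN 0 = n) :
    Runs B collectProg s fun t s' => t ≤ 5 * n + 3 ∧ ∃ N, s'.word vLen 0 = N ∧
      slice (s'.real rSort) 0 N = (slice (s.real rFrac) 0 n).filter
        fun x => s.real rLo 0 < x ∧ x < s.real rHi 0 := by
  let R : ℕ → State → Prop := fun j s' => j ≤ n ∧ s'.word vI 0 = j ∧ s'.word vN = s.word vN ∧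
    s'.real rFrac = s.real rFrac ∧ s'.real rLo = s.real rLo ∧ s'.real rHi = s.real rHi ∧
    ∃ N ≤ j, s'.word vLen 0 = N ∧ slice (s'.real rSort) 0 N = (slice (s.real rFrac) 0 j).filter
        fun x => s.real rLo 0 < x ∧ x < s.real rHi 0
  refine .seq (.storeWord ?_ ?_ (.seq (.storeWord ?_ ?_ ((Runs.loop (R := R)
    (φ := fun j => 5 * (n - j)) (g := 0) ?_ ?_).mono ?_))))
  any_goals simp; omega
  · exact ⟨Nat.zero_le _, by simp, by simp, by simp, by simp, by simp, 0, le_rfl, by simp,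
      by simp [slice_self]⟩
  · rintro j s1 ⟨hjn, hj, e1, e2, e3, e4, N, hNj, hN1, h⟩ hlt
    simp only [Cond.holds_wordLt, WExpr.eval_read, WExpr.eval_ofNat, hj, e1, hN] at hlt
    refine .seq (.ite (fun hc => ?_) fun hc => ?_)
    · simp only [Cond.holds_and, Cond.holds_realLt, RExpr.eval_read, WExpr.eval_read,
        WExpr.eval_ofNat, hj, e2, e3, e4] at hc
      refine .seq (.storeReal ?_ (.storeWord ?_ ?_ (.storeWord ?_ ?_
        ⟨j + 1, ⟨hlt, ?_, ?_, ?_, ?_, ?_, N + 1, by omega, ?_, ?_⟩, ?_⟩)))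
      · simp [hN1]; omega
      · simp; omega
      · simp [hN1]; omega
      · simp; omega
      · simp [hj]; omega
      · simp [hj]
      · simpa using e1
      · simpa using e2
      · simpa using e3
      · simpa using e4
      · simp [hN1]
      · rw [slice_succ _ (Nat.zero_le j), Multiset.filter_add, ← h, Multiset.filter_singleton,
          if_pos hc, ← MergeInv.slice_update]
        simp [hN1, hj, e2]
      · omega
    · simp only [Cond.holds_and, Cond.holds_realLt, RExpr.eval_read, WExpr.eval_read,
        WExpr.eval_ofNat, hj, e2, e3, e4] at hc
      refine .storeWord ?_ ?_ (.storeWord ?_ ?_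
        ⟨j + 1, ⟨hlt, ?_, ?_, ?_, ?_, ?_, N, by omega, ?_, ?_⟩, ?_⟩)
      · simp; omega
      · simp [hN1]; omega
      · simp; omega
      · simp [hj]; omega
      · simp [hj]
      · simpa using e1
      · simpa using e2
      · simpa using e3
      · simpa using e4
      · simp [hN1]
      · rw [slice_succ _ (Nat.zero_le j), Multiset.filter_add, ← h, Multiset.filter_singleton,
          if_neg hc]
        simp
      · omega
  · rintro t s1 ⟨j, ⟨hjn, hj, e1, e2, e3, e4, N, hNj, hN1, h⟩, hlt, ht⟩
    simp only [Cond.holds_wordLt, WExpr.eval_read, WExpr.eval_ofNat, hj, e1, hN, not_lt] at hlt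
    obtain rfl : j = n := le_antisymm hjn hlt
    exact ⟨by simp at ht; omega, N, hN1, h⟩

/-- Search for the threshold among the fractions strictly between `rLo` and `rHi`. -/
def searchRestProg : Program :=
  compressItemsProg ⨾ collectProg ⨾ .storeWord vTarget 0 (wvar vLen) ⨾ sortProg ⨾
  .storeWord vLo 0 0 ⨾ .storeWord vHi 0 (wvar vLen) ⨾ .storeWord vGap 0 0 ⨾
  searchProg setupSortedProg

/-- The tests run on the compressed items, whose number depends on the number `U` of the remaining
fractions and the number of heights, but not on `n`. -/
theorem runs_searchRestProg {B H D n R m m' U : ℕ} {Λ : Finset ℕ} {l : List Item}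
    {Pr : ℝ → Prop} {s : State} (hn : 0 < n) (hnB : 2 * n < B) (hH : H < B) (hD : D < B)
    (hN : s.word vN 0 = n) (hs : ItemsReady H D s) (hl : inputItems s = l)
    (hhead : l.head? = some (R, m, 0)) (hlast : l.getLast? = some (R, m', 0))
    (hΛ : ∀ e ∈ l, e.1 ∈ Λ ∧ (0 < e.2.2 → e.1 + 1 ∈ Λ)) (hΛH : ∀ x ∈ Λ, x < H)
    (hlo0 : 0 ≤ s.real rLo 0) (hP : ∀ f, 0 ≤ f → (itemSum f l ≤ 3 * 2 ^ R ↔ Pr f))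
    (hPlo : ¬ Pr (s.real rLo 0)) (hPhi : Pr (s.real rHi 0))
    (hU : (slice (s.real rFrac) 0 n).countP (fun x => s.real rLo 0 < x ∧ x < s.real rHi 0) = U)
    (hUl : l.countP (fun e => s.real rLo 0 < e.2.2 ∧ e.2.2 < s.real rHi 0) = U) :
    Runs B searchRestProg s fun t s' =>
      t ≤ 20 * l.length + 5 * D + 5 * n + (16 * U + 10) * Nat.clog 2 n
        + (20 * ((U + 1) * (2 * Λ.card + 1)) + 12) * (Nat.clog 2 n + 1) + 20 ∧
      ¬ Pr (s'.real rLo 0) ∧ Pr (s'.real rHi 0) ∧ s.real rLo 0 ≤ s'.real rLo 0 ∧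
      s'.real rHi 0 ≤ s.real rHi 0 ∧
      ∀ i < n, ¬ (s'.real rLo 0 < s.real rFrac i ∧ s.real rFrac i < s'.real rHi 0) := by
  set lo := s.real rLo 0 with hlo
  set hi := s.real rHi 0 with hhi
  have hgood := good_compress (hi := hi) hlo0 hΛ (hl ▸ hs.pos)
  set q := (compress lo hi l).items with hq
  have hqlen := hgood.length_items_le
  rw [hUl, ← hq] at hqlen
  refine .seq ((runs_compressItemsProg hH hD hs hl hlo0 hΛ hΛH).frame.mono ?_)
  rintro t1 s1 ⟨⟨ht1, hI1, hit1⟩, hw1, hr1⟩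
  rw [← hlo, ← hhi, ← hq] at hit1
  refine .seq ((runs_collectProg (B := B) (n := n) (by omega)
    (by rw [hw1 _ (by decide)]; exact hN)).frame.mono ?_)
  rintro t2 s2 ⟨⟨ht2, N, hN2, hsl2⟩, hw2, hr2⟩
  rw [hr1 rFrac (by decide), hr1 rLo (by decide), hr1 rHi (by decide), ← hlo, ← hhi] at hsl2
  have hNU : N = U := by
    rw [← hU, Multiset.countP_eq_card_filter, ← hsl2]
    simp [slice]
  have hNn : N ≤ n := by
    rw [hNU, ← hU]
    exact (Multiset.countP_le_card _ _).trans (by simp [slice])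
  refine .seq (.storeWord ?_ ?_ (.seq ((runs_sortProg (B := B) (N := N) (g := N) (by omega) ?_
    (by omega) ?_ (by omega)).frame.mono ?_)))
  any_goals simp; omega
  rintro t3 s3 ⟨⟨ht3, hp3, hb3⟩, hw3, hr3⟩
  have hN3 : s3.word vLen 0 = N := by
    rw [hw3 _ (by decide)]
    simpa using hN2
  rw [State.real_setWord, hsl2] at hp3
  refine .seq (.storeWord ?_ ?_ (.seq (.storeWord ?_ ?_ (.seq (.storeWord ?_ ?_ ?_)))))
  any_goals simp; omega
  generalize hs4 : State.setWord _ vGap _ _ = s4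
  have hw4 : ∀ b ∉ [vLo, vHi, vGap], s4.word b = s3.word b := by
    intro b hb
    simp only [List.mem_cons, not_or, List.not_mem_nil, not_false_eq_true, and_true] at hb
    rw [← hs4]
    simp [hb]
  have hr4 : s4.real = s3.real := by rw [← hs4]; rfl
  obtain ⟨hI, hl4⟩ := hI1.of_eq (s' := s4) (fun b hb => by
    simp only [List.mem_cons, List.not_mem_nil, or_false] at hb
    rcases hb with rfl | rfl | rfl | rfl <;>
    rw [hw4 _ (by decide), hw3 _ (by decide), State.word_setWord_of_ne _ _ _ (by decide),
      hw2 _ (by decide)]) (by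
    rw [hr4, hr3 _ (by decide), State.real_setWord, hr2 _ (by decide)])
  have elo : s4.real rLo 0 = lo := by
    rw [hr4, hr3 _ (by decide), State.real_setWord, hr2 _ (by decide), hr1 _ (by decide)]
  have ehi : s4.real rHi 0 = hi := by
    rw [hr4, hr3 _ (by decide), State.real_setWord, hr2 _ (by decide), hr1 _ (by decide)]
  have hrange : ∀ i < N, lo < s4.real rSort i ∧ s4.real rSort i < hi := by
    intro i hi
    have : s4.real rSort i ∈ slice (s3.real rSort) 0 N := by
      rw [hr4]; exact mem_slice.2 ⟨i, Nat.zero_le _, hi, rfl⟩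
    rw [hp3] at this
    exact (Multiset.mem_filter.1 this).2
  obtain ⟨m1, l1, hm1⟩ := hgood.head _ _ hhead
  obtain ⟨m2, hm2⟩ := hgood.getLast _ _ hlast
  have hclog : Nat.clog 2 N ≤ Nat.clog 2 n := Nat.clog_mono_right _ hNn
  refine (runs_searchSortedProg (B := B) (N := N) (K := 0) (r := Nat.clog 2 n + 1) (Pr := Pr)
    (l := q) (R := R) (m := m1) (m' := m2) hH hD (by omega) hI (hl4.trans hit1)
    (by simp [hq, Compressed.items, hm1]) hm2
    (by rw [hr4]; exact hb3.sorted (Nat.le_pow_clog one_lt_two _)) (by rw [elo]; exact hlo0)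
    (fun i hi => by rw [elo, ehi]; exact ⟨(hrange i hi).1.le, (hrange i hi).2.le⟩)
    (fun i hi => ?_) (by rw [elo]; exact hPlo) (by rw [ehi]; exact hPhi) ?_ ?_ ?_ ?_).mono ?_
  · rw [hq, itemSum_compress hlo0 (hrange i hi).1.le (.inl (hrange i hi).2)]
    exact hP _ (hlo0.trans (hrange i hi).1.le)
  · have h1 : n ≤ 2 ^ Nat.clog 2 n := Nat.le_pow_clog one_lt_two _
    have h2 : 0 < 2 ^ Nat.clog 2 n := by positivity
    rw [pow_succ]
    omega
  · rw [← hs4]; simp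
  · rw [← hs4]; simp [hN3]
  · rw [← hs4]; simp
  rintro t5 s5 ⟨ht5, h1, h2, h3, h4, p, h5⟩
  rw [elo] at h3
  rw [ehi] at h4
  refine ⟨?_, h1, h2, h3, h4, fun i hi hc => ?_⟩
  · have e1 : (16 * N + 10) * Nat.clog 2 N ≤ (16 * U + 10) * Nat.clog 2 n := by
      rw [hNU] at hclog ⊢
      exact Nat.mul_le_mul_left _ hclog
    have e2 : (20 * q.length + 12) * (Nat.clog 2 n + 1)
        ≤ (20 * ((U + 1) * (2 * Λ.card + 1)) + 12) * (Nat.clog 2 n + 1) :=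
      Nat.mul_le_mul_right _ (by omega)
    omega
  · have : s.real rFrac i ∈ slice (s3.real rSort) 0 N := by
      rw [hp3, Multiset.mem_filter]
      exact ⟨mem_slice.2 ⟨i, Nat.zero_le _, hi, rfl⟩, h3.trans_lt hc.1, hc.2.trans_le h4⟩
    obtain ⟨j, -, hj, hj2⟩ := mem_slice.1 this
    rw [← hj2, ← hr4] at hc
    have := h5 j hj hc.1 hc.2
    omega

end RealRAM

/-! ### The running time -/

theorem clog_sq_le {n : ℕ} (hn : 0 < n) : Nat.clog 2 n * Nat.clog 2 n ≤ 3 * n := by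
  have key : ∀ k : ℕ, (k + 1) * (k + 1) ≤ 3 * 2 ^ k := by
    intro k
    induction k with
    | zero => norm_num
    | succ k ih =>
      rcases Nat.lt_or_ge k 2 with h | h
      · interval_cases k <;> norm_num
      · rw [pow_succ]
        nlinarith
  rcases Nat.eq_zero_or_pos (Nat.clog 2 n) with h | h
  · rw [h]; omega
  · obtain ⟨k, hk⟩ : ∃ k, Nat.clog 2 n = k + 1 := ⟨Nat.clog 2 n - 1, by omega⟩
    have h1 : 2 ^ k < n := (Nat.lt_clog_iff_pow_lt one_lt_two).1 (by omega)
    have := key k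
    rw [hk]
    omega

theorem two_pow_clog_le (m : ℕ) : 2 ^ Nat.clog 2 m ≤ 2 * m + 1 := by
  rcases Nat.eq_zero_or_pos (Nat.clog 2 m) with h | h
  · rw [h]; omega
  · obtain ⟨k, hk⟩ : ∃ k, Nat.clog 2 m = k + 1 := ⟨Nat.clog 2 m - 1, by omega⟩
    have h1 : 2 ^ k < m := (Nat.lt_clog_iff_pow_lt one_lt_two).1 (by omega)
    rw [hk, pow_succ]
    omega

/-- A binary search among `⌈log₂ n⌉` positions takes `O(log log n)` rounds. -/
theorem clog_clog_le (n : ℕ) :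
    (Nat.clog 2 (Nat.clog 2 n) + 1 : ℝ) ≤ 3 * max 1 (Real.logb 2 (Real.logb 2 n)) := by
  have hmax := le_max_left 1 (Real.logb 2 (Real.logb 2 n))
  rcases Nat.eq_zero_or_pos (Nat.clog 2 (Nat.clog 2 n)) with h | h
  · rw [h]; push_cast; linarith
  · obtain ⟨k, hk⟩ : ∃ k, Nat.clog 2 (Nat.clog 2 n) = k + 1 :=
      ⟨Nat.clog 2 (Nat.clog 2 n) - 1, by omega⟩
    have h1 : 2 ^ 2 ^ k < n := (Nat.lt_clog_iff_pow_lt one_lt_two).1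
      ((Nat.lt_clog_iff_pow_lt one_lt_two).1 (by omega))
    have h2 : ((2 : ℝ) ^ (2 ^ k : ℕ)) < n := by exact_mod_cast h1
    have h3 : ((2 : ℝ) ^ k) < Real.logb 2 n := by
      rw [Real.lt_logb_iff_rpow_lt one_lt_two (lt_trans (by positivity) h2)]
      rw [← Real.rpow_natCast] at h2
      push_cast at h2
      exact h2
    have h4 : (k : ℝ) < Real.logb 2 (Real.logb 2 n) := by
      rw [Real.lt_logb_iff_rpow_lt one_lt_two (lt_trans (by positivity) h3), Real.rpow_natCast]
      exact h3
    have h5 := le_max_right 1 (Real.logb 2 (Real.logb 2 n))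
    rw [hk]
    push_cast
    linarith

/-- The running times of the phases add up to `O(n d (a + 1))`, where `a` is the number of rounds of
the search in the sample. The costs of the search among the remaining fractions have a factor
`L = ⌈log₂ n⌉`, which the reduction of the problem by the factor `2 ^ a ≥ L` compensates. -/
theorem running_time_le {n d a L U Λ : ℕ} (hn : 0 < n) (hd : 0 < d) (hL : L ≤ n) (hLn : L * L ≤ 3 * n)
    (hLa : L ≤ 2 ^ a) (haL : 2 ^ a ≤ 2 * L + 1) (hU : U ≤ 2 * (n / 2 ^ a) + 2 ^ a + 1)
    (hΛ : Λ ≤ 2 * d + 1) :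
    (24 * n + 21) + ((20 * n + 54) * (a + 1) + 11)
      + ((16 * n + 10) * (2 * a) + (16 * (n / 2 ^ a) + 26) * L + 3 * n
        + (20 * (n + 2) + 12) * a + 13)
      + (20 * (n + 2) + 5 * (n + 2) + 5 * n + (16 * U + 10) * L
        + (20 * ((U + 1) * (2 * Λ + 1)) + 12) * (L + 1) + 20)
      + (42 * n + 24) ≤ 5000 * (n * d * (a + 1)) := by
  set Y := n * d * (a + 1) with hY
  have h1 : n * (a + 1) ≤ Y := by
    rw [hY]; exact Nat.mul_le_mul_right _ (Nat.le_mul_of_pos_right _ hd)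
  have h2 : n * d ≤ Y := Nat.le_mul_of_pos_right _ (Nat.succ_pos a)
  have h3 : n ≤ n * d := Nat.le_mul_of_pos_right _ hd
  have h4 : n / 2 ^ a * L ≤ n := (Nat.mul_le_mul_left _ hLa).trans (Nat.div_mul_le_self _ _)
  have h5 : n / 2 ^ a ≤ n := Nat.div_le_self _ _
  have h6 : 2 ^ a * L ≤ 7 * n := by
    calc 2 ^ a * L ≤ (2 * L + 1) * L := Nat.mul_le_mul_right _ haL
      _ = 2 * (L * L) + L := by ring
      _ ≤ 7 * n := by omega
  have h7 : U * L ≤ 10 * n := by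
    calc U * L ≤ (2 * (n / 2 ^ a) + 2 ^ a + 1) * L := Nat.mul_le_mul_right _ hU
      _ = 2 * (n / 2 ^ a * L) + 2 ^ a * L + L := by ring
      _ ≤ 10 * n := by omega
  have h8 : (U + 1) * (L + 1) ≤ 18 * n := by
    calc (U + 1) * (L + 1) = U * L + U + L + 1 := by ring
      _ ≤ 18 * n := by omega
  have h9 : (U + 1) * (2 * Λ + 1) * (L + 1) ≤ 126 * (n * d) := by
    calc (U + 1) * (2 * Λ + 1) * (L + 1) = (U + 1) * (L + 1) * (2 * Λ + 1) := by ring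
      _ ≤ 18 * n * (7 * d) := Nat.mul_le_mul h8 (by omega)
      _ = 126 * (n * d) := by ring
  have e1 : (20 * n + 54) * (a + 1) ≤ 74 * (n * (a + 1)) := by
    rw [← Nat.mul_assoc]; exact Nat.mul_le_mul_right _ (by omega)
  have e2 : (16 * n + 10) * (2 * a) ≤ 52 * (n * (a + 1)) := by
    calc (16 * n + 10) * (2 * a) ≤ 26 * n * (2 * (a + 1)) := Nat.mul_le_mul (by omega) (by omega)
      _ = 52 * (n * (a + 1)) := by ring
  have e3 : (16 * (n / 2 ^ a) + 26) * L ≤ 42 * n := by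
    calc (16 * (n / 2 ^ a) + 26) * L = 16 * (n / 2 ^ a * L) + 26 * L := by ring
      _ ≤ 42 * n := by omega
  have e4 : (20 * (n + 2) + 12) * a ≤ 72 * (n * (a + 1)) := by
    rw [← Nat.mul_assoc]; exact Nat.mul_le_mul (by omega) (by omega)
  have e5 : (16 * U + 10) * L ≤ 170 * n := by
    calc (16 * U + 10) * L = 16 * (U * L) + 10 * L := by ring
      _ ≤ 170 * n := by omega
  have e6 : (20 * ((U + 1) * (2 * Λ + 1)) + 12) * (L + 1) ≤ 2520 * (n * d) + 24 * n := by
    calc (20 * ((U + 1) * (2 * Λ + 1)) + 12) * (L + 1)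
        = 20 * ((U + 1) * (2 * Λ + 1) * (L + 1)) + 12 * (L + 1) := by ring
      _ ≤ 2520 * (n * d) + 24 * n := by omega
  omega

namespace RealRAM

/-! ### The whole program -/

theorem countP_wallItems {n R : ℕ} {a : ℕ → ℕ} {F : ℕ → ℝ} {lo hi : ℝ} (hlo : 0 ≤ lo) :
    (wallItems n R a F).countP (fun e => lo < e.2.2 ∧ e.2.2 < hi)
      = (slice F 0 n).countP fun x => lo < x ∧ x < hi := by
  have key : ∀ p ≤ n, (itemList (fun i => if i = 0 ∨ i = n + 1 then R else a (i - 1)) (fun _ => 1)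
      (fun i => if i = 0 ∨ i = n + 1 then 0 else F (i - 1)) (p + 1)).countP
        (fun e => lo < e.2.2 ∧ e.2.2 < hi) = (slice F 0 p).countP fun x => lo < x ∧ x < hi := by
    intro p hp
    induction p with
    | zero => simp [itemList, slice_self, not_lt.2 hlo]
    | succ p ih =>
      have h1 : ¬ (p + 1 = 0 ∨ p + 1 = n + 1) := by omega
      rw [itemList, List.countP_cons, ih (by omega), slice_succ _ (Nat.zero_le p),
        Multiset.countP_add]
      simp only [if_neg h1, Nat.add_sub_cancel]
      congr 1
      by_cases h2 : lo < F p ∧ F p < hi <;>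
        simp [Multiset.countP_eq_card_filter, Multiset.filter_singleton, h2]
  rw [wallItems, itemList, List.countP_cons, key n le_rfl]
  simp [not_lt.2 hlo]

/-- Compute an alphabetic minimax tree. -/
def minimaxProg : Program :=
  initProg ⨾ rootProg ⨾ searchSampleProg ⨾ searchRestProg ⨾ buildProg

/-- The heights that compression can produce: the one of the root, and at most two for each
rounded weight. -/
theorem exists_heights (n h : ℕ) (w : ℕ → ℝ) (c : ℤ) : ∃ Λ : Finset ℕ,
    Λ.card ≤ 2 * ((Finset.range n).image fun i => ⌈w i⌉).card + 1 ∧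
    (∀ x, x ∈ Λ ↔ x = n + h ∨ ∃ i < n, x = baseHeight n c (w i) ∨ x = baseHeight n c (w i) + 1) := by
  set S := (Finset.range n).image fun i => ⌈w i⌉ with hS
  refine ⟨insert (n + h) ((S.image fun z => ((n : ℤ) - c + z).toNat) ∪
    S.image fun z => ((n : ℤ) - c + z).toNat + 1), ?_, fun x => ?_⟩
  · refine (Finset.card_insert_le _ _).trans (Nat.add_le_add_right ?_ 1)
    refine (Finset.card_union_le _ _).trans ?_
    rw [two_mul]
    exact Nat.add_le_add Finset.card_image_le Finset.card_image_le
  · simp only [Finset.mem_insert, Finset.mem_union, Finset.mem_image, hS, Finset.mem_range,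
      exists_exists_and_eq_and, baseHeight]
    constructor
    · rintro (h | ⟨i, hi, h⟩ | ⟨i, hi, h⟩)
      · exact .inl h
      · exact .inr ⟨i, hi, .inl h.symm⟩
      · exact .inr ⟨i, hi, .inr h.symm⟩
    · rintro (h | ⟨i, hi, h | h⟩)
      · exact .inl h
      · exact .inr (.inl ⟨i, hi, h.symm⟩)
      · exact .inr (.inr ⟨i, hi, h.symm⟩)

theorem runs_minimaxProg {B n : ℕ} {w : ℕ → ℝ} {s : State} (hn : 0 < n) (hB : 9 * (n + 2) ^ 2 ≤ B)
    (hN : s.word 0 0 = n) (hw : ∀ i < n, s.real rW i = w i) (hI : s.real rItem = fun _ => 0)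
    (hfresh : ∀ v, s.word 1 v = 0 ∧ s.word 2 v = 0) :
    Runs B minimaxProg s fun t s' =>
      t ≤ 5000 * (n * ((Finset.range n).image fun i => ⌈w i⌉).card *
        (Nat.clog 2 (Nat.clog 2 n) + 1)) ∧
      ∃ T : BinTree, Outputs s' T ∧ T.IsAlphabeticMinimax fun i : Fin n => w i := by
  set L := Nat.clog 2 n with hLdef
  set a := Nat.clog 2 L with hadef
  have hLn : L ≤ n := clog_two_le n
  have haL : 2 ^ a ≤ 2 * L + 1 := two_pow_clog_le L
  have hB1 : 2 * n + 2 < B := by nlinarith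
  have hB2 : 2 * (2 ^ a * 2 ^ a) < B := by
    have : 2 ^ a * 2 ^ a ≤ (2 * n + 1) * (2 * n + 1) := Nat.mul_le_mul (by omega) (by omega)
    nlinarith
  refine .seq ((runs_initProg hn hB1 hN hw hI hfresh).mono ?_)
  rintro t1 s1 ⟨ht1, c, hle, hex, hready, hleaves, hsort⟩
  refine .seq ((runs_rootProg hB1 hn hle hex hready hleaves.log).frame.mono ?_)
  rintro t2 s2 ⟨⟨ht2, h, hhL, hroot, hlo2, hhi2, hF0, hF1, hI2, hit2⟩, hw2, hr2⟩
  have hleaves2 : Leaves n (fun i => baseHeight n c (w i)) (fun i => fraction (w i)) s2 :=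
    hleaves.of_eq (fun b hb => hw2 b (by
      simp only [List.mem_cons, List.not_mem_nil, or_false] at hb
      rcases hb with rfl | rfl | rfl | rfl | rfl | rfl | rfl <;> decide)) (hr2 _ (by decide))
  have hsort2 : ∀ i < n, s2.real rSort i = fraction (w i) := by
    rw [hr2 rSort (by decide)]; exact hsort
  have hP : ∀ f, 0 ≤ f → (itemSum f (wallItems n (n + h) (fun i => baseHeight n c (w i))
      fun i => fraction (w i)) ≤ 3 * 2 ^ (n + h) ↔ Feasible n w c h f) :=
    fun f hf => itemSum_wallItems_le_iff hf
  have hlenl : (wallItems n (n + h) (fun i => baseHeight n c (w i))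
      fun i => fraction (w i)).length = n + 2 := by rw [wallItems, length_itemList]
  refine .seq ((runs_searchSampleProg (B := B) (a := a) (Pr := Feasible n w c h) hn (by omega) hB2
    (by omega) (by omega) hleaves2.num hleaves2.stride hI2 hit2 (head?_wallItems _ _ _ _)
    (getLast?_wallItems _ _ _ _) hlo2.ge (fun i hi => ?_) hP (by rw [hlo2]; exact hF0)
    (by rw [hhi2]; exact hF1)).frame.mono ?_)
  · rw [hsort2 i hi, hlo2, hhi2]
    exact ⟨(fraction_pos _).le, fraction_le_one _⟩
  rintro t3 s3 ⟨⟨ht3, hFlo3, hFhi3, hlo3, hhi3, hU⟩, hw3, hr3⟩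
  rw [hlo2] at hlo3
  rw [hhi2] at hhi3
  rw [hlenl] at ht3
  have hleaves3 : Leaves n (fun i => baseHeight n c (w i)) (fun i => fraction (w i)) s3 :=
    hleaves2.of_eq (fun b hb => hw3 b (by
      simp only [List.mem_cons, List.not_mem_nil, or_false] at hb
      rcases hb with rfl | rfl | rfl | rfl | rfl | rfl | rfl <;> decide)) (hr3 _ (by decide))
  obtain ⟨hI3, hit3⟩ := hI2.of_eq (s' := s3) (fun b hb => hw3 b (by
      simp only [List.mem_cons, List.not_mem_nil, or_false] at hb
      rcases hb with rfl | rfl | rfl | rfl <;> decide)) (hr3 _ (by decide))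
  obtain ⟨Λ, hΛcard, hΛ⟩ := exists_heights n h w c
  have hfrac : slice (s3.real rFrac) 0 n = slice (fun i => fraction (w i)) 0 n :=
    slice_congr fun i _ hi => hleaves3.frac i hi
  have hsl : slice (s2.real rSort) 0 n = slice (fun i => fraction (w i)) 0 n :=
    slice_congr fun i _ hi => hsort2 i hi
  rw [hsl] at hU
  refine .seq ((runs_searchRestProg (B := B) (Λ := Λ) (Pr := Feasible n w c h) hn (by omega)
    (by omega) (by omega) hleaves3.num hI3 (hit3.trans hit2) (head?_wallItems _ _ _ _)
    (getLast?_wallItems _ _ _ _) ?_ ?_ hlo3 hP hFlo3 hFhi3 (congrArg _ hfrac)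
    (countP_wallItems hlo3)).frame.mono ?_)
  · rw [wallItems, forall_mem_itemList]
    intro i hi
    simp only [hΛ]
    split_ifs with h1
    · exact ⟨.inl rfl, fun h => absurd h (lt_irrefl _)⟩
    · exact ⟨.inr ⟨i - 1, by omega, .inl rfl⟩, fun _ => .inr ⟨i - 1, by omega, .inr rfl⟩⟩
  · intro x hx
    rcases (hΛ x).1 hx with rfl | ⟨i, hi, h1⟩
    · omega
    · have := baseHeight_le (n := n) (hle i hi)
      omega
  rintro t4 s4 ⟨⟨ht4, hFlo4, hFhi4, hlo4, hhi4, hgap⟩, hw4, hr4⟩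
  rw [hlenl] at ht4
  have hleaves4 : Leaves n (fun i => baseHeight n c (w i)) (fun i => fraction (w i)) s4 :=
    hleaves3.of_eq (fun b hb => hw4 b (by
      simp only [List.mem_cons, List.not_mem_nil, or_false] at hb
      rcases hb with rfl | rfl | rfl | rfl | rfl | rfl | rfl <;> decide)) (hr4 _ (by decide))
  refine (runs_buildProg (B := B) (R := n + h) (k := fun i => leafHeight n c (s4.real rHi 0) (w i))
    hn hB1 (by omega) hleaves4.num ?_ (fun i hi => ?_) hleaves4.fresh hFhi4.kraft_le).mono ?_
  · rw [hw4 vRoot (by decide), hw3 vRoot (by decide), hroot]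
  · rw [hleaves4.height i hi, hleaves4.frac i hi, leafHeight]
  rintro t5 s5 ⟨ht5, T, hT, hout, hdepth⟩
  have hhi0 : 0 ≤ s4.real rHi 0 := by
    by_contra hneg
    exact hF0 (hFhi4.mono (not_le.1 hneg).le)
  refine ⟨?_, T, hout, isAlphabeticMinimax_of hn hhi0 (hhi4.trans hhi3) hFlo4 hFhi4
    (fun i hi => ?_) hT hdepth⟩
  · have hd : 0 < ((Finset.range n).image fun i => ⌈w i⌉).card :=
      Finset.card_pos.2 ⟨_, Finset.mem_image_of_mem _ (Finset.mem_range.2 hn)⟩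
    refine le_trans ?_ (running_time_le hn hd hLn (clog_sq_le hn) (Nat.le_pow_clog one_lt_two _) haL
      hU hΛcard)
    rw [← hLdef, ← hadef] at ht2
    rw [← hLdef] at ht3 ht4
    omega
  · have := hgap i hi
    rwa [hleaves3.frac i hi] at this

end RealRAM

theorem theorem1 :
    ∃ (P : RealRAM.Program) (k : ℕ) (C : ℝ),
      ∀ (n : ℕ) (_ : 1 ≤ n) (w : Fin n → ℝ),
        ∃ (t : ℕ) (s : RealRAM.State) (T : BinTree),
          RealRAM.Exec ((n + 2) ^ k) P (RealRAM.inputState w) t s ∧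
          (t : ℝ) ≤ C * (n * numCeils w * max 1 (Real.logb 2 (Real.logb 2 n))) ∧
          RealRAM.Outputs s T ∧
          T.IsAlphabeticMinimax w := by
  -- The exponent `4` leaves room for the squared stride, which is at most `(2 n + 1) ^ 2`. The constant
  -- is that of `running_time_le`, times the one of `clog_clog_le`.
  refine ⟨RealRAM.minimaxProg, 4, 15000, fun n hn w => ?_⟩
  set W : ℕ → ℝ := fun i => if h : i < n then w ⟨i, h⟩ else 0 with hW
  have hWw : (fun i : Fin n => W i) = w := by
    funext i
    simp [hW]
  obtain ⟨t, s, hexec, ht, T, hout, hT⟩ := RealRAM.runs_minimaxProg (B := (n + 2) ^ 4) (n := n)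
    (w := W) (s := RealRAM.inputState w) hn
    (by
      rw [show (n + 2) ^ 4 = (n + 2) ^ 2 * (n + 2) ^ 2 by ring]
      exact Nat.mul_le_mul_right _ (by nlinarith))
    (by simp [RealRAM.inputState]) (fun i hi => by simp [RealRAM.inputState, hW])
    (by funext i; simp [RealRAM.inputState]) (fun v => by simp [RealRAM.inputState])
  rw [hWw] at hT
  refine ⟨t, s, T, hexec, ?_, hout, hT⟩
  have hd : ((Finset.range n).image fun i => ⌈W i⌉).card ≤ numCeils w := by
    refine Finset.card_le_card fun z hz => ?_
    obtain ⟨i, hi, rfl⟩ := Finset.mem_image.1 hz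
    rw [Finset.mem_range] at hi
    exact Finset.mem_image.2 ⟨⟨i, hi⟩, Finset.mem_univ _, by simp [hW, hi]⟩
  have ht' : t ≤ 5000 * (n * numCeils w * (Nat.clog 2 (Nat.clog 2 n) + 1)) :=
    ht.trans (by gcongr)
  calc (t : ℝ) ≤ 5000 * (n * numCeils w * (Nat.clog 2 (Nat.clog 2 n) + 1)) := by exact_mod_cast ht'
    _ ≤ 5000 * (n * numCeils w * (3 * max 1 (Real.logb 2 (Real.logb 2 n)))) := by
      gcongr
      exact clog_clog_le n
    _ = 15000 * (n * numCeils w * max 1 (Real.logb 2 (Real.logb 2 n))) := by ring
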